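/- Let $X$ be a Banach space and $\mathcal B(X)$ the bounded linear operators on $X$ with the operator norm. For $U:[a,b]\times[a,b]\to E$ ($E$ a Banach space), $\int_a^b DU(\tau,t)=J$ denotes the Kurzweil integral: for every $\epsilon>0$ there is a gauge $\delta:[a,b]\to(0,\infty)$ such that $\big\|\sum_{j}[U(\tau_j,s_j)-U(\tau_j,s_{j-1})]-J\big\|<\epsilon$ for all divisions $a=s_0\le\dots\le s_n=b$ with tags $\tau_j\in[s_{j-1},s_j]\subset(\tau_j-\delta(\tau_j),\tau_j+\delta(\tau_j))$; and $\int_b^a=-\int_a^b$. A function $x:\mathbb R\to X$ is a solution of the generalized ODE $\frac{dx}{d\tau}=D[G(x,t)]$ if $x(b)=x(a)+\int_a^bDG(x(\tau),t)$ for all $a,b\in\mathbb R$, the integral existing. Let $K,C>0$. Then there is $\delta>0$, depending only on $K$ and $C$ (for the given space $X$), such that the following holds. Let $\alpha>0$, $A:\mathbb R\to\mathcal B(X)$, $F:X\times\mathbb R\to X$ and $h:\mathbb R\to\mathbb R$ satisfy: 1. $A$ has bounded variation on every compact interval, and for every $t\in\mathbb R$ the operators $I+[A(t^+)-A(t)]$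 and $I-[A(t)-A(t^-)]$ are invertible in $\mathcal B(X)$ with inverses of norm at most $C$. 2. The linear equation $\frac{dx}{d\tau}=D[A(t)x]$ has an exponential dichotomy on $\mathbb R$ with constants $K,\alpha$: with $V(t,s)=I+\int_s^t d[A(r)]V(r,s)$ its fundamental operator ($V(\cdot,s)$ locally of bounded variation), $\mathcal V(t)=V(t,0)$ and $\mathcal V^{-1}(t)=V(0,t)$, there is a projection $P\in\mathcal B(X)$ with $\|\mathcal V(t)P\mathcal V^{-1}(s)\|\le Ke^{-\alpha(t-s)}$ for $t\ge s$ and $\|\mathcal V(t)(I-P)\mathcal V^{-1}(s)\|\le Ke^{\alpha(t-s)}$ for $t<s$. 3. $h$ is nondecreasing with total variation $V_h=\sup_{a<b}\mathrm{var}_a^b h\le\delta$, and $F\in\mathscr F(\Omega,h)$ with $\Omega=X\times\mathbb R$, that is, for all $x,z\in X$ and $t_1,t_2\in\mathbb R$, $\|F(x,t_2)-F(x,t_1)\|\le|h(t_2)-h(t_1)|$ and $\|F(x,t_2)-F(x,t_1)-F(z,t_2)+F(z,t_1)\|\le\|x-z\|\,|h(t_2)-h(t_1)|$. Then the nonlinear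 equation $\frac{dx}{d\tau}=D[A(t)x+F(x,t)]$ is topologically conjugate to the linear equation $\frac{dx}{d\tau}=D[A(t)x]$ in the sense of Palmer: there are maps $\Phi(t,x)=x+\phi(t,x)$ and $\Psi(t,x)=x+\psi(t,x)$ from $\mathbb R\times X$ to $X$, with $\phi,\psi$ bounded on $\mathbb R\times X$, such that for every $t$ the map $\Phi(t,\cdot)$ is a homeomorphism of $X$ onto $X$ with inverse $\Psi(t,\cdot)$; if $x(t)$ is a solution of the linear equation then $\Phi(t,x(t))$ is a solution of the nonlinear one; and if $y(t)$ is a solution of the nonlinear equation then $\Psi(t,y(t))$ is a solution of the linear one. (No bound on the total variation of $A$ over all of $\mathbb R$ is assumed; the case $\sup_{a<b}\mathrm{var}_a^bA<\infty$ is included.) -/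

import Mathlib

open Set Filter Topology

section Kurzweil

variable {E : Type*} [NormedAddCommGroup E] [NormedSpace ℝ E]

/-- A tagged division of `[a, b]`: points `a = s₀ ≤ s₁ ≤ ⋯ ≤ sₙ = b` (`pt j = sⱼ`) and tags
`tag j ∈ [sⱼ, sⱼ₊₁]` for `j < n`. Only `pt 0, …, pt n` and `tag 0, …, tag (n - 1)` matter. -/
structure TaggedDivision (a b : ℝ) where
  n : ℕ
  pt : ℕ → ℝ
  tag : ℕ → ℝ
  pt_zero : pt 0 = a
  pt_last : pt n = b
  pt_le : ∀ j < n, pt j ≤ pt (j + 1)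
  tag_mem : ∀ j < n, tag j ∈ Icc (pt j) (pt (j + 1))

/-- A tagged division is fine for a gauge `δ` if each of its intervals `[sⱼ, sⱼ₊₁]` with tag `τ`
lies in `(τ - δ τ, τ + δ τ)`. -/
def TaggedDivision.IsFine {a b : ℝ} (D : TaggedDivision a b) (δ : ℝ → ℝ) : Prop :=
  ∀ j < D.n, Icc (D.pt j) (D.pt (j + 1)) ⊆
    Ioo (D.tag j - δ (D.tag j)) (D.tag j + δ (D.tag j))

/-- The sum `∑ⱼ (U(τⱼ, sⱼ₊₁) - U(τⱼ, sⱼ))`. -/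
def TaggedDivision.kurzweilSum {a b : ℝ} (D : TaggedDivision a b) (U : ℝ → ℝ → E) : E :=
  ∑ j ∈ Finset.range D.n, (U (D.tag j) (D.pt (j + 1)) - U (D.tag j) (D.pt j))

/-- For `a ≤ b`: `U` is Kurzweil integrable on `[a, b]` and `∫_a^b DU(τ, t) = J`. -/
def HasKurzweilIntegralOn (U : ℝ → ℝ → E) (a b : ℝ) (J : E) : Prop :=
  ∀ ε > 0, ∃ δ : ℝ → ℝ, (∀ τ ∈ Icc a b, 0 < δ τ) ∧
    ∀ D : TaggedDivision a b, D.IsFine δ → ‖D.kurzweilSum U - J‖ < ε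

/-- The oriented Kurzweil integral, `∫_a^b = -∫_b^a` when `b < a`. -/
def HasKurzweilIntegral (U : ℝ → ℝ → E) (a b : ℝ) (J : E) : Prop :=
  (a ≤ b → HasKurzweilIntegralOn U a b J) ∧ (b < a → HasKurzweilIntegralOn U b a (-J))

/-- `x` is a solution on `ℝ` of the generalized ODE `dx/dτ = D[G(x, t)]`, that is,
`x(b) = x(a) + ∫_a^b DG(x(τ), t)` for all `a`, `b`, the integral existing in the Kurzweil
sense. -/
def IsGODESolution (G : E → ℝ → E) (x : ℝ → E) : Prop :=
  ∀ a b : ℝ, HasKurzweilIntegral (fun τ t => G (x τ) t) a b (x b - x a)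

end Kurzweil

section GODE

variable {X : Type*} [NormedAddCommGroup X] [NormedSpace ℝ X]

/-- `V` is the fundamental operator of `dx/dτ = D[A(t)x]`:
`V(t, s) = I + ∫_s^t d[A(r)] V(r, s)` (a Kurzweil integral with values in the bounded operators),
and `V(·, s)` is of locally bounded variation for each `s`. -/
def IsFundamentalOperator (A : ℝ → X →L[ℝ] X) (V : ℝ → ℝ → X →L[ℝ] X) : Prop :=
  (∀ t s : ℝ, HasKurzweilIntegral (fun r u => (A u).comp (V r s)) s t
    (V t s - ContinuousLinearMap.id ℝ X)) ∧
  ∀ s : ℝ, LocallyBoundedVariationOn (fun t => V t s) univ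

/-- The linear equation `dx/dτ = D[A(t)x]` has an exponential dichotomy on `ℝ` with constants
`K, α > 0`; here `V t 0` is the operator written `𝒱(t)` and `V 0 s` is its inverse `𝒱⁻¹(s)`. -/
def HasExponentialDichotomy (A : ℝ → X →L[ℝ] X) (K α : ℝ) : Prop :=
  0 < K ∧ 0 < α ∧ ∃ V : ℝ → ℝ → X →L[ℝ] X, IsFundamentalOperator A V ∧
    ∃ P : X →L[ℝ] X, P.comp P = P ∧
      (∀ t s : ℝ, s ≤ t → ‖((V t 0).comp P).comp (V 0 s)‖ ≤ K * Real.exp (-α * (t - s))) ∧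
      (∀ t s : ℝ, t < s →
        ‖((V t 0).comp (ContinuousLinearMap.id ℝ X - P)).comp (V 0 s)‖
          ≤ K * Real.exp (α * (t - s)))

/-- For every `t` the operators `I + (A(t⁺) - A(t))` and `I - (A(t) - A(t⁻))` have inverses in the
bounded operators, of norm at most `C`. (Used for `A` of locally bounded variation, for which the
one-sided limits exist.) -/
def JumpsInvertible (A : ℝ → X →L[ℝ] X) (C : ℝ) : Prop :=
  ∀ t : ℝ,
    (IsUnit (1 + (Function.rightLim A t - A t)) ∧
      ‖Ring.inverse (1 + (Function.rightLim A t - A t))‖ ≤ C) ∧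
    (IsUnit (1 - (A t - Function.leftLim A t)) ∧
      ‖Ring.inverse (1 - (A t - Function.leftLim A t))‖ ≤ C)

/-- `F` belongs to the class `𝓕(Ω, h)`, `Ω = X × ℝ`. -/
def InClassF (F : X → ℝ → X) (h : ℝ → ℝ) : Prop :=
  (∀ x t₁ t₂, ‖F x t₂ - F x t₁‖ ≤ |h t₂ - h t₁|) ∧
  ∀ x z t₁ t₂, ‖F x t₂ - F x t₁ - F z t₂ + F z t₁‖ ≤ ‖x - z‖ * |h t₂ - h t₁|

/-- Topological conjugacy, in the sense of Palmer, of `dx/dτ = D[G₁(x, t)]` and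
`dx/dτ = D[G₂(x, t)]` through `Φ` and `Ψ`: for each `t`, `Φ(t, ·)` is a homeomorphism of `X` with
inverse `Ψ(t, ·)`; `Φ(t, x) - x` and `Ψ(t, x) - x` are bounded on `ℝ × X`; `Φ` carries solutions
of the first equation to solutions of the second, and `Ψ` does the converse. -/
structure IsTopologicalConjugacy (G₁ G₂ : X → ℝ → X) (Φ Ψ : ℝ → X → X) : Prop where
  continuous_toFun : ∀ t, Continuous (Φ t)
  continuous_invFun : ∀ t, Continuous (Ψ t)
  left_inv : ∀ t x, Ψ t (Φ t x) = x
  right_inv : ∀ t x, Φ t (Ψ t x) = x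
  bounded_toFun : ∃ M : ℝ, ∀ t x, ‖Φ t x - x‖ ≤ M
  bounded_invFun : ∃ M : ℝ, ∀ t x, ‖Ψ t x - x‖ ≤ M
  map_solution : ∀ x : ℝ → X, IsGODESolution G₁ x → IsGODESolution G₂ (fun t => Φ t (x t))
  map_solution_inv : ∀ y : ℝ → X, IsGODESolution G₂ y → IsGODESolution G₁ (fun t => Ψ t (y t))

end GODE

/-! Fix a monotone η that dominates the increments of A and of h. A function x solves one of the
generalized ODEs considered here exactly when, at every τ, x s - x τ equals G (x τ) s - G (x τ) τ up
to o(|η s - η τ|) as s → τ (`IsGODESolution.isPrimOn`, `isGODESolution_of_isPrimOn`). Where η jumps,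
this prescribes the one-sided limits of x. Such local primitives replace the Kurzweil integral: a
mean value inequality (`norm_sub_le_of_local`), which follows from Cousin's lemma, gives uniqueness
and the estimates, and a sewing lemma (`IsAlmostAdditiveOn.exists_isPrimOn_Icc`) gives existence.

Invertible jumps make linear solutions unique in both time directions, so 𝒱 has an inverse W. In the
coordinates y = 𝒱 u, the perturbed equation says that u is a primitive of W s (F (y τ) s - F (y τ)
τ). The dichotomy kernels are bounded by K. Hence a primitive v for which 𝒱 v is bounded satisfies
‖𝒱 v‖ ≤ 2K times the oscillation of its control (`IsDichotomy.norm_apply_le_of_bounded`), and every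
primitive with bounded control becomes of this kind after subtracting one constant
(`IsDichotomy.exists_sub_bounded`). The exponential rate only removes boundary terms at infinity, so
α does not enter δ.

For small Kδ a contraction yields, for each u, exactly one perturbed solution Y u at bounded
distance from 𝒱 u. Conversely, each perturbed solution y is at bounded distance from 𝒱 (U y) for a
single U y, and Y and U are mutually inverse. For small (C + 2)δ a perturbed solution Z t x passes
through each (t, x), and it is unique (`IsFundamentalPair.hasFlow`). Then Φ t x = Y (W t x) t and Ψ
t x = 𝒱 t (U (Z t x)).

No Lipschitz bound uniform in time is available for continuity, since solutions may diverge
exponentially. Instead, nearby data keep solutions close on [-T, T], while outside [-T, T] the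
perturbation has small variation whatever the solutions do (`exists_truncated_control`,
`IsDichotomy.norm_sub_sub_le`). -/

/-! ### Calculus of local primitives relative to a monotone control function. -/

section LocalPrimitives

variable {E : Type*} [NormedAddCommGroup E]

/-- Induction on intervals (Cousin's lemma). -/
theorem interval_induction {Q : ℝ → ℝ → Prop} {a b : ℝ} (hab : a ≤ b)
    (trans : ∀ x y z, a ≤ x → x ≤ y → y ≤ z → z ≤ b → Q x y → Q y z → Q x z)
    (loc : ∀ τ ∈ Icc a b, ∀ᶠ s in 𝓝[Icc a b] τ, (s ≤ τ → Q s τ) ∧ (τ ≤ s → Q τ s)) :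
    Q a b := by
  have loc' : ∀ τ ∈ Icc a b, ∃ r > 0, ∀ s ∈ Icc a b, |s - τ| < r →
      (s ≤ τ → Q s τ) ∧ (τ ≤ s → Q τ s) := by
    intro τ hτ
    obtain ⟨r, hr, h⟩ := Metric.mem_nhdsWithin_iff.1 (loc τ hτ)
    refine ⟨r, hr, fun s hs hsr => h ⟨?_, hs⟩⟩
    simpa [Real.dist_eq] using hsr
  set T : Set ℝ := {t | t ∈ Icc a b ∧ Q a t} with hT
  have haT : a ∈ T := by
    obtain ⟨r, hr, h⟩ := loc' a ⟨le_rfl, hab⟩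
    exact ⟨⟨le_rfl, hab⟩, (h a ⟨le_rfl, hab⟩ (by simpa using hr)).1 le_rfl⟩
  have hbdd : BddAbove T := ⟨b, fun t ht => ht.1.2⟩
  set c := sSup T with hc
  have hac : a ≤ c := le_csSup hbdd haT
  have hcb : c ≤ b := csSup_le ⟨a, haT⟩ fun t ht => ht.1.2
  obtain ⟨r, hr, h⟩ := loc' c ⟨hac, hcb⟩
  obtain ⟨t, htT, htc⟩ := exists_lt_of_lt_csSup ⟨a, haT⟩ (show c - r < sSup T by linarith)
  have htc' : t ≤ c := le_csSup hbdd htT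
  have hQc : Q a c := by
    refine trans a t c le_rfl htT.1.1 htc' hcb htT.2 ((h t htT.1 ?_).1 htc')
    rw [abs_lt]; constructor <;> linarith
  rcases eq_or_lt_of_le hcb with hcb' | hcb'
  · rwa [← hcb']
  · exfalso
    have h1 : c < min b (c + r / 2) := lt_min hcb' (by linarith)
    have h2 : min b (c + r / 2) ≤ c + r / 2 := min_le_right _ _
    have h3 : min b (c + r / 2) ∈ Icc a b := ⟨by linarith, min_le_left _ _⟩
    have h4 : Q c (min b (c + r / 2)) := by
      refine (h _ h3 ?_).2 h1.le
      rw [abs_lt]; constructor <;> linarith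
    have h5 : min b (c + r / 2) ∈ T := ⟨h3, trans _ _ _ le_rfl hac h1.le h3.2 hQc h4⟩
    exact absurd (le_csSup hbdd h5) (not_le.2 h1)

/-- Mean value inequality with respect to monotone control functions. -/
theorem norm_sub_le_of_local {g : ℝ → E} {m η : ℝ → ℝ} {a b : ℝ} (hab : a ≤ b)
    (hm : Monotone m) (hη : Monotone η)
    (H : ∀ ε > 0, ∀ τ ∈ Icc a b, ∀ᶠ s in 𝓝[Icc a b] τ,
      ‖g s - g τ‖ ≤ |m s - m τ| + ε * |η s - η τ|) :
    ‖g b - g a‖ ≤ m b - m a := by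
  have key : ∀ ε > 0, ‖g b - g a‖ ≤ (m b - m a) + ε * (η b - η a) := by
    intro ε hε
    refine interval_induction (Q := fun x y => ‖g y - g x‖ ≤ (m y - m x) + ε * (η y - η x)) hab
      ?_ ?_
    · intro x y z _ _ _ _ h1 h2
      have : g z - g x = (g z - g y) + (g y - g x) := by abel
      calc ‖g z - g x‖ ≤ ‖g z - g y‖ + ‖g y - g x‖ := by rw [this]; exact norm_add_le _ _
        _ ≤ _ := by nlinarith
    · intro τ hτ
      filter_upwards [H ε hε τ hτ] with s hs
      refine ⟨fun h => ?_, fun h => ?_⟩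
      · rw [abs_sub_comm, abs_of_nonneg (sub_nonneg.2 (hm h)), abs_sub_comm (η s),
          abs_of_nonneg (sub_nonneg.2 (hη h))] at hs
        rwa [norm_sub_rev]
      · rwa [abs_of_nonneg (sub_nonneg.2 (hm h)), abs_of_nonneg (sub_nonneg.2 (hη h))] at hs
  refine le_of_forall_pos_le_add fun ε hε => ?_
  have h0 : 0 ≤ η b - η a := sub_nonneg.2 (hη hab)
  refine (key (ε / (η b - η a + 1)) (by positivity)).trans ?_
  have : ε / (η b - η a + 1) * (η b - η a) ≤ ε := by
    rw [div_mul_eq_mul_div, div_le_iff₀ (by positivity)]; nlinarith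
  linarith

/-- `g` is a primitive of the increments `H` on `S`, up to errors of size `ε` with respect to the
control function `η`. -/
def IsApproxPrimOn (η : ℝ → ℝ) (ε : ℝ) (S : Set ℝ) (H : ℝ → ℝ → E) (g : ℝ → E) : Prop :=
  ∀ τ ∈ S, ∀ᶠ s in 𝓝[S] τ, ‖g s - g τ - H τ s‖ ≤ ε * |η s - η τ|

/-- `g` is a primitive of the increments `H` on `S`, up to errors negligible with respect to the
control function `η`. -/
def IsPrimOn (η : ℝ → ℝ) (S : Set ℝ) (H : ℝ → ℝ → E) (g : ℝ → E) : Prop :=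
  ∀ ε > 0, IsApproxPrimOn η ε S H g

namespace IsApproxPrimOn

variable {η : ℝ → ℝ} {ε : ℝ} {S T : Set ℝ} {H H' : ℝ → ℝ → E} {g g' : ℝ → E} {a b c : ℝ}

theorem mono (h : IsApproxPrimOn η ε T H g) (hST : S ⊆ T) : IsApproxPrimOn η ε S H g :=
  fun τ hτ => (h τ (hST hτ)).filter_mono (nhdsWithin_mono _ hST)

theorem congr (h : IsApproxPrimOn η ε S H g) (hH : ∀ τ ∈ S, ∀ s ∈ S, H τ s = H' τ s)
    (hg : ∀ s ∈ S, g s = g' s) : IsApproxPrimOn η ε S H' g' := by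
  intro τ hτ
  filter_upwards [h τ hτ, self_mem_nhdsWithin] with s hs hsS
  rwa [← hH τ hτ s hsS, ← hg s hsS, ← hg τ hτ]

theorem sub_const (h : IsApproxPrimOn η ε S H g) (c : E) :
    IsApproxPrimOn η ε S H (fun s => g s - c) := by
  intro τ hτ
  filter_upwards [h τ hτ] with s h1
  simpa using h1

theorem union_Icc (h₁ : IsApproxPrimOn η ε (Icc a b) H g) (h₂ : IsApproxPrimOn η ε (Icc b c) H g)
    (hab : a ≤ b) (hbc : b ≤ c) : IsApproxPrimOn η ε (Icc a c) H g := by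
  intro τ hτ
  rcases lt_trichotomy τ b with h | h | h
  · refine (h₁ τ ⟨hτ.1, h.le⟩).filter_mono ?_
    rw [nhdsWithin, nhdsWithin]
    refine le_inf inf_le_left ?_
    rw [le_principal_iff]
    filter_upwards [mem_inf_of_left (Iio_mem_nhds h), mem_inf_of_right (mem_principal_self _)]
      with s h1 h2 using ⟨h2.1, h1.le⟩
  · subst h
    rw [← Icc_union_Icc_eq_Icc hab hbc, nhdsWithin_union]
    exact eventually_sup.2 ⟨h₁ τ ⟨hab, le_rfl⟩, h₂ τ ⟨le_rfl, hbc⟩⟩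
  · refine (h₂ τ ⟨h.le, hτ.2⟩).filter_mono ?_
    rw [nhdsWithin, nhdsWithin]
    refine le_inf inf_le_left ?_
    rw [le_principal_iff]
    filter_upwards [mem_inf_of_left (Ioi_mem_nhds h), mem_inf_of_right (mem_principal_self _)]
      with s h1 h2 using ⟨h1.le, h2.2⟩

theorem union_Icc_ite (h₁ : IsApproxPrimOn η ε (Icc a b) H g)
    (h₂ : IsApproxPrimOn η ε (Icc b c) H g') (hab : a ≤ b) (hbc : b ≤ c) (hb : g b = g' b) :
    IsApproxPrimOn η ε (Icc a c) H (fun t => if t ≤ b then g t else g' t) := by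
  refine union_Icc (h₁.congr (fun _ _ _ _ => rfl) fun s hs => (if_pos hs.2).symm)
    (h₂.congr (fun _ _ _ _ => rfl) fun s hs => ?_) hab hbc
  rcases eq_or_lt_of_le hs.1 with h | h
  · simp [← h, hb]
  · simp [not_le.2 h]

end IsApproxPrimOn

namespace IsPrimOn

variable {η m : ℝ → ℝ} {S T : Set ℝ} {H H' : ℝ → ℝ → E} {g g' : ℝ → E} {a b c : ℝ}

theorem mono (h : IsPrimOn η T H g) (hST : S ⊆ T) : IsPrimOn η S H g :=
  fun ε hε => (h ε hε).mono hST

theorem congr (h : IsPrimOn η S H g) (hH : ∀ τ ∈ S, ∀ s ∈ S, H τ s = H' τ s)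
    (hg : ∀ s ∈ S, g s = g' s) : IsPrimOn η S H' g' :=
  fun ε hε => (h ε hε).congr hH hg

theorem sub_const (h : IsPrimOn η S H g) (c : E) : IsPrimOn η S H (fun s => g s - c) :=
  fun ε hε => (h ε hε).sub_const c

theorem union_Icc (h₁ : IsPrimOn η (Icc a b) H g) (h₂ : IsPrimOn η (Icc b c) H g)
    (hab : a ≤ b) (hbc : b ≤ c) : IsPrimOn η (Icc a c) H g :=
  fun ε hε => (h₁ ε hε).union_Icc (h₂ ε hε) hab hbc

theorem sub (h : IsPrimOn η S H g) (h' : IsPrimOn η S H' g') :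
    IsPrimOn η S (fun τ s => H τ s - H' τ s) (fun s => g s - g' s) := by
  intro ε hε τ hτ
  filter_upwards [h (ε / 2) (by positivity) τ hτ, h' (ε / 2) (by positivity) τ hτ] with s h1 h2
  have : g s - g' s - (g τ - g' τ) - (H τ s - H' τ s)
      = (g s - g τ - H τ s) - (g' s - g' τ - H' τ s) := by abel
  rw [this]
  refine (norm_sub_le _ _).trans ?_
  linarith

theorem of_forall_Icc (h : ∀ n : ℕ, IsPrimOn η (Icc (c - n) (c + n)) H g) :
    IsPrimOn η univ H g := by
  intro ε hε τ _
  obtain ⟨n, hn⟩ := exists_nat_gt |τ - c|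
  rw [abs_lt] at hn
  have := h n ε hε τ ⟨by linarith, by linarith⟩
  rwa [nhdsWithin_univ, ← nhdsWithin_eq_nhds.2 (Icc_mem_nhds (a := c - n) (b := c + n)
    (by linarith) (by linarith))]

theorem norm_sub_le (h : IsPrimOn η (Icc a b) H g) (hab : a ≤ b) (hη : Monotone η)
    (hm : Monotone m)
    (hH : ∀ τ ∈ Icc a b, ∀ᶠ s in 𝓝[Icc a b] τ, ‖H τ s‖ ≤ |m s - m τ|) :
    ‖g b - g a‖ ≤ m b - m a := by
  refine norm_sub_le_of_local hab hm hη fun ε hε τ hτ => ?_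
  filter_upwards [h ε hε τ hτ, hH τ hτ] with s h1 h2
  have : g s - g τ = H τ s + (g s - g τ - H τ s) := by abel
  rw [this]
  refine (norm_add_le _ _).trans ?_
  linarith

theorem norm_sub_le_mul (h : IsPrimOn η S H g) (hS : S.OrdConnected) (hη : Monotone η)
    (hm : Monotone m) {κ : ℝ} (hκ : 0 ≤ κ) 
    (hH : ∀ τ ∈ S, ∀ s ∈ S, ‖H τ s‖ ≤ κ * |m s - m τ|) {s t : ℝ} (hs : s ∈ S) (ht : t ∈ S) :
    ‖g s - g t‖ ≤ κ * |m s - m t| := by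
  wlog hst : t ≤ s generalizing s t
  · rw [norm_sub_rev, abs_sub_comm]; exact this ht hs (le_of_not_ge hst)
  have := (h.mono (hS.out ht hs)).norm_sub_le (m := fun x => κ * m x) hst hη
    (fun x y hxy => mul_le_mul_of_nonneg_left (hm hxy) hκ) ?_
  · rwa [abs_of_nonneg (sub_nonneg.2 (hm hst)), mul_sub]
  · intro τ hτ
    filter_upwards [self_mem_nhdsWithin] with x hx
    rw [← mul_sub, abs_mul, abs_of_nonneg hκ]
    exact hH τ (hS.out ht hs hτ) x (hS.out ht hs hx)

/-- The difference is a primitive of zero, so the mean value inequality with constant 0 makes it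
constant. -/
theorem sub_eq_sub (h : IsPrimOn η S H g) (h' : IsPrimOn η S H g') (hS : S.OrdConnected)
    (hη : Monotone η) {s t : ℝ} (hs : s ∈ S) (ht : t ∈ S) : g s - g t = g' s - g' t := by
  have := (h.sub h').norm_sub_le_mul hS hη (m := η) hη le_rfl (by simp) hs ht
  rw [zero_mul, norm_le_zero_iff] at this
  rw [← sub_eq_zero, ← this]; abel

end IsPrimOn

/-- Gluing of functions defined on growing intervals that are determined by their value at a
point. -/
theorem exists_glue {E : Type*} {p : ℕ → (ℝ → E) → Prop} (c : ℝ) (hex : ∀ n, ∃ g, p n g)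
    (hmono : ∀ n k g, n ≤ k → p k g → p n g)
    (huniq : ∀ n g g', p n g → p n g' → EqOn g g' (Icc (c - n) (c + n))) :
    ∃ g, ∀ n, ∃ g', p n g' ∧ EqOn g' g (Icc (c - n) (c + n)) := by
  choose G hG using hex
  refine ⟨fun t => G ⌈|t - c|⌉₊ t, fun n => ⟨G n, hG n, fun t ht => ?_⟩⟩
  have h1 : |t - c| ≤ n := by rw [abs_le]; constructor <;> linarith [ht.1, ht.2]
  have h2 : |t - c| ≤ (⌈|t - c|⌉₊ : ℝ) := Nat.le_ceil _
  refine huniq _ _ _ (hmono _ _ _ (Nat.ceil_le.2 h1) (hG n)) (hG _) ?_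
  rw [abs_le] at h2
  constructor <;> linarith [h2.1, h2.2]

end LocalPrimitives

/-! ### Sewing: almost additive increments have primitives. -/

section Existence

variable {η : ℝ → ℝ}

theorem Monotone.le_of_tendsto_nhdsGT (hη : Monotone η) {τ s L : ℝ}
    (hL : Tendsto η (𝓝[>] τ) (𝓝 L)) (hs : τ < s) : L ≤ η s := by
  refine _root_.le_of_tendsto hL ?_
  filter_upwards [Ioo_mem_nhdsGT hs] with x hx using hη hx.2.le

theorem Monotone.ge_of_tendsto_nhdsLT (hη : Monotone η) {τ s L : ℝ}
    (hL : Tendsto η (𝓝[<] τ) (𝓝 L)) (hs : s < τ) : η s ≤ L := by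
  refine _root_.ge_of_tendsto hL ?_
  filter_upwards [Ioo_mem_nhdsLT hs] with x hx using hη hx.1.le

/-- Near a point a monotone function has small oscillation, or it jumps there and has small
oscillation away from the point. -/
theorem Monotone.eventually_small_or_jump (hη : Monotone η) (τ : ℝ) {κ : ℝ} (hκ : 0 < κ) :
    ∀ᶠ q in 𝓝 τ, (∀ s ∈ uIcc τ q, |η s - η τ| ≤ κ) ∨
      ∃ J > 0, (∀ s ∈ uIcc τ q, s ≠ τ → J ≤ |η s - η τ| ∧ |η s - η τ| ≤ 2 * J) ∧
        ∀ s ∈ uIcc τ q, ∀ s' ∈ uIcc τ q, s ≠ τ → s' ≠ τ → |η s - η s'| ≤ κ := by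
  rw [← nhdsNE_sup_pure τ, ← nhdsLT_sup_nhdsGT, eventually_sup, eventually_sup]
  refine ⟨⟨?_, ?_⟩, ?_⟩
  · have hL := hη.tendsto_nhdsLT τ
    set L := sSup (η '' Iio τ)
    have hle : ∀ s < τ, η s ≤ L := fun s hs => hη.ge_of_tendsto_nhdsLT hL hs
    have hLτ : L ≤ η τ := _root_.le_of_tendsto hL (by
      filter_upwards [self_mem_nhdsWithin] with x hx using hη (le_of_lt hx))
    rcases eq_or_lt_of_le hLτ with hJ | hJ
    · filter_upwards [self_mem_nhdsWithin,
        hL.eventually (lt_mem_nhds (show L - κ < L by linarith))] with q hq h1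
      refine Or.inl fun s hs => ?_
      rw [uIcc_of_ge (le_of_lt hq)] at hs
      have h2 := hη hs.1
      have h3 := hη hs.2
      rw [abs_le]; constructor <;> linarith
    · filter_upwards [self_mem_nhdsWithin,
        hL.eventually (lt_mem_nhds (show L - min κ (η τ - L) < L by
          have := lt_min hκ (sub_pos.2 hJ); linarith))] with q hq h1
      have hm1 := min_le_left κ (η τ - L)
      have hm2 := min_le_right κ (η τ - L)
      refine Or.inr ⟨η τ - L, by linarith, fun s hs hsτ => ?_, fun s hs s' hs' hsτ hsτ' => ?_⟩
      · rw [uIcc_of_ge (le_of_lt hq)] at hs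
        have h2 := hη hs.1
        have h3 := hle s (lt_of_le_of_ne hs.2 hsτ)
        rw [abs_sub_comm, abs_of_nonneg (by linarith)]
        constructor <;> linarith
      · rw [uIcc_of_ge (le_of_lt hq)] at hs hs'
        have h2 := hη hs.1
        have h3 := hle s (lt_of_le_of_ne hs.2 hsτ)
        have h2' := hη hs'.1
        have h3' := hle s' (lt_of_le_of_ne hs'.2 hsτ')
        rw [abs_le]; constructor <;> linarith
  · have hL := hη.tendsto_nhdsGT τ
    set L := sInf (η '' Ioi τ)
    have hle : ∀ s > τ, L ≤ η s := fun s hs => hη.le_of_tendsto_nhdsGT hL hs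
    have hLτ : η τ ≤ L := _root_.ge_of_tendsto hL (by
      filter_upwards [self_mem_nhdsWithin] with x hx using hη (le_of_lt hx))
    rcases eq_or_lt_of_le hLτ with hJ | hJ
    · filter_upwards [self_mem_nhdsWithin,
        hL.eventually (gt_mem_nhds (show L < L + κ by linarith))] with q hq h1
      refine Or.inl fun s hs => ?_
      rw [uIcc_of_le (le_of_lt hq)] at hs
      have h2 := hη hs.1
      have h3 := hη hs.2
      rw [abs_le]; constructor <;> linarith
    · filter_upwards [self_mem_nhdsWithin,
        hL.eventually (gt_mem_nhds (show L < L + min κ (L - η τ) by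
          have := lt_min hκ (sub_pos.2 hJ); linarith))] with q hq h1
      have hm1 := min_le_left κ (L - η τ)
      have hm2 := min_le_right κ (L - η τ)
      refine Or.inr ⟨L - η τ, by linarith, fun s hs hsτ => ?_, fun s hs s' hs' hsτ hsτ' => ?_⟩
      · rw [uIcc_of_le (le_of_lt hq)] at hs
        have h2 := hη hs.2
        have h3 := hle s (lt_of_le_of_ne hs.1 (Ne.symm hsτ))
        rw [abs_of_nonneg (by linarith)]
        constructor <;> linarith
      · rw [uIcc_of_le (le_of_lt hq)] at hs hs'
        have h2 := hη hs.2
        have h3 := hle s (lt_of_le_of_ne hs.1 (Ne.symm hsτ))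
        have h2' := hη hs'.2
        have h3' := hle s' (lt_of_le_of_ne hs'.1 (Ne.symm hsτ'))
        rw [abs_le]; constructor <;> linarith
  · rw [eventually_pure]
    refine Or.inl fun s hs => ?_
    rw [uIcc_self, mem_singleton_iff] at hs
    simp [hs, hκ.le]

variable {E : Type*} [NormedAddCommGroup E] {H : ℝ → ℝ → E}

/-- The sewing condition: `H` is almost additive. -/
def IsAlmostAdditiveOn (η : ℝ → ℝ) (M : ℝ) (S : Set ℝ) (H : ℝ → ℝ → E) : Prop :=
  ∀ c ∈ S, ∀ τ ∈ S, ∀ s ∈ S, ‖H c s - H c τ - H τ s‖ ≤ M * |η τ - η c| * |η s - η τ|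

theorem IsAlmostAdditiveOn.self_eq_zero {M : ℝ} {S : Set ℝ} (h : IsAlmostAdditiveOn η M S H)
    {τ : ℝ} (hτ : τ ∈ S) : H τ τ = 0 := by
  simpa using h τ hτ τ hτ τ hτ

/-- Increments from one fixed base point serve as an approximate primitive as long as η varies
little from that point. If η jumps at τ, the base point is moved across the jump to q and the value
at τ is set separately. -/
theorem IsAlmostAdditiveOn.exists_approx_local {M ε : ℝ} {τ q : ℝ} (hM : 0 ≤ M) (hε : 0 < ε)
    (h : IsAlmostAdditiveOn η M (uIcc τ q) H)
    (hosc : (∀ s ∈ uIcc τ q, |η s - η τ| ≤ ε / (2 * (M + 1))) ∨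
      ∃ J > 0, (∀ s ∈ uIcc τ q, s ≠ τ → J ≤ |η s - η τ| ∧ |η s - η τ| ≤ 2 * J) ∧
        ∀ s ∈ uIcc τ q, ∀ s' ∈ uIcc τ q, s ≠ τ → s' ≠ τ → |η s - η s'| ≤ ε / (2 * (M + 1))) :
    ∃ g, IsApproxPrimOn η ε (uIcc τ q) H g := by
  have hκ : M * (ε / (2 * (M + 1))) ≤ ε / 2 := by
    rw [mul_div_assoc', div_le_div_iff₀ (by positivity) (by positivity)]; nlinarith
  set κ := ε / (2 * (M + 1))
  rcases hosc with h1 | ⟨J, hJ, h1, h2⟩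
  · refine ⟨H τ, fun τ' hτ' => ?_⟩
    filter_upwards [self_mem_nhdsWithin] with s hs
    refine (h τ left_mem_uIcc τ' hτ' s hs).trans ?_
    gcongr
    have := mul_le_mul_of_nonneg_left (h1 τ' hτ') hM
    linarith
  · classical
    -- The value at τ makes the increment from τ to s equal to H τ q + H q s, which is H τ s up to M
    -- · 2J · κ ≤ ε J; the jump J is itself at most |η s - η τ|.
    refine ⟨fun s => if s = τ then - H τ q else H q s, fun τ' hτ' => ?_⟩
    by_cases hττ : τ' = τ
    · subst hττ
      filter_upwards [self_mem_nhdsWithin] with s hs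
      by_cases hsτ : s = τ'
      · simp [hsτ, h.self_eq_zero left_mem_uIcc]
      · rw [if_neg hsτ, if_pos rfl]
        have hq : q ≠ τ' := by
          rintro rfl
          rw [uIcc_self] at hs
          exact hsτ hs
        have e : H q s - -H τ' q - H τ' s = -(H τ' s - H τ' q - H q s) := by abel
        rw [e, norm_neg]
        refine (h τ' left_mem_uIcc q right_mem_uIcc s hs).trans ?_
        have a1 := (h1 q right_mem_uIcc hq).2
        have a2 := h2 s hs q right_mem_uIcc hsτ hq
        have a3 := (h1 s hs hsτ).1
        calc M * |η q - η τ'| * |η s - η q| ≤ M * (2 * J) * κ := by gcongr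
          _ = (M * κ) * (2 * J) := by ring
          _ ≤ ε / 2 * (2 * J) := by gcongr
          _ = ε * J := by ring
          _ ≤ _ := by gcongr
    · filter_upwards [self_mem_nhdsWithin,
        mem_nhdsWithin_of_mem_nhds (isOpen_ne.mem_nhds hττ)] with s hs hsτ
      have hq : q ≠ τ := by
        rintro rfl
        rw [uIcc_self] at hs
        exact hsτ hs
      rw [if_neg hsτ, if_neg hττ]
      refine (h q right_mem_uIcc τ' hτ' s hs).trans ?_
      gcongr
      have := mul_le_mul_of_nonneg_left (h2 τ' hτ' q right_mem_uIcc hττ hq) hM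
      linarith

theorem IsAlmostAdditiveOn.mono {M : ℝ} {S T : Set ℝ} (h : IsAlmostAdditiveOn η M T H)
    (hST : S ⊆ T) : IsAlmostAdditiveOn η M S H := fun c hc τ hτ s hs =>
  h c (hST hc) τ (hST hτ) s (hST hs)

/-- Pieces are glued after adding constants. The defining condition is local, so ε does not
deteriorate under gluing. -/
theorem IsAlmostAdditiveOn.exists_approx {M ε a b : ℝ} (hη : Monotone η) (hM : 0 ≤ M) (hε : 0 < ε)
    (hab : a ≤ b) (h : IsAlmostAdditiveOn η M (Icc a b) H) :
    ∃ g, IsApproxPrimOn η ε (Icc a b) H g := by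
  refine interval_induction (Q := fun x y => ∃ g, IsApproxPrimOn η ε (Icc x y) H g) hab ?_ ?_
  · rintro x y z - hxy hyz - ⟨g₁, h₁⟩ ⟨g₂, h₂⟩
    exact ⟨_, h₁.union_Icc_ite (h₂.sub_const (g₂ y - g₁ y)) hxy hyz (by abel)⟩
  · intro τ hτ
    filter_upwards [mem_nhdsWithin_of_mem_nhds (hη.eventually_small_or_jump τ
      (κ := ε / (2 * (M + 1))) (by positivity)), self_mem_nhdsWithin] with s hs hsI
    have := (h.mono (ordConnected_Icc.uIcc_subset hτ hsI)).exists_approx_local hM hε hs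
    refine ⟨fun hle => ?_, fun hle => ?_⟩
    · rwa [uIcc_of_ge hle] at this
    · rwa [uIcc_of_le hle] at this

theorem IsApproxPrimOn.norm_sub_sub_le {ε ε' a b : ℝ} {g g' : ℝ → E} (hη : Monotone η)
    (hε : 0 ≤ ε + ε')
    (h : IsApproxPrimOn η ε (Icc a b) H g) (h' : IsApproxPrimOn η ε' (Icc a b) H g') {s t : ℝ}
    (hs : s ∈ Icc a b) (ht : t ∈ Icc a b) :
    ‖(g s - g' s) - (g t - g' t)‖ ≤ (ε + ε') * |η s - η t| := by
  wlog hst : t ≤ s generalizing s t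
  · rw [norm_sub_rev, abs_sub_comm]; exact this ht hs (le_of_not_ge hst)
  have := norm_sub_le_of_local (g := fun x => g x - g' x) (m := fun x => (ε + ε') * η x) hst
    (fun x y hxy => mul_le_mul_of_nonneg_left (hη hxy) hε) hη ?_
  · rwa [abs_of_nonneg (sub_nonneg.2 (hη hst)), mul_sub]
  · intro ρ hρ τ hτ
    have hsub := ordConnected_Icc.out ht hs
    filter_upwards [h.mono hsub τ hτ, h'.mono hsub τ hτ] with x h1 h2
    have e : g x - g' x - (g τ - g' τ) = (g x - g τ - H τ x) - (g' x - g' τ - H τ x) := by abel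
    rw [e, ← mul_sub, abs_mul, abs_of_nonneg hε]
    refine (norm_sub_le _ _).trans ?_
    have : 0 ≤ ρ * |η x - η τ| := by positivity
    linarith

/-- Two approximate primitives differ by a function whose increments are at most (ε + ε') |η s - η
t|. Normalized at a, those with ε = 1 / (n + 1) therefore converge, and the same increment estimate
passes to the limit and transfers the local condition to it. -/
theorem IsAlmostAdditiveOn.exists_isPrimOn_Icc [CompleteSpace E] {M a b : ℝ} (hη : Monotone η)
    (hM : 0 ≤ M) (hab : a ≤ b) (h : IsAlmostAdditiveOn η M (Icc a b) H) :
    ∃ g, IsPrimOn η (Icc a b) H g := by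
  have hpos : ∀ n : ℕ, 0 < 1 / ((n : ℝ) + 1) := fun n => by positivity
  have hex : ∀ n : ℕ, ∃ g, IsApproxPrimOn η (1 / ((n : ℝ) + 1)) (Icc a b) H g ∧ g a = 0 := by
    intro n
    obtain ⟨g, hg⟩ := h.exists_approx hη hM (hpos n) hab
    exact ⟨_, hg.sub_const (g a), by simp⟩
  choose g hg hga using hex
  have hlim := tendsto_one_div_add_atTop_nhds_zero_nat (𝕜 := ℝ)
  have hdist : ∀ n k, ∀ s ∈ Icc a b, ∀ t ∈ Icc a b,
      ‖(g n s - g k s) - (g n t - g k t)‖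
        ≤ (1 / ((n : ℝ) + 1) + 1 / ((k : ℝ) + 1)) * |η s - η t| := fun n k s hs t ht =>
    (hg n).norm_sub_sub_le hη (add_pos (hpos n) (hpos k)).le (hg k) hs ht
  have haI : a ∈ Icc a b := ⟨le_rfl, hab⟩
  have hcau : ∀ s ∈ Icc a b, ∃ y, Tendsto (fun n => g n s) atTop (𝓝 y) := by
    intro s hs
    refine cauchySeq_tendsto_of_complete ?_
    refine cauchySeq_of_le_tendsto_0 (fun n => 2 * (1 / ((n : ℝ) + 1)) * |η s - η a|) ?_ ?_
    · intro n k N hn hk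
      have := hdist n k s hs a haI
      rw [hga, hga, sub_self, sub_zero] at this
      rw [dist_eq_norm]
      refine this.trans ?_
      have h1 : 1 / ((n : ℝ) + 1) ≤ 1 / ((N : ℝ) + 1) := Nat.one_div_le_one_div hn
      have h2 : 1 / ((k : ℝ) + 1) ≤ 1 / ((N : ℝ) + 1) := Nat.one_div_le_one_div hk
      gcongr
      linarith
    · simpa using (hlim.const_mul 2).mul_const |η s - η a|
  choose! G hG using hcau
  refine ⟨G, fun ε hε τ hτ => ?_⟩
  obtain ⟨n, hn⟩ := exists_nat_one_div_lt (show 0 < ε / 2 by positivity)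
  filter_upwards [hg n τ hτ, self_mem_nhdsWithin] with s h1 hs
  have h2 : ‖(g n s - G s) - (g n τ - G τ)‖ ≤ (1 / ((n : ℝ) + 1) + 0) * |η s - η τ| := by
    refine le_of_tendsto_of_tendsto (((tendsto_const_nhds.sub (hG s hs)).sub
      (tendsto_const_nhds.sub (hG τ hτ))).norm) ((tendsto_const_nhds.add hlim).mul_const _)
      (Eventually.of_forall fun k => hdist n k s hs τ hτ)
  have e : G s - G τ - H τ s = (g n s - g n τ - H τ s) - ((g n s - G s) - (g n τ - G τ)) := by
    abel
  rw [e]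
  refine (norm_sub_le _ _).trans ?_
  have h3 : 1 / ((n : ℝ) + 1) * |η s - η τ| ≤ ε / 2 * |η s - η τ| := by gcongr
  rw [add_zero] at h2
  linarith

theorem exists_isPrimOn_univ [CompleteSpace E] (hη : Monotone η)
    (h : ∀ R : ℝ, ∃ M, 0 ≤ M ∧ IsAlmostAdditiveOn η M (Icc (-R) R) H) :
    ∃ g, IsPrimOn η univ H g := by
  obtain ⟨g, hg⟩ := exists_glue (p := fun n g => IsPrimOn η (Icc (0 - n) (0 + n)) H g ∧ g 0 = 0) 0
    (fun n => by
      obtain ⟨M, hM, hMn⟩ := h n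
      have hn : (0 : ℝ) ≤ n := n.cast_nonneg
      rw [zero_sub, zero_add]
      obtain ⟨g, hg⟩ := hMn.exists_isPrimOn_Icc hη hM (by linarith)
      exact ⟨_, hg.sub_const (g 0), by simp⟩)
    (fun n k g hnk hg => by
      have hn : (n : ℝ) ≤ k := by exact_mod_cast hnk
      exact ⟨hg.1.mono (Icc_subset_Icc (by linarith) (by linarith)), hg.2⟩)
    (fun n g g' hg hg' t ht => by
      have hn : (0 : ℝ) ≤ n := n.cast_nonneg
      have := hg.1.sub_eq_sub hg'.1 ordConnected_Icc hη ht (t := 0)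
        ⟨by linarith, by linarith⟩
      rwa [hg.2, hg'.2, sub_zero, sub_zero] at this)
  refine ⟨g, IsPrimOn.of_forall_Icc (c := 0) fun n => ?_⟩
  obtain ⟨g', hg', he⟩ := hg n
  exact hg'.1.congr (fun _ _ _ _ => rfl) he

end Existence

/-! ### Tagged divisions: concatenation, fineness and sum estimates. -/

namespace TaggedDivision

variable {E : Type*} [NormedAddCommGroup E] {a b c : ℝ}

theorem pt_mono (D : TaggedDivision a b) {i j : ℕ} (hij : i ≤ j) (hj : j ≤ D.n) :
    D.pt i ≤ D.pt j := by
  induction j, hij using Nat.le_induction with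
  | base => exact le_rfl
  | succ k hk ih => exact (ih (by omega)).trans (D.pt_le k (by omega))

theorem pt_mem (D : TaggedDivision a b) {j : ℕ} (hj : j ≤ D.n) : D.pt j ∈ Icc a b := by
  constructor
  · have := D.pt_mono (Nat.zero_le j) hj
    rwa [D.pt_zero] at this
  · have := D.pt_mono hj le_rfl
    rwa [D.pt_last] at this

theorem tag_mem_Icc (D : TaggedDivision a b) {j : ℕ} (hj : j < D.n) : D.tag j ∈ Icc a b :=
  ⟨(D.pt_mem hj.le).1.trans (D.tag_mem j hj).1, (D.tag_mem j hj).2.trans (D.pt_mem (j := j + 1) hj).2⟩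

/-- The division of `[a, b]` into a single interval with a given tag. -/
def single (hab : a ≤ b) (τ : ℝ) (hτ : τ ∈ Icc a b) : TaggedDivision a b where
  n := 1
  pt j := if j = 0 then a else b
  tag _ := τ
  pt_zero := by simp
  pt_last := by simp
  pt_le := by
    intro j hj
    obtain rfl : j = 0 := by omega
    simpa using hab
  tag_mem := by
    intro j hj
    obtain rfl : j = 0 := by omega
    simpa using hτ

theorem single_isFine (hab : a ≤ b) {τ : ℝ} (hτ : τ ∈ Icc a b) {δ : ℝ → ℝ}
    (h : ∀ s ∈ Icc a b, |s - τ| < δ τ) : (single hab τ hτ).IsFine δ := by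
  intro j hj
  obtain rfl : j = 0 := by simp only [single] at hj; omega
  intro s hs
  have := abs_lt.1 (h s (by simpa [single] using hs))
  constructor <;> simp only [single] <;> linarith

theorem single_kurzweilSum (hab : a ≤ b) {τ : ℝ} (hτ : τ ∈ Icc a b) (U : ℝ → ℝ → E) :
    (single hab τ hτ).kurzweilSum U = U τ b - U τ a := by
  simp [kurzweilSum, single]

/-- Concatenation of tagged divisions. -/
def append (D : TaggedDivision a b) (D' : TaggedDivision b c) : TaggedDivision a c where
  n := D.n + D'.n
  pt j := if j ≤ D.n then D.pt j else D'.pt (j - D.n)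
  tag j := if j < D.n then D.tag j else D'.tag (j - D.n)
  pt_zero := by simp [D.pt_zero]
  pt_last := by
    by_cases h : D'.n = 0
    · have := D'.pt_last
      rw [h, D'.pt_zero] at this
      simp [h, D.pt_last, this]
    · simp [h, D'.pt_last]
  pt_le := by
    intro j hj
    rcases lt_trichotomy j D.n with h | h | h
    · simpa [h.le, Nat.succ_le_of_lt h] using D.pt_le j h
    · have := D'.pt_le 0 (by omega)
      simp [h, D.pt_last]
      rwa [D'.pt_zero] at this
    · have := D'.pt_le (j - D.n) (by omega)
      rw [if_neg (by omega), if_neg (by omega)]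
      rwa [show j + 1 - D.n = j - D.n + 1 by omega]
  tag_mem := by
    intro j hj
    rcases lt_trichotomy j D.n with h | h | h
    · simpa [h, h.le, Nat.succ_le_of_lt h] using D.tag_mem j h
    · have := D'.tag_mem 0 (by omega)
      rw [D'.pt_zero] at this
      simpa [h, D.pt_last] using this
    · have := D'.tag_mem (j - D.n) (by omega)
      rw [if_neg (by omega), if_neg (by omega), if_neg (by omega)]
      rwa [show j + 1 - D.n = j - D.n + 1 by omega]

theorem append_left (D : TaggedDivision a b) (D' : TaggedDivision b c) {j : ℕ} (hj : j < D.n) :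
    (D.append D').pt j = D.pt j ∧ (D.append D').pt (j + 1) = D.pt (j + 1) ∧
      (D.append D').tag j = D.tag j := by
  refine ⟨if_pos hj.le, if_pos hj, if_pos hj⟩

theorem append_right (D : TaggedDivision a b) (D' : TaggedDivision b c) (j : ℕ) :
    (D.append D').pt (D.n + j) = D'.pt j ∧ (D.append D').tag (D.n + j) = D'.tag j := by
  constructor
  · by_cases h : j = 0
    · subst h
      simp [append, D.pt_last, D'.pt_zero]
    · simp [append, h]
  · simp [append]

theorem IsFine.append {D : TaggedDivision a b} {D' : TaggedDivision b c} {δ : ℝ → ℝ}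
    (h : D.IsFine δ) (h' : D'.IsFine δ) : (D.append D').IsFine δ := by
  intro j hj
  by_cases hjD : j < D.n
  · obtain ⟨h1, h2, h3⟩ := D.append_left D' hjD
    rw [h1, h2, h3]
    exact h j hjD
  · obtain ⟨k, rfl⟩ := Nat.exists_eq_add_of_le (not_lt.1 hjD)
    rw [add_assoc, (D.append_right D' k).1, (D.append_right D' (k + 1)).1,
      (D.append_right D' k).2]
    refine h' k ?_
    simp only [TaggedDivision.append] at hj
    omega

theorem append_kurzweilSum (D : TaggedDivision a b) (D' : TaggedDivision b c) (U : ℝ → ℝ → E) :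
    (D.append D').kurzweilSum U = D.kurzweilSum U + D'.kurzweilSum U := by
  unfold kurzweilSum
  rw [show (D.append D').n = D.n + D'.n from rfl, Finset.sum_range_add]
  congr 1
  · refine Finset.sum_congr rfl fun j hj => ?_
    obtain ⟨h1, h2, h3⟩ := D.append_left D' (Finset.mem_range.1 hj)
    rw [h1, h2, h3]
  · refine Finset.sum_congr rfl fun j hj => ?_
    rw [add_assoc, (D.append_right D' j).1, (D.append_right D' (j + 1)).1,
      (D.append_right D' j).2]

theorem exists_isFine (hab : a ≤ b) {δ : ℝ → ℝ} (hδ : ∀ τ ∈ Icc a b, 0 < δ τ) :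
    ∃ D : TaggedDivision a b, D.IsFine δ := by
  refine interval_induction (Q := fun x y => ∃ D : TaggedDivision x y, D.IsFine δ) hab ?_ ?_
  · rintro x y z - - - - ⟨D, hD⟩ ⟨D', hD'⟩
    exact ⟨D.append D', hD.append hD'⟩
  · intro τ hτ
    filter_upwards [mem_nhdsWithin_of_mem_nhds (Metric.ball_mem_nhds τ (hδ τ hτ))] with s hs
    rw [Metric.mem_ball, Real.dist_eq, abs_lt] at hs
    refine ⟨fun h => ⟨single h τ ⟨h, le_rfl⟩, single_isFine _ _ fun t ht => ?_⟩,
      fun h => ⟨single h τ ⟨le_rfl, h⟩, single_isFine _ _ fun t ht => ?_⟩⟩ <;>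
    · rw [abs_lt]
      constructor <;> linarith [ht.1, ht.2]

theorem norm_kurzweilSum_le (D : TaggedDivision a b) {U : ℝ → ℝ → E} {m : ℝ → ℝ}
    (h : ∀ j < D.n, ‖U (D.tag j) (D.pt (j + 1)) - U (D.tag j) (D.pt j)‖
      ≤ m (D.pt (j + 1)) - m (D.pt j)) :
    ‖D.kurzweilSum U‖ ≤ m b - m a := by
  calc ‖D.kurzweilSum U‖ ≤ ∑ j ∈ Finset.range D.n, (m (D.pt (j + 1)) - m (D.pt j)) :=
        norm_sum_le_of_le _ fun j hj => h j (Finset.mem_range.1 hj)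
    _ = m b - m a := by
        rw [Finset.sum_range_sub (fun j => m (D.pt j)), D.pt_last, D.pt_zero]

theorem kurzweilSum_sub (D : TaggedDivision a b) (U U' : ℝ → ℝ → E) :
    D.kurzweilSum (fun τ t => U τ t - U' τ t) = D.kurzweilSum U - D.kurzweilSum U' := by
  unfold kurzweilSum
  rw [← Finset.sum_sub_distrib]
  exact Finset.sum_congr rfl fun j _ => sub_sub_sub_comm _ _ _ _

theorem kurzweilSum_const (D : TaggedDivision a b) (x : ℝ → E) :
    D.kurzweilSum (fun _ t => x t) = x b - x a := by
  unfold kurzweilSum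
  rw [Finset.sum_range_sub (fun j => x (D.pt j)), D.pt_last, D.pt_zero]

theorem IsFine.mono {D : TaggedDivision a b} {δ δ' : ℝ → ℝ} (h : D.IsFine δ)
    (hδ : ∀ τ, δ τ ≤ δ' τ) : D.IsFine δ' := fun j hj =>
  (h j hj).trans (Ioo_subset_Ioo (by linarith [hδ (D.tag j)]) (by linarith [hδ (D.tag j)]))

end TaggedDivision

/-! ### Subintervals and Saks–Henstock estimates for the Kurzweil integral. -/

namespace HasKurzweilIntegralOn

variable {E : Type*} [NormedAddCommGroup E] {a b c : ℝ} {U : ℝ → ℝ → E} {J J' : E}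

theorem eq_zero_of_self (h : HasKurzweilIntegralOn U a a J) : J = 0 := by
  rw [← norm_le_zero_iff]
  refine le_of_forall_pos_le_add fun ε hε => ?_
  obtain ⟨δ, hδ, hD⟩ := h ε hε
  have := hD ⟨0, fun _ => a, fun _ => a, rfl, rfl, by simp, by simp⟩ (by intro j hj; simp at hj)
  simp [TaggedDivision.kurzweilSum] at this
  linarith

/-- Saks-Henstock type estimate: if the integrals over `[a, b]` and over `[a, c]`, `c ≤ b`, exist,
then so does the integral over `[c, b]`. -/
theorem sub_left (hac : a ≤ c) (hcb : c ≤ b) (h : HasKurzweilIntegralOn U a b J)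
    (h' : HasKurzweilIntegralOn U a c J') : HasKurzweilIntegralOn U c b (J - J') := by
  intro ε hε
  obtain ⟨δ, hδ, hD⟩ := h (ε / 2) (by positivity)
  obtain ⟨δ', hδ', hD'⟩ := h' (ε / 2) (by positivity)
  refine ⟨δ, fun τ hτ => hδ τ ⟨hac.trans hτ.1, hτ.2⟩, fun D hDf => ?_⟩
  obtain ⟨D₀, hD₀⟩ := TaggedDivision.exists_isFine (δ := fun τ => min (δ τ) (δ' τ)) hac
    fun τ hτ => lt_min (hδ τ ⟨hτ.1, hτ.2.trans hcb⟩) (hδ' τ hτ)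
  have h1 := hD' D₀ (hD₀.mono fun τ => min_le_right _ _)
  have h2 := hD _ ((hD₀.mono fun τ => min_le_left _ _).append hDf)
  rw [TaggedDivision.append_kurzweilSum] at h2
  have e : D.kurzweilSum U - (J - J') = (D₀.kurzweilSum U + D.kurzweilSum U - J)
      - (D₀.kurzweilSum U - J') := by abel
  rw [e]
  exact (norm_sub_le _ _).trans_lt (by linarith)

theorem sub_right (hac : a ≤ c) (hcb : c ≤ b) (h : HasKurzweilIntegralOn U a b J)
    (h' : HasKurzweilIntegralOn U c b J') : HasKurzweilIntegralOn U a c (J - J') := by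
  intro ε hε
  obtain ⟨δ, hδ, hD⟩ := h (ε / 2) (by positivity)
  obtain ⟨δ', hδ', hD'⟩ := h' (ε / 2) (by positivity)
  refine ⟨δ, fun τ hτ => hδ τ ⟨hτ.1, hτ.2.trans hcb⟩, fun D hDf => ?_⟩
  obtain ⟨D₀, hD₀⟩ := TaggedDivision.exists_isFine (δ := fun τ => min (δ τ) (δ' τ)) hcb
    fun τ hτ => lt_min (hδ τ ⟨hac.trans hτ.1, hτ.2⟩) (hδ' τ hτ)
  have h1 := hD' D₀ (hD₀.mono fun τ => min_le_right _ _)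
  have h2 := hD _ (hDf.append (hD₀.mono fun τ => min_le_left _ _))
  rw [TaggedDivision.append_kurzweilSum] at h2
  have e : D.kurzweilSum U - (J - J') = (D.kurzweilSum U + D₀.kurzweilSum U - J)
      - (D₀.kurzweilSum U - J') := by abel
  rw [e]
  exact (norm_sub_le _ _).trans_lt (by linarith)

/-- If away from the tag `c` the integrand differs from `U c` by increments of a monotone function,
then the integral is close to the increment of `U c`. -/
theorem norm_sub_le (hab : a ≤ b) (h : HasKurzweilIntegralOn U a b J) {m : ℝ → ℝ}
    (hm : Monotone m)
    (hU : ∀ r ∈ Icc a b, r ≠ c → ∀ t ∈ Icc a b, ∀ t' ∈ Icc a b, t ≠ c → t' ≠ c → t ≤ t' →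
      ‖(U r t' - U c t') - (U r t - U c t)‖ ≤ m t' - m t) :
    ‖J - (U c b - U c a)‖ ≤ m b - m a := by
  classical
  refine le_of_forall_pos_le_add fun ε hε => ?_
  obtain ⟨δ, hδ, hD⟩ := h ε hε
  -- A gauge at most |τ - c| for τ ≠ c forces every interval containing c to carry the tag c. On
  -- such intervals the integrand agrees with U c, and the hypothesis on U covers the rest.
  obtain ⟨D, hDf⟩ := TaggedDivision.exists_isFine
    (δ := fun τ => if τ = c then δ τ else min (δ τ) |τ - c|) hab fun τ hτ => by
      split_ifs with hc
      · exact hδ τ hτ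
      · exact lt_min (hδ τ hτ) (abs_pos.2 (sub_ne_zero.2 hc))
  have h1 := hD D (hDf.mono fun τ => by split_ifs; exacts [le_rfl, min_le_left _ _])
  have h2 := D.norm_kurzweilSum_le (U := fun τ t => U τ t - U c t) (m := m) (by
    intro j hj
    by_cases hc : D.tag j = c
    · simp only [hc, sub_self, norm_zero]
      exact sub_nonneg.2 (hm (D.pt_le j hj))
    · have hsub : ∀ t ∈ Icc (D.pt j) (D.pt (j + 1)), t ≠ c := by
        rintro t ht rfl
        have h3 := hDf j hj ht
        simp only [if_neg hc] at h3
        have h4 : |D.tag j - t| < |D.tag j - t| := by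
          refine (abs_lt.2 ⟨?_, ?_⟩).trans_le (min_le_right (δ (D.tag j)) _)
          · linarith [h3.2]
          · linarith [h3.1]
        exact lt_irrefl _ h4
      exact hU _ (D.tag_mem_Icc hj) hc _ (D.pt_mem hj.le) _ (D.pt_mem (j := j + 1) hj)
        (hsub _ ⟨le_rfl, D.pt_le j hj⟩) (hsub _ ⟨D.pt_le j hj, le_rfl⟩) (D.pt_le j hj))
  rw [D.kurzweilSum_sub, D.kurzweilSum_const] at h2
  have e : J - (U c b - U c a) = (D.kurzweilSum U - (U c b - U c a)) - (D.kurzweilSum U - J) := by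
    abel
  rw [e]
  exact (_root_.norm_sub_le _ _).trans (by linarith)

/-- The single interval [a, s] with tag a, followed by a fine division of [s, b], is fine on [a, b];
subtracting the two sums isolates the first term. This gives smallness but no rate in η. -/
theorem eventually_norm_sub_lt_right {x : ℝ → E} (hab : a < b)
    (h : ∀ p q, a ≤ p → p ≤ q → q ≤ b → HasKurzweilIntegralOn U p q (x q - x p)) {ε : ℝ}
    (hε : 0 < ε) : ∀ᶠ s in 𝓝[>] a, ‖x s - x a - (U a s - U a a)‖ < ε := by
  obtain ⟨δ, hδ, hD⟩ := h a b le_rfl hab.le le_rfl (ε / 2) (by positivity)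
  have hδa := hδ a ⟨le_rfl, hab.le⟩
  filter_upwards [Ioo_mem_nhdsGT hab, Ioo_mem_nhdsGT (show a < a + δ a by linarith)] with s hs hs'
  have has : a < s := hs.1
  obtain ⟨δ', hδ', hD'⟩ := h s b hs.1.le hs.2.le le_rfl (ε / 2) (by positivity)
  obtain ⟨D, hDf⟩ := TaggedDivision.exists_isFine (δ := fun τ => min (δ τ) (δ' τ)) hs.2.le
    fun τ hτ => lt_min (hδ τ ⟨hs.1.le.trans hτ.1, hτ.2⟩) (hδ' τ hτ)
  have h1 := hD' D (hDf.mono fun τ => min_le_right _ _)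
  have h2 := hD _ ((TaggedDivision.single_isFine has.le (τ := a) (left_mem_Icc.2 has.le) (by
    intro t ht
    rw [abs_lt]; constructor <;> linarith [ht.1, ht.2, hs'.2])).append
    (hDf.mono fun τ => min_le_left _ _))
  rw [TaggedDivision.append_kurzweilSum, TaggedDivision.single_kurzweilSum] at h2
  have e : x s - x a - (U a s - U a a) = (D.kurzweilSum U - (x b - x s))
      - ((U a s - U a a) + D.kurzweilSum U - (x b - x a)) := by abel
  rw [e]
  exact (_root_.norm_sub_le _ _).trans_lt (by linarith)

theorem eventually_norm_sub_lt_left {x : ℝ → E} (hab : a < b)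
    (h : ∀ p q, a ≤ p → p ≤ q → q ≤ b → HasKurzweilIntegralOn U p q (x q - x p)) {ε : ℝ}
    (hε : 0 < ε) : ∀ᶠ s in 𝓝[<] b, ‖x s - x b - (U b s - U b b)‖ < ε := by
  obtain ⟨δ, hδ, hD⟩ := h a b le_rfl hab.le le_rfl (ε / 2) (by positivity)
  have hδb := hδ b ⟨hab.le, le_rfl⟩
  filter_upwards [Ioo_mem_nhdsLT hab, Ioo_mem_nhdsLT (show b - δ b < b by linarith)] with s hs hs'
  have hsb : s < b := hs.2
  obtain ⟨δ', hδ', hD'⟩ := h a s le_rfl hs.1.le hs.2.le (ε / 2) (by positivity)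
  obtain ⟨D, hDf⟩ := TaggedDivision.exists_isFine (δ := fun τ => min (δ τ) (δ' τ)) hs.1.le
    fun τ hτ => lt_min (hδ τ ⟨hτ.1, hτ.2.trans hs.2.le⟩) (hδ' τ hτ)
  have h1 := hD' D (hDf.mono fun τ => min_le_right _ _)
  have h2 := hD _ ((hDf.mono fun τ => min_le_left _ _).append
    (TaggedDivision.single_isFine hsb.le (τ := b) (right_mem_Icc.2 hsb.le) (by
      intro t ht
      rw [abs_lt]; constructor <;> linarith [ht.1, ht.2, hs'.1])))
  rw [TaggedDivision.append_kurzweilSum, TaggedDivision.single_kurzweilSum] at h2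
  have e : x s - x b - (U b s - U b b) = (D.kurzweilSum U + (U b b - U b s) - (x b - x a))
      - (D.kurzweilSum U - (x s - x a)) := by abel
  rw [e]
  exact (_root_.norm_sub_le _ _).trans_lt (by linarith)

end HasKurzweilIntegralOn

/-! ### Equivalence of Kurzweil solutions and local primitives. -/

section Conversion

variable {E : Type*} [NormedAddCommGroup E] {G : E → ℝ → E} {η : ℝ → ℝ} {x : ℝ → E}

theorem IsPrimOn.hasKurzweilIntegralOn {a b : ℝ} (hab : a ≤ b) (hη : Monotone η)
    (h : IsPrimOn η (Icc a b) (fun τ s => G (x τ) s - G (x τ) τ) x) :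
    HasKurzweilIntegralOn (fun τ t => G (x τ) t) a b (x b - x a) := by
  intro ε hε
  have hη0 : 0 ≤ η b - η a := sub_nonneg.2 (hη hab)
  set ε' := ε / (η b - η a + 1) with hε'
  have hε'0 : 0 < ε' := by positivity
  have hex : ∀ τ ∈ Icc a b, ∃ r > 0, ∀ s ∈ Icc a b, |s - τ| < r →
      ‖x s - x τ - (G (x τ) s - G (x τ) τ)‖ ≤ ε' * |η s - η τ| := by
    intro τ hτ
    obtain ⟨r, hr, h'⟩ := Metric.mem_nhdsWithin_iff.1 (h ε' hε'0 τ hτ)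
    refine ⟨r, hr, fun s hs hsr => h' ⟨?_, hs⟩⟩
    simpa [Real.dist_eq] using hsr
  choose! δ hδ hδ' using hex
  refine ⟨δ, hδ, fun D hD => ?_⟩
  have h1 := D.norm_kurzweilSum_le (U := fun τ t => G (x τ) t - x t) (m := fun t => ε' * η t) (by
    intro j hj
    have hmem := D.tag_mem j hj
    have key : ∀ s ∈ Icc (D.pt j) (D.pt (j + 1)),
        ‖x s - x (D.tag j) - (G (x (D.tag j)) s - G (x (D.tag j)) (D.tag j))‖
          ≤ ε' * |η s - η (D.tag j)| := by
      intro s hs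
      refine hδ' _ (D.tag_mem_Icc hj) s ⟨(D.pt_mem hj.le).1.trans hs.1,
        hs.2.trans (D.pt_mem (j := j + 1) hj).2⟩ ?_
      have := hD j hj hs
      rw [abs_lt]; constructor <;> linarith [this.1, this.2]
    have k1 := key _ ⟨le_rfl, D.pt_le j hj⟩
    have k2 := key _ ⟨D.pt_le j hj, le_rfl⟩
    rw [abs_sub_comm, abs_of_nonneg (sub_nonneg.2 (hη hmem.1))] at k1
    rw [abs_of_nonneg (sub_nonneg.2 (hη hmem.2))] at k2
    set τ := D.tag j
    set s := D.pt j
    set t := D.pt (j + 1)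
    have e : G (x τ) t - x t - (G (x τ) s - x s) = (x s - x τ - (G (x τ) s - G (x τ) τ))
      - (x t - x τ - (G (x τ) t - G (x τ) τ)) := by abel
    rw [e]
    refine (_root_.norm_sub_le _ _).trans ?_
    linarith)
  rw [D.kurzweilSum_sub, D.kurzweilSum_const, ← mul_sub] at h1
  refine h1.trans_lt ?_
  rw [hε', div_mul_eq_mul_div, div_lt_iff₀ (by positivity)]
  nlinarith

theorem isGODESolution_of_isPrimOn (hη : Monotone η)
    (h : IsPrimOn η univ (fun τ s => G (x τ) s - G (x τ) τ) x) : IsGODESolution G x := by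
  refine fun a b => ⟨fun hab => (h.mono (subset_univ _)).hasKurzweilIntegralOn hab hη,
    fun hab => ?_⟩
  rw [neg_sub]
  exact (h.mono (subset_univ _)).hasKurzweilIntegralOn hab.le hη

/-- From a first order estimate without rate to one with rate, on one side of a point. -/
theorem eventually_norm_sub_le_mul {l : Filter ℝ} {τ L : ℝ} {U : ℝ → E}
    (hL : Tendsto η l (𝓝 L)) (hLτ : ∀ᶠ s in l, |L - η τ| ≤ |η s - η τ|) {k : ℝ} (hk : 0 ≤ k)
    (hU : ∀ s, ‖U s - U τ‖ ≤ k * |η s - η τ|)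
    (h0 : ∀ ε > 0, ∀ᶠ s in l, ‖x s - x τ - (U s - U τ)‖ < ε)
    (h1 : ∀ B ≥ 0, (∀ᶠ s in l, ‖x s - x τ‖ ≤ B) →
      ∀ᶠ s in l, ‖x s - x τ - (U s - U τ)‖ ≤ B * |η s - L|) {ε : ℝ} (hε : 0 < ε) :
    ∀ᶠ s in l, ‖x s - x τ - (U s - U τ)‖ ≤ ε * |η s - η τ| := by
  -- If η has no jump on this side, x has small increments, so `h1` applies with B = ε. If it has
  -- one, a crude bound B suffices: B |η s - L| tends to 0 while |η s - η τ| stays above the jump.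
  by_cases hJ : L = η τ
  · subst hJ
    refine h1 ε hε.le ?_
    have h2 : Tendsto (fun s => k * |η s - η τ|) l (𝓝 0) := by
      have := (hL.sub_const (η τ)).abs.const_mul k
      simpa using this
    filter_upwards [h0 (ε / 2) (by positivity), h2.eventually (gt_mem_nhds
      (show (0 : ℝ) < ε / 2 by positivity))] with s a1 a2
    have e : x s - x τ = (x s - x τ - (U s - U τ)) + (U s - U τ) := by abel
    rw [e]
    refine (norm_add_le _ _).trans ?_
    linarith [hU s]
  · have hJ' : 0 < |L - η τ| := abs_pos.2 (sub_ne_zero.2 hJ)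
    have h2 : Tendsto (fun s => k * |η s - η τ|) l (𝓝 (k * |L - η τ|)) :=
      (hL.sub_const (η τ)).abs.const_mul k
    have hB : ∀ᶠ s in l, ‖x s - x τ‖ ≤ 1 + (k * |L - η τ| + 1) := by
      filter_upwards [h0 1 one_pos, h2.eventually (gt_mem_nhds (lt_add_one _))] with s a1 a2
      have e : x s - x τ = (x s - x τ - (U s - U τ)) + (U s - U τ) := by abel
      rw [e]
      refine (norm_add_le _ _).trans ?_
      linarith [hU s]
    set B := 1 + (k * |L - η τ| + 1) with hBdef
    have hB0 : 0 ≤ B := by positivity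
    have h3 : Tendsto (fun s => B * |η s - L|) l (𝓝 0) := by
      have := (hL.sub_const L).abs.const_mul B
      simpa using this
    filter_upwards [h1 B hB0 hB, h3.eventually (gt_mem_nhds (mul_pos hε hJ')), hLτ]
      with s a1 a2 a3
    refine a1.trans (a2.le.trans ?_)
    gcongr

/-- For r near τ on one side, G (x r) and G (x τ) have increments differing by at most sup ‖x r - x
τ‖ times those of η. Integrating this away from τ turns plain convergence into convergence with a
rate. Integrals are needed only on one-sided intervals at τ, so that a base point of integration may
also be τ. -/
theorem isPrimOn_of_kurzweil_sided {τ : ℝ} (hη : Monotone η) {k : ℝ} (hk : 0 ≤ k)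
    (hG : ∀ s t, ‖G (x τ) s - G (x τ) t‖ ≤ k * |η s - η t|)
    (hG' : ∀ y z s t, ‖G y s - G y t - G z s + G z t‖ ≤ ‖y - z‖ * |η s - η t|)
    (hr : ∃ b > τ, ∀ p q, τ ≤ p → p ≤ q → q ≤ b →
      HasKurzweilIntegralOn (fun τ t => G (x τ) t) p q (x q - x p))
    (hl : ∃ a < τ, ∀ p q, a ≤ p → p ≤ q → q ≤ τ →
      HasKurzweilIntegralOn (fun τ t => G (x τ) t) p q (x q - x p)) {ε : ℝ} (hε : 0 < ε) :
    ∀ᶠ s in 𝓝 τ, ‖x s - x τ - (G (x τ) s - G (x τ) τ)‖ ≤ ε * |η s - η τ| := by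
  have hGd : ∀ {B : ℝ} {r t t' : ℝ}, ‖x r - x τ‖ ≤ B → t ≤ t' →
      ‖(G (x r) t' - G (x τ) t') - (G (x r) t - G (x τ) t)‖ ≤ B * (η t' - η t) := by
    intro B r t t' hB htt
    have := hG' (x r) (x τ) t' t
    rw [abs_of_nonneg (sub_nonneg.2 (hη htt))] at this
    have e : (G (x r) t' - G (x τ) t') - (G (x r) t - G (x τ) t)
      = G (x r) t' - G (x r) t - G (x τ) t' + G (x τ) t := by abel
    rw [e]
    exact this.trans (mul_le_mul_of_nonneg_right hB (sub_nonneg.2 (hη htt)))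
  rw [← nhdsNE_sup_pure τ, ← nhdsLT_sup_nhdsGT, eventually_sup, eventually_sup]
  refine ⟨⟨?_, ?_⟩, ?_⟩
  · obtain ⟨a, haτ, ha⟩ := hl
    have hL := hη.tendsto_nhdsLT τ
    set L := sSup (η '' Iio τ)
    have hle : ∀ s < τ, η s ≤ L := fun s hs => hη.ge_of_tendsto_nhdsLT hL hs
    have hLτ : L ≤ η τ := le_of_tendsto hL (by
      filter_upwards [self_mem_nhdsWithin] with x hx using hη (le_of_lt hx))
    refine eventually_norm_sub_le_mul (U := G (x τ)) hL ?_ hk (fun s => hG s τ)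
      (fun ε hε => HasKurzweilIntegralOn.eventually_norm_sub_lt_left haτ ha hε) ?_ hε
    · filter_upwards [self_mem_nhdsWithin] with s hs
      rw [abs_sub_comm, abs_of_nonneg (sub_nonneg.2 hLτ), abs_sub_comm,
        abs_of_nonneg (sub_nonneg.2 (hη (le_of_lt hs)))]
      linarith [hle s hs]
    · intro B hB hxB
      obtain ⟨p, hp, hpB⟩ := mem_nhdsLT_iff_exists_Ioo_subset.1 hxB
      filter_upwards [Ioo_mem_nhdsLT haτ, Ioo_mem_nhdsLT hp] with s hs hs'
      -- Cutting η off at its left limit L removes the jump at τ from the control, so the bound is B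
      -- (L - η s) and not B (η τ - η s).
      have := (ha s τ hs.1.le hs.2.le le_rfl).norm_sub_le (c := τ) hs.2.le
        (m := fun t => B * min (η t) L) (fun t t' htt => by
          have := hη htt
          dsimp only
          gcongr) (by
          intro r hr hrτ t ht t' ht' htτ htτ' htt
          rw [← mul_sub, min_eq_left (hle t' (lt_of_le_of_ne ht'.2 htτ')),
            min_eq_left (hle t (lt_of_le_of_ne ht.2 htτ))]
          exact hGd (hpB ⟨hs'.1.trans_le hr.1, lt_of_le_of_ne hr.2 hrτ⟩) htt)
      rw [min_eq_right hLτ, min_eq_left (hle s hs.2), ← mul_sub] at this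
      rw [abs_sub_comm, abs_of_nonneg (sub_nonneg.2 (hle s hs.2)), ← norm_neg]
      have e : -(x s - x τ - (G (x τ) s - G (x τ) τ))
        = x τ - x s - (G (x τ) τ - G (x τ) s) := by abel
      rwa [e]
  · obtain ⟨b, hτb, hb⟩ := hr
    have hL := hη.tendsto_nhdsGT τ
    set L := sInf (η '' Ioi τ)
    have hle : ∀ s > τ, L ≤ η s := fun s hs => hη.le_of_tendsto_nhdsGT hL hs
    have hLτ : η τ ≤ L := ge_of_tendsto hL (by
      filter_upwards [self_mem_nhdsWithin] with x hx using hη (le_of_lt hx))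
    refine eventually_norm_sub_le_mul (U := G (x τ)) hL ?_ hk (fun s => hG s τ)
      (fun ε hε => HasKurzweilIntegralOn.eventually_norm_sub_lt_right hτb hb hε) ?_ hε
    · filter_upwards [self_mem_nhdsWithin] with s hs
      rw [abs_of_nonneg (sub_nonneg.2 hLτ),
        abs_of_nonneg (sub_nonneg.2 (hη (le_of_lt hs)))]
      linarith [hle s hs]
    · intro B hB hxB
      obtain ⟨p, hp, hpB⟩ := mem_nhdsGT_iff_exists_Ioo_subset.1 hxB
      filter_upwards [Ioo_mem_nhdsGT hτb, Ioo_mem_nhdsGT hp] with s hs hs'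
      have := (hb τ s le_rfl hs.1.le hs.2.le).norm_sub_le (c := τ) hs.1.le
        (m := fun t => B * max (η t) L) (fun t t' htt => by
          have := hη htt
          dsimp only
          gcongr) (by
          intro r hr hrτ t ht t' ht' htτ htτ' htt
          rw [← mul_sub, max_eq_left (hle t' (lt_of_le_of_ne ht'.1 htτ'.symm)),
            max_eq_left (hle t (lt_of_le_of_ne ht.1 htτ.symm))]
          exact hGd (hpB ⟨lt_of_le_of_ne hr.1 hrτ.symm, hr.2.trans_lt hs'.2⟩) htt)
      rw [max_eq_right hLτ, max_eq_left (hle s hs.1), ← mul_sub] at this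
      rwa [abs_of_nonneg (sub_nonneg.2 (hle s hs.1))]
  · rw [eventually_pure]
    simp

/-- A solution of a generalized ODE is a local primitive of its right-hand side. -/
theorem IsGODESolution.isPrimOn (hη : Monotone η) {k : E → ℝ} (hk : ∀ y, 0 ≤ k y)
    (hG : ∀ y s t, ‖G y s - G y t‖ ≤ k y * |η s - η t|)
    (hG' : ∀ y z s t, ‖G y s - G y t - G z s + G z t‖ ≤ ‖y - z‖ * |η s - η t|)
    (h : IsGODESolution G x) : IsPrimOn η univ (fun τ s => G (x τ) s - G (x τ) τ) x := by
  intro ε hε τ _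
  rw [nhdsWithin_univ]
  exact isPrimOn_of_kurzweil_sided hη (hk _) (hG _) hG'
    ⟨τ + 1, by linarith, fun p q _ hpq _ => (h p q).1 hpq⟩
    ⟨τ - 1, by linarith, fun p q _ hpq _ => (h p q).1 hpq⟩ hε

/-- A function whose increments from a fixed base point are Kurzweil integrals is a local
primitive. -/
theorem isPrimOn_of_hasKurzweilIntegral (hη : Monotone η) {k : E → ℝ} (hk : ∀ y, 0 ≤ k y)
    (hG : ∀ y s t, ‖G y s - G y t‖ ≤ k y * |η s - η t|)
    (hG' : ∀ y z s t, ‖G y s - G y t - G z s + G z t‖ ≤ ‖y - z‖ * |η s - η t|) {c : ℝ} {x₀ : E}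
    (h : ∀ t, HasKurzweilIntegral (fun τ t => G (x τ) t) c t (x t - x₀)) :
    IsPrimOn η univ (fun τ s => G (x τ) s - G (x τ) τ) x := by
  have hright : ∀ p q, c ≤ p → p ≤ q →
      HasKurzweilIntegralOn (fun τ t => G (x τ) t) p q (x q - x p) := by
    intro p q hp hpq
    have := ((h q).1 (hp.trans hpq)).sub_left hp hpq ((h p).1 hp)
    rwa [sub_sub_sub_cancel_right] at this
  have hx₀ : x c = x₀ := sub_eq_zero.1 ((h c).1 le_rfl).eq_zero_of_self
  have hleft' : ∀ p ≤ c, HasKurzweilIntegralOn (fun τ t => G (x τ) t) p c (x₀ - x p) := by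
    intro p hp
    rcases eq_or_lt_of_le hp with rfl | hp
    · have := (h p).1 le_rfl
      rwa [hx₀, sub_self] at this ⊢
    · have := (h p).2 hp
      rwa [neg_sub] at this
  have hleft : ∀ p q, p ≤ q → q ≤ c →
      HasKurzweilIntegralOn (fun τ t => G (x τ) t) p q (x q - x p) := by
    intro p q hpq hq
    have := (hleft' p (hpq.trans hq)).sub_right hpq hq (hleft' q hq)
    rwa [sub_sub_sub_cancel_left] at this
  intro ε hε τ _
  rw [nhdsWithin_univ]
  refine isPrimOn_of_kurzweil_sided hη (hk _) (hG _) hG' ?_ ?_ hε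
  · rcases le_or_gt c τ with hcτ | hcτ
    · exact ⟨τ + 1, by linarith, fun p q hp hpq _ => hright p q (hcτ.trans hp) hpq⟩
    · exact ⟨c, hcτ, fun p q _ hpq hq => hleft p q hpq hq⟩
  · rcases lt_or_ge c τ with hcτ | hcτ
    · exact ⟨c, hcτ, fun p q hp hpq _ => hright p q hp hpq⟩
    · exact ⟨τ - 1, by linarith, fun p q _ hpq hq => hleft p q hpq (hq.trans hcτ)⟩

end Conversion

/-! ### Absorption, compactness and limits of primitives. -/

section Auxiliary

variable {E F : Type*} [NormedAddCommGroup E] [NormedAddCommGroup F]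

/-- Replaces Gronwall's inequality: starting from an a priori bound, the improvement B ↦ D + B / 2
is iterated and tends to its fixed point 2D. -/
theorem le_two_mul_of_forall_bound {ι : Type*} {S : Set ι} {w : ι → ℝ} {D : ℝ}
    (hbdd : ∃ B, ∀ t ∈ S, w t ≤ B)
    (h : ∀ B, (∀ t ∈ S, w t ≤ B) → ∀ t ∈ S, w t ≤ D + B / 2) : ∀ t ∈ S, w t ≤ 2 * D := by
  obtain ⟨B, hB⟩ := hbdd
  have key : ∀ n : ℕ, ∀ t ∈ S, w t ≤ 2 * D + (B - 2 * D) * (1 / 2) ^ n := by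
    intro n
    induction n with
    | zero => simpa using hB
    | succ k ih =>
      intro t ht
      refine (h _ ih t ht).trans (le_of_eq ?_)
      ring
  intro t ht
  refine ge_of_tendsto' (x := atTop) ?_ fun n => key n t ht
  have := (tendsto_pow_atTop_nhds_zero_of_lt_one (r := (1 / 2 : ℝ)) (by norm_num)
    (by norm_num)).const_mul (B - 2 * D)
  simpa using this.const_add (2 * D)

theorem IsCompact.exists_norm_le_of_locally {S : Set ℝ} (hS : IsCompact S) {x : ℝ → E}
    (h : ∀ τ ∈ S, ∃ k, ∀ᶠ s in 𝓝[S] τ, ‖x s‖ ≤ k) : ∃ M, ∀ t ∈ S, ‖x t‖ ≤ M := by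
  refine hS.induction_on (p := fun T => ∃ M, ∀ t ∈ T, ‖x t‖ ≤ M) ⟨0, by simp⟩ ?_ ?_ ?_
  · rintro s t hst ⟨M, hM⟩
    exact ⟨M, fun t ht => hM t (hst ht)⟩
  · rintro s t ⟨M, hM⟩ ⟨M', hM'⟩
    refine ⟨max M M', fun u hu => ?_⟩
    rcases hu with hu | hu
    · exact (hM u hu).trans (le_max_left _ _)
    · exact (hM' u hu).trans (le_max_right _ _)
  · intro τ hτ
    obtain ⟨k, hk⟩ := h τ hτ
    exact ⟨_, hk, k, fun t ht => ht⟩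

theorem exists_tendsto_of_dominated [CompleteSpace E] {l : Filter ℝ} [l.NeBot] {η : ℝ → ℝ} {L : ℝ}
    (hL : Tendsto η l (𝓝 L)) {y : ℝ → E} (hy : ∀ s t, ‖y s - y t‖ ≤ |η s - η t|) :
    ∃ Y, Tendsto y l (𝓝 Y) := by
  refine cauchy_map_iff_exists_tendsto.1 (cauchy_map_iff.2 ⟨‹_›, ?_⟩)
  have h1 := (cauchy_map_iff.1 hL.cauchy_map).2
  rw [Metric.uniformity_basis_dist.tendsto_right_iff] at h1 ⊢
  intro ε hε
  filter_upwards [h1 ε hε] with p hp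
  simp only [dist_eq_norm, Real.norm_eq_abs] at hp ⊢
  exact (hy _ _).trans_lt hp

theorem IsPrimOn.clm_apply [NormedSpace ℝ E] [NormedSpace ℝ F] {η : ℝ → ℝ} {S : Set ℝ}
    {H : ℝ → ℝ → E} {g : ℝ → E} (h : IsPrimOn η S H g) (L : E →L[ℝ] F) :
    IsPrimOn η S (fun τ s => L (H τ s)) (fun s => L (g s)) := by
  intro ε hε τ hτ
  filter_upwards [h (ε / (‖L‖ + 1)) (by positivity) τ hτ] with s hs
  rw [← map_sub, ← map_sub]
  refine (L.le_opNorm _).trans ?_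
  calc ‖L‖ * ‖g s - g τ - H τ s‖ ≤ (‖L‖ + 1) * (ε / (‖L‖ + 1) * |η s - η τ|) := by
        gcongr; linarith
    _ = ε * |η s - η τ| := by field_simp

/-- Along a filter where η converges, |η s - η τ| stays bounded, so the error tends to 0 and g has
the same jump as H τ. -/
theorem IsPrimOn.tendsto {η : ℝ → ℝ} {H : ℝ → ℝ → E} {g : ℝ → E} (h : IsPrimOn η univ H g)
    {l : Filter ℝ} {τ L : ℝ} (hl : l ≤ 𝓝 τ) (hη : Tendsto η l (𝓝 L)) {y : E}
    (hH : Tendsto (H τ) l (𝓝 y)) : Tendsto g l (𝓝 (g τ + y)) := by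
  have h0 : Tendsto (fun s => g s - g τ - H τ s) l (𝓝 0) := by
    rw [Metric.tendsto_nhds]
    intro ε hε
    have h1 : Tendsto (fun s => |η s - η τ|) l (𝓝 |L - η τ|) := (hη.sub_const _).abs
    have h2 := h (ε / (|L - η τ| + 1)) (by positivity) τ (mem_univ _)
    rw [nhdsWithin_univ] at h2
    filter_upwards [hl h2, h1.eventually (gt_mem_nhds (lt_add_one _))] with s a1 a2
    rw [dist_zero_right]
    refine a1.trans_lt ?_
    rw [div_mul_eq_mul_div, div_lt_iff₀ (by positivity)]
    gcongr
  have := (h0.add (tendsto_const_nhds (x := g τ))).add hH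
  rw [zero_add] at this
  refine this.congr fun s => by abel

end Auxiliary

/-! ### The linear equation: uniqueness, the inverse of 𝒱 and local bounds. -/

section Linear

variable {X : Type*} [NormedAddCommGroup X] [NormedSpace ℝ X]

/-- At each point and on each side, `1 + (A s - A τ)` converges to an invertible operator whose
inverse has norm at most `C`. -/
def HasInvertibleJumps (A : ℝ → X →L[ℝ] X) (C : ℝ) : Prop :=
  ∀ τ : ℝ, ∀ l : Filter ℝ, l = 𝓝[<] τ ∨ l = 𝓝[>] τ → ∃ U : (X →L[ℝ] X)ˣ,
    ‖((U⁻¹ : (X →L[ℝ] X)ˣ) : X →L[ℝ] X)‖ ≤ C ∧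
      Tendsto (fun s => 1 + (A s - A τ)) l (𝓝 (U : X →L[ℝ] X))

theorem Monotone.exists_tendsto_sided {η : ℝ → ℝ} (hη : Monotone η) {τ : ℝ} {l : Filter ℝ}
    (hl : l = 𝓝[<] τ ∨ l = 𝓝[>] τ) : ∃ L, Tendsto η l (𝓝 L) := by
  rcases hl with rfl | rfl
  · exact ⟨_, hη.tendsto_nhdsLT τ⟩
  · exact ⟨_, hη.tendsto_nhdsGT τ⟩

theorem JumpsInvertible.hasInvertibleJumps [CompleteSpace X] {A : ℝ → X →L[ℝ] X} {C : ℝ}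
    (h : JumpsInvertible A C) {η : ℝ → ℝ} (hη : Monotone η)
    (hA : ∀ s t, ‖A s - A t‖ ≤ |η s - η t|) : HasInvertibleJumps A C := by
  rintro τ l (rfl | rfl)
  · obtain ⟨⟨U, hU⟩, hC⟩ := (h τ).2
    refine ⟨U, ?_, ?_⟩
    · rwa [← hU, Ring.inverse_unit] at hC
    · have := tendsto_leftLim_of_tendsto (exists_tendsto_of_dominated (hη.tendsto_nhdsLT τ) hA)
      rw [hU, ← neg_sub (Function.leftLim A τ), sub_neg_eq_add]
      exact tendsto_const_nhds.add (this.sub_const _)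
  · obtain ⟨⟨U, hU⟩, hC⟩ := (h τ).1
    refine ⟨U, ?_, ?_⟩
    · rwa [← hU, Ring.inverse_unit] at hC
    · have := tendsto_rightLim_of_tendsto (exists_tendsto_of_dominated (hη.tendsto_nhdsGT τ) hA)
      rw [hU]
      exact tendsto_const_nhds.add (this.sub_const _)

theorem Monotone.eventually_osc_le {η : ℝ → ℝ} (hη : Monotone η) (τ : ℝ) {κ : ℝ} (hκ : 0 < κ) :
    ∀ᶠ q in 𝓝 τ, ∀ s ∈ uIcc τ q, ∀ s' ∈ uIcc τ q, s ≠ τ → s' ≠ τ → |η s - η s'| ≤ κ := by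
  filter_upwards [hη.eventually_small_or_jump τ (half_pos hκ)] with q hq
  intro s hs s' hs' hsτ hsτ'
  rcases hq with h | ⟨J, -, -, h⟩
  · have e : η s - η s' = (η s - η τ) - (η s' - η τ) := by ring
    rw [e]
    refine (abs_sub _ _).trans ?_
    linarith [h s hs, h s' hs']
  · linarith [h s hs s' hs' hsτ hsτ']

variable {η : ℝ → ℝ} {A : ℝ → X →L[ℝ] X} {x : ℝ → X} {C : ℝ}

theorem IsPrimOn.exists_norm_le_uIcc (hη : Monotone η) {E : Type*} [NormedAddCommGroup E]
    {H : ℝ → ℝ → E} {g : ℝ → E} (h : IsPrimOn η univ H g)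
    {k : ℝ → ℝ} (hH : ∀ τ s, ‖H τ s‖ ≤ k τ * |η s - η τ|) (a b : ℝ) :
    ∃ M, ∀ t ∈ uIcc a b, ‖g t‖ ≤ M := by
  refine isCompact_uIcc.exists_norm_le_of_locally fun τ hτ => ?_
  have hk : 0 ≤ |k τ| := abs_nonneg _
  refine ⟨‖g τ‖ + (1 + |k τ|) * (η (max a b) - η (min a b)), ?_⟩
  have := (h.mono (subset_univ (uIcc a b))) 1 one_pos τ hτ
  filter_upwards [this, self_mem_nhdsWithin] with s hs hsI
  have e : g s = g τ + (g s - g τ - H τ s) + H τ s := by abel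
  have hd : |η s - η τ| ≤ η (max a b) - η (min a b) := by
    rw [abs_le]
    have h1 := hη hsI.1
    have h2 := hη hsI.2
    have h3 := hη hτ.1
    have h4 := hη hτ.2
    constructor <;> linarith
  have h5 : k τ * |η s - η τ| ≤ |k τ| * |η s - η τ| := by gcongr; exact le_abs_self _
  rw [e]
  calc _ ≤ ‖g τ‖ + ‖g s - g τ - H τ s‖ + ‖H τ s‖ := norm_add₃_le
    _ ≤ ‖g τ‖ + 1 * |η s - η τ| + |k τ| * |η s - η τ| := by
      gcongr
      exact (hH τ s).trans h5
    _ = ‖g τ‖ + (1 + |k τ|) * |η s - η τ| := by ring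
    _ ≤ _ := by gcongr

/-- If ‖x‖ ≤ B on the interval, the mean value inequality improves this to ‖x s‖ + B / 2, and
absorption concludes. -/
theorem linear_norm_le_two_mul (hη : Monotone η) (hA : ∀ s t, ‖A s - A t‖ ≤ |η s - η t|)
    (hx : IsPrimOn η univ (fun τ s => A s (x τ) - A τ (x τ)) x) {s t : ℝ}
    (hosc : ∀ r ∈ uIcc s t, |η r - η s| ≤ 1 / 2) : ‖x t‖ ≤ 2 * ‖x s‖ := by
  have hH : ∀ τ s, ‖A s (x τ) - A τ (x τ)‖ ≤ ‖x τ‖ * |η s - η τ| := fun τ s => by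
    rw [← sub_apply, mul_comm]
    exact ((A s - A τ).le_opNorm _).trans (by gcongr; exact hA _ _)
  refine le_two_mul_of_forall_bound (S := uIcc s t) (w := fun r => ‖x r‖) (D := ‖x s‖)
    (hx.exists_norm_le_uIcc hη hH s t) (fun B hB r hr => ?_) t right_mem_uIcc
  have hB0 : 0 ≤ B := (norm_nonneg _).trans (hB r hr)
  have h1 := (hx.mono (subset_univ (uIcc s t))).norm_sub_le_mul ordConnected_uIcc hη hη hB0
    (fun τ hτ s _ => (hH τ s).trans (by gcongr; exact hB τ hτ)) hr left_mem_uIcc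
  have h2 : B * |η r - η s| ≤ B * (1 / 2) := by gcongr; exact hosc r hr
  have h3 : ‖x r‖ ≤ ‖x s‖ + ‖x r - x s‖ := by
    have : x r = x s + (x r - x s) := by abel
    conv_lhs => rw [this]
    exact norm_add_le _ _
  linarith

theorem linear_tendsto (hη : Monotone η) (hx : IsPrimOn η univ (fun τ s => A s (x τ) - A τ (x τ)) x)
    {τ : ℝ} {l : Filter ℝ} (hl : l = 𝓝[<] τ ∨ l = 𝓝[>] τ) {U : X →L[ℝ] X}
    (hU : Tendsto (fun s => 1 + (A s - A τ)) l (𝓝 U)) : Tendsto x l (𝓝 (U (x τ))) := by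
  obtain ⟨L, hL⟩ := hη.exists_tendsto_sided hl
  have hle : l ≤ 𝓝 τ := by rcases hl with rfl | rfl <;> exact nhdsWithin_le_nhds
  have h1 : Tendsto (fun s => (1 + (A s - A τ)) (x τ)) l (𝓝 (U (x τ))) :=
    ((ContinuousLinearMap.apply ℝ X (x τ)).continuous.tendsto U).comp hU
  have h2 : Tendsto (fun s => A s (x τ) - A τ (x τ)) l (𝓝 (U (x τ) - x τ)) := by
    refine (h1.sub_const (x τ)).congr fun s => ?_
    simp
  have := hx.tendsto hle hL h2
  rwa [add_sub_cancel] at this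

/-- On either side of τ, off τ itself, η oscillates little, so values of x there are comparable up
to a factor 2. The one-sided limit of x at τ is U (x τ) with U invertible, which lets vanishing pass
through τ in both directions. -/
theorem linear_eventually_eq_zero_iff (hη : Monotone η) (hA : ∀ s t, ‖A s - A t‖ ≤ |η s - η t|)
    (hJ : HasInvertibleJumps A C)
    (hx : IsPrimOn η univ (fun τ s => A s (x τ) - A τ (x τ)) x) (τ : ℝ) :
    ∀ᶠ q in 𝓝 τ, (x τ = 0 ↔ x q = 0) := by
  have main : ∀ l : Filter ℝ, l.NeBot → l = 𝓝[<] τ ∨ l = 𝓝[>] τ →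
      (∀ᶠ q in l, ∀ᶠ s in l, s ∈ uIcc τ q ∧ s ≠ τ ∧ τ ∉ uIcc s q ∧ uIcc s q ⊆ uIcc τ q) →
      ∀ᶠ q in l, (x τ = 0 ↔ x q = 0) := by
    intro l hne hl hmem
    have hle : l ≤ 𝓝 τ := by rcases hl with rfl | rfl <;> exact nhdsWithin_le_nhds
    obtain ⟨U, -, hU⟩ := hJ τ l hl
    have hlim := linear_tendsto hη hx hl hU
    filter_upwards [hle (hη.eventually_osc_le τ (show (0 : ℝ) < 1 / 2 by norm_num)), hmem]
      with q hq hmem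
    have h2 : ∀ᶠ s in l, ‖x s‖ ≤ 2 * ‖x q‖ ∧ ‖x q‖ ≤ 2 * ‖x s‖ := by
      filter_upwards [hmem] with s ⟨hs, hsτ, hτ, hsub⟩
      have hne : ∀ r ∈ uIcc s q, r ≠ τ := fun r hr h => hτ (h ▸ hr)
      constructor
      · exact linear_norm_le_two_mul hη hA hx fun r hr => by
          rw [uIcc_comm] at hr
          exact hq r (hsub hr) q right_mem_uIcc (hne r hr) (hne q right_mem_uIcc)
      · exact linear_norm_le_two_mul hη hA hx fun r hr =>
          hq r (hsub hr) s hs (hne r hr) hsτ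
    constructor
    · intro h0
      rw [h0, map_zero] at hlim
      have h3 : Tendsto (fun s => 2 * ‖x s‖) l (𝓝 0) := by simpa using hlim.norm.const_mul 2
      exact norm_le_zero_iff.1 (ge_of_tendsto h3 (h2.mono fun s hs => hs.2))
    · intro h0
      have h3 : Tendsto x l (𝓝 0) := by
        refine tendsto_const_nhds.congr' ?_
        filter_upwards [h2] with s hs
        have := hs.1
        rw [h0, norm_zero, mul_zero] at this
        exact (norm_le_zero_iff.1 this).symm
      have h4 := tendsto_nhds_unique hlim h3
      have h5 : (U⁻¹ : (X →L[ℝ] X)ˣ).val (U.val (x τ)) = x τ := by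
        rw [← mul_apply_eq_comp, U.inv_mul, one_apply_eq_self]
      rw [← h5, h4, map_zero]
  rw [← nhdsNE_sup_pure τ, ← nhdsLT_sup_nhdsGT, eventually_sup, eventually_sup]
  refine ⟨⟨main _ inferInstance (Or.inl rfl) ?_, main _ inferInstance (Or.inr rfl) ?_⟩, ?_⟩
  · filter_upwards [self_mem_nhdsWithin] with q hq
    filter_upwards [Ioo_mem_nhdsLT hq] with s hs
    have hq' : q < τ := hq
    have hqs : q < s := hs.1
    have hsτ : s < τ := hs.2
    rw [uIcc_of_ge hq'.le, uIcc_of_ge hqs.le]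
    exact ⟨⟨hqs.le, hsτ.le⟩, hsτ.ne, fun h => absurd h.2 (not_le.2 hsτ),
      Icc_subset_Icc le_rfl hsτ.le⟩
  · filter_upwards [self_mem_nhdsWithin] with q hq
    filter_upwards [Ioo_mem_nhdsGT hq] with s hs
    have hq' : τ < q := hq
    have hqs : s < q := hs.2
    have hsτ : τ < s := hs.1
    rw [uIcc_of_le hq'.le, uIcc_of_le hqs.le]
    exact ⟨⟨hsτ.le, hqs.le⟩, hsτ.ne', fun h => absurd h.1 (not_le.2 hsτ),
      Icc_subset_Icc hsτ.le le_rfl⟩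
  · rw [eventually_pure]

theorem linear_eq_zero (hη : Monotone η) (hA : ∀ s t, ‖A s - A t‖ ≤ |η s - η t|)
    (hJ : HasInvertibleJumps A C)
    (hx : IsPrimOn η univ (fun τ s => A s (x τ) - A τ (x τ)) x) {s : ℝ} (hs : x s = 0) (t : ℝ) :
    x t = 0 := by
  have key : ∀ a b, a ≤ b → (x a = 0 ↔ x b = 0) := by
    intro a b hab
    refine interval_induction (Q := fun a b => (x a = 0 ↔ x b = 0)) hab
      (fun _ _ _ _ _ _ _ h1 h2 => h1.trans h2) fun τ _ => ?_
    filter_upwards [mem_nhdsWithin_of_mem_nhds (linear_eventually_eq_zero_iff hη hA hJ hx τ)]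
      with s hs
    exact ⟨fun _ => hs.symm, fun _ => hs⟩
  rcases le_total s t with h | h
  · exact (key s t h).1 hs
  · exact (key t s h).2 hs

theorem linear_unique (hη : Monotone η) (hA : ∀ s t, ‖A s - A t‖ ≤ |η s - η t|)
    (hJ : HasInvertibleJumps A C) {y : ℝ → X}
    (hx : IsPrimOn η univ (fun τ s => A s (x τ) - A τ (x τ)) x)
    (hy : IsPrimOn η univ (fun τ s => A s (y τ) - A τ (y τ)) y) {s : ℝ} (hs : x s = y s) (t : ℝ) :
    x t = y t := by
  have h := (hx.sub hy).congr (H' := fun τ s => A s (x τ - y τ) - A τ (x τ - y τ))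
    (fun τ _ s _ => by simp only [map_sub]; abel) fun _ _ => rfl
  exact sub_eq_zero.1 (linear_eq_zero hη hA hJ h (sub_eq_zero.2 hs) t)

/-- `𝒱` is the fundamental solution of `dx/dτ = D[A(t)x]` with `𝒱 0 = 1`, and `W` its inverse. -/
structure IsFundamentalPair (η : ℝ → ℝ) (A 𝒱 W : ℝ → X →L[ℝ] X) : Prop where
  mono : Monotone η
  norm_sub_le : ∀ s t, ‖A s - A t‖ ≤ |η s - η t|
  isPrimOn : IsPrimOn η univ (fun τ s => A s * 𝒱 τ - A τ * 𝒱 τ) 𝒱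
  at_zero : 𝒱 0 = 1
  mul_inv : ∀ t, 𝒱 t * W t = 1
  inv_mul : ∀ t, W t * 𝒱 t = 1

/-- Uniqueness for the linear equation gives the cocycle identity V t s V s r = V t r, so V 0 t is a
two-sided inverse of V t 0. -/
theorem IsFundamentalOperator.isFundamentalPair {V : ℝ → ℝ → X →L[ℝ] X}
    (hV : IsFundamentalOperator A V) (hη : Monotone η) (hA : ∀ s t, ‖A s - A t‖ ≤ |η s - η t|)
    (hJ : HasInvertibleJumps A C) :
    IsFundamentalPair η A (fun t => V t 0) (fun t => V 0 t) := by
  have hdist : ∀ (Y : X →L[ℝ] X) (s t : ℝ), ‖A s * Y - A t * Y‖ ≤ ‖Y‖ * |η s - η t| := by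
    intro Y s t
    rw [← sub_mul, mul_comm]
    exact (norm_mul_le _ _).trans (by gcongr; exact hA s t)
  have hop : ∀ c, IsPrimOn η univ (fun τ s => A s * V τ c - A τ * V τ c) (fun t => V t c) := by
    intro c
    refine isPrimOn_of_hasKurzweilIntegral (G := fun Y t => A t * Y) hη (k := fun Y => ‖Y‖)
      (fun _ => norm_nonneg _) hdist (fun Y Z s t => ?_) (fun t => hV.1 t c)
    have := hdist (Y - Z) s t
    have e : A s * (Y - Z) - A t * (Y - Z) = A s * Y - A t * Y - A s * Z + A t * Z := by
      rw [mul_sub, mul_sub]; abel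
    rwa [e] at this
  have hid : ∀ c, V c c = 1 := fun c =>
    sub_eq_zero.1 ((hV.1 c c).1 le_rfl).eq_zero_of_self
  have happ : ∀ c z, IsPrimOn η univ (fun τ s => A s (V τ c z) - A τ (V τ c z))
      (fun t => V t c z) := by
    intro c z
    refine ((hop c).clm_apply (ContinuousLinearMap.apply ℝ X z)).congr (fun τ _ s _ => ?_)
      fun _ _ => rfl
    simp
  have hcoc : ∀ r s t, V t s * V s r = V t r := by
    intro r s t
    ext z
    have := linear_unique hη hA hJ (happ s (V s r z)) (happ r z) (s := s) (by simp [hid]) t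
    simpa using this
  exact ⟨hη, hA, hop 0, hid 0, fun t => by rw [hcoc, hid], fun t => by rw [hcoc, hid]⟩

namespace IsFundamentalPair

variable {𝒱 W : ℝ → X →L[ℝ] X}

theorem apply_inv (h : IsFundamentalPair η A 𝒱 W) (t : ℝ) (z : X) : 𝒱 t (W t z) = z := by
  rw [← mul_apply_eq_comp, h.mul_inv, one_apply_eq_self]

theorem inv_apply (h : IsFundamentalPair η A 𝒱 W) (t : ℝ) (z : X) : W t (𝒱 t z) = z := by
  rw [← mul_apply_eq_comp, h.inv_mul, one_apply_eq_self]

theorem norm_incr_le (h : IsFundamentalPair η A 𝒱 W) (τ s : ℝ) :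
    ‖A s * 𝒱 τ - A τ * 𝒱 τ‖ ≤ ‖𝒱 τ‖ * |η s - η τ| := by
  rw [← sub_mul, mul_comm]
  exact (norm_mul_le _ _).trans (by gcongr; exact h.norm_sub_le s τ)

theorem isPrimOn_apply (h : IsFundamentalPair η A 𝒱 W) (z : X) :
    IsPrimOn η univ (fun τ s => A s (𝒱 τ z) - A τ (𝒱 τ z)) (fun t => 𝒱 t z) := by
  refine (h.isPrimOn.clm_apply (ContinuousLinearMap.apply ℝ X z)).congr (fun τ _ s _ => ?_)
    fun _ _ => rfl
  simp

theorem tendsto_mul_inv (h : IsFundamentalPair η A 𝒱 W) {τ : ℝ} {l : Filter ℝ}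
    (hl : l = 𝓝[<] τ ∨ l = 𝓝[>] τ) {U : X →L[ℝ] X}
    (hU : Tendsto (fun s => 1 + (A s - A τ)) l (𝓝 U)) :
    Tendsto (fun s => 𝒱 s * W τ) l (𝓝 U) := by
  obtain ⟨L, hL⟩ := h.mono.exists_tendsto_sided hl
  have hle : l ≤ 𝓝 τ := by rcases hl with rfl | rfl <;> exact nhdsWithin_le_nhds
  have h2 : Tendsto (fun s => A s * 𝒱 τ - A τ * 𝒱 τ) l (𝓝 (U * 𝒱 τ - 𝒱 τ)) := by
    refine ((hU.mul_const (𝒱 τ)).sub_const (𝒱 τ)).congr fun s => ?_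
    rw [add_mul, sub_mul, one_mul, add_sub_cancel_left]
  have := (h.isPrimOn.tendsto hle hL h2).mul_const (W τ)
  rwa [add_sub_cancel, mul_assoc, h.mul_inv, mul_one] at this

theorem tendsto_inv [CompleteSpace X] (h : IsFundamentalPair η A 𝒱 W) {τ : ℝ} {l : Filter ℝ}
    (hl : l = 𝓝[<] τ ∨ l = 𝓝[>] τ) {U : (X →L[ℝ] X)ˣ}
    (hU : Tendsto (fun s => 1 + (A s - A τ)) l (𝓝 (U : X →L[ℝ] X))) :
    Tendsto (fun s => 𝒱 τ * W s) l (𝓝 ((U⁻¹ : (X →L[ℝ] X)ˣ) : X →L[ℝ] X)) := by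
  have h1 := (NormedRing.inverse_continuousAt U).tendsto.comp (h.tendsto_mul_inv hl hU)
  rw [Ring.inverse_unit] at h1
  refine h1.congr fun s => ?_
  have e1 : (𝒱 s * W τ) * (𝒱 τ * W s) = 1 := by
    rw [mul_assoc, ← mul_assoc (W τ), h.inv_mul, one_mul, h.mul_inv]
  have e2 : (𝒱 τ * W s) * (𝒱 s * W τ) = 1 := by
    rw [mul_assoc, ← mul_assoc (W s), h.inv_mul, one_mul, h.mul_inv]
  exact Ring.inverse_unit ⟨_, _, e1, e2⟩

/-- The only quantitative local bound, depending on A through C alone. As s and t approach τ from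
one side, 𝒱 t W s tends to the identity and 𝒱 τ W s to U⁻¹, of norm at most C; C + 2 strictly
exceeds both norms. The case s = τ is excluded because its limit U has no prescribed bound. -/
theorem eventually_norm_mul_inv_le [CompleteSpace X] (h : IsFundamentalPair η A 𝒱 W)
    (hJ : HasInvertibleJumps A C) (hC : 0 < C) (τ : ℝ) :
    ∀ᶠ q in 𝓝 τ, ∀ s ∈ uIcc τ q, ∀ t ∈ uIcc τ q, s ≠ τ → ‖𝒱 t * W s‖ ≤ C + 2 := by
  have main : ∀ l : Filter ℝ, l = 𝓝[<] τ ∨ l = 𝓝[>] τ →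
      ∃ T ∈ l, (∀ s ∈ T, ‖𝒱 τ * W s‖ ≤ C + 2) ∧ ∀ s ∈ T, ∀ t ∈ T, ‖𝒱 t * W s‖ ≤ C + 2 := by
    intro l hl
    obtain ⟨U, hUC, hU⟩ := hJ τ l hl
    have h1 := h.tendsto_mul_inv hl hU
    have h2 := h.tendsto_inv hl hU
    have h3 : Tendsto (fun p : ℝ × ℝ => 𝒱 p.1 * W p.2) (l ×ˢ l) (𝓝 1) := by
      have := (h1.comp tendsto_fst).mul (h2.comp tendsto_snd)
      rw [U.mul_inv] at this
      refine this.congr fun p => ?_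
      simp only [Function.comp]
      rw [mul_assoc, ← mul_assoc (W τ), h.inv_mul, one_mul]
    have hone : ‖(1 : X →L[ℝ] X)‖ ≤ 1 := ContinuousLinearMap.norm_id_le
    have h4 := h3.norm.eventually (gt_mem_nhds (show ‖(1 : X →L[ℝ] X)‖ < C + 2 by linarith))
    have h5 := h2.norm.eventually (gt_mem_nhds
      (show ‖((U⁻¹ : (X →L[ℝ] X)ˣ) : X →L[ℝ] X)‖ < C + 2 by linarith))
    obtain ⟨T, hT, hT'⟩ := (eventually_prod_self_iff
      (r := fun t s => ‖𝒱 t * W s‖ < C + 2)).1 h4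
    exact ⟨T ∩ {s | ‖𝒱 τ * W s‖ < C + 2}, inter_mem hT h5, fun s hs => hs.2.le,
      fun s hs t ht => (hT' t ht.1 s hs.1).le⟩
  rw [← nhdsNE_sup_pure τ, ← nhdsLT_sup_nhdsGT, eventually_sup, eventually_sup]
  refine ⟨⟨?_, ?_⟩, ?_⟩
  · obtain ⟨T, hT, hT1, hT2⟩ := main _ (Or.inl rfl)
    obtain ⟨p, hp, hpT⟩ := mem_nhdsLT_iff_exists_Ioo_subset.1 hT
    filter_upwards [Ioo_mem_nhdsLT hp] with q hq s hs t ht hsτ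
    have hqτ : q < τ := hq.2
    rw [uIcc_of_ge hqτ.le] at hs ht
    have hsT := hpT ⟨hq.1.trans_le hs.1, lt_of_le_of_ne hs.2 hsτ⟩
    rcases eq_or_lt_of_le ht.2 with rfl | htτ
    · exact hT1 s hsT
    · exact hT2 s hsT t (hpT ⟨hq.1.trans_le ht.1, htτ⟩)
  · obtain ⟨T, hT, hT1, hT2⟩ := main _ (Or.inr rfl)
    obtain ⟨p, hp, hpT⟩ := mem_nhdsGT_iff_exists_Ioo_subset.1 hT
    filter_upwards [Ioo_mem_nhdsGT hp] with q hq s hs t ht hsτ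
    have hqτ : τ < q := hq.1
    rw [uIcc_of_le hqτ.le] at hs ht
    have hsT := hpT ⟨lt_of_le_of_ne hs.1 hsτ.symm, hs.2.trans_lt hq.2⟩
    rcases eq_or_lt_of_le ht.1 with rfl | htτ
    · exact hT1 s hsT
    · exact hT2 s hsT t (hpT ⟨htτ, ht.2.trans_lt hq.2⟩)
  · rw [eventually_pure]
    intro s hs t _ hsτ
    rw [uIcc_self] at hs
    exact absurd hs hsτ

theorem exists_bound [CompleteSpace X] (h : IsFundamentalPair η A 𝒱 W)
    (hJ : HasInvertibleJumps A C) (hC : 0 < C) (R : ℝ) :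
    ∃ M, 1 ≤ M ∧ ∀ t ∈ Icc (-R) R, ‖𝒱 t‖ ≤ M ∧ ‖W t‖ ≤ M := by
  obtain ⟨M₁, hM₁⟩ := isCompact_Icc.exists_norm_le_of_locally (x := W) (S := Icc (-R) R) (by
    intro τ _
    refine ⟨‖W τ‖ + ‖W τ‖ * (C + 2), mem_nhdsWithin_of_mem_nhds ?_⟩
    filter_upwards [h.eventually_norm_mul_inv_le hJ hC τ] with q hq
    have h0 : 0 ≤ ‖W τ‖ := norm_nonneg _
    by_cases hqτ : q = τ
    · rw [hqτ]
      have : 0 ≤ ‖W τ‖ * (C + 2) := by positivity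
      linarith
    · have e : W q = W τ * (𝒱 τ * W q) := by rw [← mul_assoc, h.inv_mul, one_mul]
      have : ‖W q‖ ≤ ‖W τ‖ * (C + 2) := by
        conv_lhs => rw [e]
        exact (norm_mul_le _ _).trans (by gcongr; exact hq q right_mem_uIcc τ left_mem_uIcc hqτ)
      linarith)
  obtain ⟨M₂, hM₂⟩ := h.isPrimOn.exists_norm_le_uIcc h.mono (k := fun τ => ‖𝒱 τ‖)
    (fun τ s => h.norm_incr_le τ s) (-R) R
  refine ⟨max 1 (max M₁ M₂), le_max_left _ _, fun t ht => ⟨?_, ?_⟩⟩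
  · exact (hM₂ t (Icc_subset_uIcc ht)).trans ((le_max_right _ _).trans (le_max_right _ _))
  · exact (hM₁ t ht).trans ((le_max_left _ _).trans (le_max_right _ _))

/-- On compact intervals, `𝒱` and `W` are bounded and dominated by the control function. -/
theorem exists_dominated [CompleteSpace X] (h : IsFundamentalPair η A 𝒱 W)
    (hJ : HasInvertibleJumps A C) (hC : 0 < C) (R : ℝ) :
    ∃ M, 1 ≤ M ∧ (∀ t ∈ Icc (-R) R, ‖𝒱 t‖ ≤ M ∧ ‖W t‖ ≤ M) ∧
      ∀ s ∈ Icc (-R) R, ∀ t ∈ Icc (-R) R,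
        ‖𝒱 s - 𝒱 t‖ ≤ M * |η s - η t| ∧ ‖W s - W t‖ ≤ M * |η s - η t| := by
  obtain ⟨M, hM1, hM⟩ := h.exists_bound hJ hC R
  have hM0 : 0 ≤ M := by linarith
  have hV : ∀ s ∈ Icc (-R) R, ∀ t ∈ Icc (-R) R, ‖𝒱 s - 𝒱 t‖ ≤ M * |η s - η t| := by
    intro s hs t ht
    exact (h.isPrimOn.mono (subset_univ (Icc (-R) R))).norm_sub_le_mul ordConnected_Icc h.mono
      h.mono hM0 (fun τ hτ s _ => (h.norm_incr_le τ s).trans (by gcongr; exact (hM τ hτ).1)) hs ht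
  have hMM : M ≤ M * M * M := by nlinarith [mul_nonneg hM0 hM0]
  refine ⟨M * M * M, hM1.trans hMM, fun t ht => ⟨(hM t ht).1.trans hMM, (hM t ht).2.trans hMM⟩,
    fun s hs t ht => ⟨(hV s hs t ht).trans (by gcongr), ?_⟩⟩
  -- The resolvent-type identity transfers domination by η from 𝒱 to W.
  have e : W s - W t = W s * (𝒱 t - 𝒱 s) * W t := by
    rw [mul_sub, sub_mul, h.inv_mul, one_mul, mul_assoc, h.mul_inv, mul_one]
  rw [e]
  calc ‖W s * (𝒱 t - 𝒱 s) * W t‖ ≤ ‖W s‖ * ‖𝒱 t - 𝒱 s‖ * ‖W t‖ :=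
        (norm_mul_le _ _).trans (by gcongr; exact norm_mul_le _ _)
    _ ≤ M * (M * |η t - η s|) * M := by
        gcongr
        exacts [(hM s hs).2, hV t ht s hs, (hM t ht).2]
    _ = M * M * M * |η s - η t| := by rw [abs_sub_comm]; ring

end IsFundamentalPair

end Linear

/-- A contraction principle for families of functions with possibly unbounded members. -/
theorem exists_fixedPoint_of_half_contracting {ι E : Type*} [NormedAddCommGroup E]
    [CompleteSpace E] {T : (ι → E) → ι → E} {Z : Set (ι → E)} (hT : ∀ z ∈ Z, T z ∈ Z)
    (hZ : ∀ (z : ℕ → ι → E) (w : ι → E), (∀ n, z n ∈ Z) →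
      (∀ t, Tendsto (fun n => z n t) atTop (𝓝 (w t))) → w ∈ Z)
    (hc : ∀ z ∈ Z, ∀ z' ∈ Z, ∀ B, (∀ t, ‖z t - z' t‖ ≤ B) → ∀ t, ‖T z t - T z' t‖ ≤ B / 2)
    {z₀ : ι → E} (hz₀ : z₀ ∈ Z) {B₀ : ℝ} (hB₀ : ∀ t, ‖T z₀ t - z₀ t‖ ≤ B₀) :
    ∃ z ∈ Z, T z = z := by
  set z : ℕ → ι → E := fun n => T^[n] z₀ with hz
  have hsucc : ∀ n, z (n + 1) = T (z n) := fun n => Function.iterate_succ_apply' T n z₀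
  have hmem : ∀ n, z n ∈ Z := by
    intro n
    induction n with
    | zero => exact hz₀
    | succ k ih => rw [hsucc]; exact hT _ ih
  have hdist : ∀ n t, ‖z (n + 1) t - z n t‖ ≤ (2 * B₀) / 2 / 2 ^ n := by
    intro n
    induction n with
    | zero =>
      intro t
      rw [hsucc, pow_zero, div_one, mul_div_cancel_left₀ _ (two_ne_zero' ℝ)]
      exact hB₀ t
    | succ k ih =>
      intro t
      have := hc _ (hmem (k + 1)) _ (hmem k) _ ih t
      rw [← hsucc, ← hsucc] at this
      refine this.trans (le_of_eq ?_)
      rw [pow_succ]; field_simp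
  have hdist' : ∀ t n, dist (z n t) (z (n + 1) t) ≤ (2 * B₀) / 2 / 2 ^ n := fun t n => by
    rw [dist_comm, dist_eq_norm]; exact hdist n t
  have hlim : ∀ t, ∃ y, Tendsto (fun n => z n t) atTop (𝓝 y) := fun t =>
    cauchySeq_tendsto_of_complete (cauchySeq_of_le_geometric_two (hdist' t))
  choose w hw using hlim
  have hwZ : w ∈ Z := hZ z w hmem hw
  refine ⟨w, hwZ, funext fun t => ?_⟩
  have h1 : ∀ n, ‖T w t - z (n + 1) t‖ ≤ (2 * B₀) / 2 ^ n / 2 := by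
    intro n
    rw [hsucc]
    refine hc _ hwZ _ (hmem n) _ (fun s => ?_) t
    rw [← dist_eq_norm, dist_comm]
    exact dist_le_of_le_geometric_two_of_tendsto (hdist' s) (hw s) n
  have h2 : Tendsto (fun n : ℕ => (2 * B₀) / 2 ^ n / 2) atTop (𝓝 0) := by
    have := (tendsto_pow_atTop_nhds_zero_of_lt_one (r := (1 / 2 : ℝ)) (by norm_num)
      (by norm_num)).const_mul B₀
    rw [mul_zero] at this
    refine this.congr fun n => ?_
    rw [div_pow, one_pow]; field_simp
  have h3 : Tendsto (fun n => ‖T w t - z (n + 1) t‖) atTop (𝓝 ‖T w t - w t‖) :=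
    (tendsto_const_nhds.sub ((hw t).comp (tendsto_add_atTop_nat 1))).norm
  exact sub_eq_zero.1 (norm_le_zero_iff.1 (le_of_tendsto_of_tendsto' h3 h2 h1))

/-! ### Variation of constants and the general fixed point argument. -/

section Coordinates

variable {X : Type*} [NormedAddCommGroup X] [NormedSpace ℝ X]
  {η h : ℝ → ℝ} {A 𝒱 W : ℝ → X →L[ℝ] X} {C : ℝ} {S : Set ℝ}

/-- Domination by the control function on compact parts of `S`. -/
def IsLocDominatedOn (η : ℝ → ℝ) (S : Set ℝ) (y : ℝ → X) : Prop :=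
  ∀ R : ℝ, ∃ M, 0 ≤ M ∧ ∀ s ∈ S ∩ Icc (-R) R, ∀ t ∈ S ∩ Icc (-R) R,
    ‖y s - y t‖ ≤ M * |η s - η t|

/-- The increments of `F` along `y`. -/
def incr (F : X → ℝ → X) (y : ℝ → X) (τ s : ℝ) : X := F (y τ) s - F (y τ) τ

namespace InClassF

variable {F : X → ℝ → X}

theorem norm_incr_le (hF : InClassF F h) (y : ℝ → X) (τ s : ℝ) :
    ‖incr F y τ s‖ ≤ |h s - h τ| := hF.1 _ _ _

theorem norm_incr_sub_le (hF : InClassF F h) (y y' : ℝ → X) (τ s : ℝ) :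
    ‖incr F y τ s - incr F y' τ s‖ ≤ ‖y τ - y' τ‖ * |h s - h τ| := by
  have := hF.2 (y τ) (y' τ) τ s
  have e : incr F y τ s - incr F y' τ s
    = F (y τ) s - F (y τ) τ - F (y' τ) s + F (y' τ) τ := by unfold incr; abel
  rwa [e]

end InClassF

namespace IsFundamentalPair

theorem eventually_norm_le [CompleteSpace X] (fp : IsFundamentalPair η A 𝒱 W)
    (hJ : HasInvertibleJumps A C) (hC : 0 < C) (τ : ℝ) :
    ∃ k, 0 ≤ k ∧ ∀ᶠ s in 𝓝 τ, ‖𝒱 s‖ ≤ k ∧ ‖W s‖ ≤ k := by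
  obtain ⟨k, hk, hk'⟩ := fp.exists_bound hJ hC (|τ| + 1)
  refine ⟨k, by linarith, ?_⟩
  have := neg_abs_le τ
  have := le_abs_self τ
  filter_upwards [Icc_mem_nhds (show -(|τ| + 1) < τ by linarith) (show τ < |τ| + 1 by linarith)]
    with s hs using hk' s hs

/-- Variation of constants, from the product rule 𝒱 s u s - 𝒱 τ u τ = 𝒱 s (u s - u τ) + (𝒱 s - 𝒱 τ)
u τ. As 𝒱 may jump, the weight has to be W s and not W τ. -/
theorem isPrimOn_of_inv [CompleteSpace X] (fp : IsFundamentalPair η A 𝒱 W)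
    (hJ : HasInvertibleJumps A C) (hC : 0 < C) {f : ℝ → ℝ → X} {u : ℝ → X}
    (hu : IsPrimOn η S (fun τ s => W s (f τ s)) u) :
    IsPrimOn η S (fun τ s => A s (𝒱 τ (u τ)) - A τ (𝒱 τ (u τ)) + f τ s) (fun t => 𝒱 t (u t)) := by
  intro ε hε τ hτ
  obtain ⟨k, hk, hk'⟩ := fp.eventually_norm_le hJ hC τ
  have h1 := (fp.isPrimOn.mono (subset_univ S)) (ε / 2 / (‖u τ‖ + 1)) (by positivity) τ hτ
  filter_upwards [hu (ε / 2 / (k + 1)) (by positivity) τ hτ, h1, mem_nhdsWithin_of_mem_nhds hk']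
    with s a1 a2 a3
  have e : 𝒱 s (u s) - 𝒱 τ (u τ) - (A s (𝒱 τ (u τ)) - A τ (𝒱 τ (u τ)) + f τ s)
      = 𝒱 s (u s - u τ - W s (f τ s)) + (𝒱 s - 𝒱 τ - (A s * 𝒱 τ - A τ * 𝒱 τ)) (u τ) := by
    simp only [map_sub, fp.apply_inv, sub_apply, mul_apply_eq_comp]
    abel
  rw [e]
  have b1 : ‖𝒱 s (u s - u τ - W s (f τ s))‖ ≤ ε / 2 * |η s - η τ| :=
    calc _ ≤ ‖𝒱 s‖ * ‖u s - u τ - W s (f τ s)‖ := (𝒱 s).le_opNorm _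
      _ ≤ (k + 1) * (ε / 2 / (k + 1) * |η s - η τ|) := by
        gcongr; linarith [a3.1]
      _ = _ := by field_simp
  have b2 : ‖(𝒱 s - 𝒱 τ - (A s * 𝒱 τ - A τ * 𝒱 τ)) (u τ)‖ ≤ ε / 2 * |η s - η τ| :=
    calc _ ≤ ‖𝒱 s - 𝒱 τ - (A s * 𝒱 τ - A τ * 𝒱 τ)‖ * ‖u τ‖ := ContinuousLinearMap.le_opNorm _ _
      _ ≤ (ε / 2 / (‖u τ‖ + 1) * |η s - η τ|) * (‖u τ‖ + 1) := by
        gcongr; linarith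
      _ = _ := by field_simp
  exact (norm_add_le _ _).trans (by linarith)

theorem isPrimOn_inv [CompleteSpace X] (fp : IsFundamentalPair η A 𝒱 W)
    (hJ : HasInvertibleJumps A C) (hC : 0 < C) {f : ℝ → ℝ → X} {y : ℝ → X}
    (hy : IsPrimOn η S (fun τ s => A s (y τ) - A τ (y τ) + f τ s) y) :
    IsPrimOn η S (fun τ s => W s (f τ s)) (fun t => W t (y t)) := by
  intro ε hε τ hτ
  obtain ⟨k, hk, hk'⟩ := fp.eventually_norm_le hJ hC τ
  have h1 := (fp.isPrimOn.mono (subset_univ S)) (ε / 2 / (k + 1) / (‖W τ (y τ)‖ + 1))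
    (by positivity) τ hτ
  filter_upwards [hy (ε / 2 / (k + 1)) (by positivity) τ hτ, h1, mem_nhdsWithin_of_mem_nhds hk']
    with s a1 a2 a3
  have e : W s (y s) - W τ (y τ) - W s (f τ s)
      = W s ((y s - y τ - (A s (y τ) - A τ (y τ) + f τ s))
        - (𝒱 s - 𝒱 τ - (A s * 𝒱 τ - A τ * 𝒱 τ)) (W τ (y τ))) := by
    simp only [map_sub, map_add, fp.apply_inv, fp.inv_apply, sub_apply, mul_apply_eq_comp]
    abel
  rw [e]
  have b2 : ‖(𝒱 s - 𝒱 τ - (A s * 𝒱 τ - A τ * 𝒱 τ)) (W τ (y τ))‖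
      ≤ ε / 2 / (k + 1) * |η s - η τ| :=
    calc _ ≤ ‖𝒱 s - 𝒱 τ - (A s * 𝒱 τ - A τ * 𝒱 τ)‖ * ‖W τ (y τ)‖ :=
          ContinuousLinearMap.le_opNorm _ _
      _ ≤ (ε / 2 / (k + 1) / (‖W τ (y τ)‖ + 1) * |η s - η τ|) * (‖W τ (y τ)‖ + 1) := by
        gcongr; linarith
      _ = _ := by field_simp
  refine ((W s).le_opNorm _).trans ?_
  calc _ ≤ (k + 1) * (ε / 2 / (k + 1) * |η s - η τ| + ε / 2 / (k + 1) * |η s - η τ|) := by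
        gcongr
        · linarith [a3.2]
        · exact (_root_.norm_sub_le _ _).trans (add_le_add a1 b2)
    _ = _ := by field_simp; ring

theorem isLocDominatedOn_apply [CompleteSpace X] (fp : IsFundamentalPair η A 𝒱 W)
    (hJ : HasInvertibleJumps A C) (hC : 0 < C) {u : ℝ → X} (hu : IsLocDominatedOn η S u) :
    IsLocDominatedOn η S (fun t => 𝒱 t (u t)) := by
  intro R
  obtain ⟨M, hM1, hM, hM'⟩ := fp.exists_dominated hJ hC R
  obtain ⟨N, hN, hN'⟩ := hu R
  rcases (S ∩ Icc (-R) R).eq_empty_or_nonempty with he | ⟨t₀, ht₀⟩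
  · exact ⟨0, le_rfl, by simp [he]⟩
  have hη0 : 0 ≤ η R - η (-R) := sub_nonneg.2 (fp.mono (ht₀.2.1.trans ht₀.2.2))
  have hub : ∀ t ∈ S ∩ Icc (-R) R, ‖u t‖ ≤ ‖u t₀‖ + N * (η R - η (-R)) := by
    intro t ht
    have h1 := hN' t ht t₀ ht₀
    have h2 : |η t - η t₀| ≤ η R - η (-R) := by
      have a1 := fp.mono ht.2.1
      have a2 := fp.mono ht.2.2
      have a3 := fp.mono ht₀.2.1
      have a4 := fp.mono ht₀.2.2
      rw [abs_le]; constructor <;> linarith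
    have e : u t = u t₀ + (u t - u t₀) := by abel
    rw [e]
    refine (norm_add_le _ _).trans ?_
    gcongr
    exact h1.trans (by gcongr)
  set D := ‖u t₀‖ + N * (η R - η (-R))
  have hD : 0 ≤ D := by positivity
  refine ⟨M * N + M * D, by positivity, fun s hs t ht => ?_⟩
  have e : 𝒱 s (u s) - 𝒱 t (u t) = 𝒱 s (u s - u t) + (𝒱 s - 𝒱 t) (u t) := by
    simp only [map_sub, sub_apply]; abel
  rw [e]
  calc _ ≤ ‖𝒱 s‖ * ‖u s - u t‖ + ‖𝒱 s - 𝒱 t‖ * ‖u t‖ :=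
        (norm_add_le _ _).trans (add_le_add ((𝒱 s).le_opNorm _) ((𝒱 s - 𝒱 t).le_opNorm _))
    _ ≤ M * (N * |η s - η t|) + (M * |η s - η t|) * D := by
        gcongr
        exacts [(hM s hs.2).1, hN' s hs t ht, (hM' s hs.2 t ht.2).1, hub t ht]
    _ = _ := by ring

/-- The additivity defect has two parts, one from changing the state y c to y τ and one from
changing the weight W τ to W s. Each is a product of two increments dominated by η. -/
theorem isAlmostAdditiveOn_incr [CompleteSpace X] (fp : IsFundamentalPair η A 𝒱 W)
    (hJ : HasInvertibleJumps A C) (hC : 0 < C) {F : X → ℝ → X} (hF : InClassF F h)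
    (hh : ∀ s t, |h s - h t| ≤ |η s - η t|) {y : ℝ → X} (hy : IsLocDominatedOn η S y) (R : ℝ) :
    ∃ M, 0 ≤ M ∧ IsAlmostAdditiveOn η M (S ∩ Icc (-R) R) (fun τ s => W s (incr F y τ s)) := by
  obtain ⟨M, hM1, hM, hM'⟩ := fp.exists_dominated hJ hC R
  obtain ⟨N, hN, hN'⟩ := hy R
  refine ⟨M * N + M, by positivity, fun c hc τ hτ s hs => ?_⟩
  have e : W s (incr F y c s) - W τ (incr F y c τ) - W s (incr F y τ s)
      = W s ((F (y c) s - F (y c) τ - F (y τ) s + F (y τ) τ)) + (W s - W τ) (incr F y c τ) := by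
    simp only [incr, map_sub, map_add, sub_apply]; abel
  rw [e]
  calc _ ≤ ‖W s‖ * ‖F (y c) s - F (y c) τ - F (y τ) s + F (y τ) τ‖
          + ‖W s - W τ‖ * ‖incr F y c τ‖ :=
        (norm_add_le _ _).trans (add_le_add ((W s).le_opNorm _) ((W s - W τ).le_opNorm _))
    _ ≤ M * ((N * |η c - η τ|) * |η s - η τ|) + (M * |η s - η τ|) * |η τ - η c| := by
        gcongr
        · exact (hM s hs.2).2
        · refine (hF.2 _ _ _ _).trans ?_
          exact mul_le_mul (hN' c hc τ hτ) (hh s τ) (abs_nonneg _) (by positivity)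
        · exact (hM' s hs.2 τ hτ.2).2
        · exact (hF.norm_incr_le y c τ).trans (hh τ c)
    _ = _ := by rw [abs_sub_comm (η c)]; ring

theorem norm_sub_le_of_prim (fp : IsFundamentalPair η A 𝒱 W) (hS : S.OrdConnected)
    (hmono : Monotone h) {f : ℝ → ℝ → X} {v : ℝ → X}
    (hv : IsPrimOn η S (fun τ s => W s (f τ s)) v)
    (hf : ∀ τ s, ‖f τ s‖ ≤ |h s - h τ|) {R M : ℝ} (hM : ∀ t ∈ Icc (-R) R, ‖W t‖ ≤ M) {s t : ℝ}
    (hs : s ∈ S ∩ Icc (-R) R) (ht : t ∈ S ∩ Icc (-R) R) : ‖v s - v t‖ ≤ M * |h s - h t| := by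
  have hM0 : 0 ≤ M := (norm_nonneg _).trans (hM s hs.2)
  refine (hv.mono inter_subset_left).norm_sub_le_mul (S := S ∩ Icc (-R) R)
    (hS.inter ordConnected_Icc) fp.mono hmono hM0 (fun τ _ x hx => ?_) hs ht
  refine ((W x).le_opNorm _).trans ?_
  gcongr
  exacts [hM x hx.2, hf τ x]

theorem isLocDominatedOn_of_prim [CompleteSpace X] (fp : IsFundamentalPair η A 𝒱 W)
    (hJ : HasInvertibleJumps A C) (hC : 0 < C) (hS : S.OrdConnected) (hmono : Monotone h)
    (hh : ∀ s t, |h s - h t| ≤ |η s - η t|) {f : ℝ → ℝ → X} {v : ℝ → X}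
    (hv : IsPrimOn η S (fun τ s => W s (f τ s)) v) (hf : ∀ τ s, ‖f τ s‖ ≤ |h s - h τ|) :
    IsLocDominatedOn η S v := by
  intro R
  obtain ⟨M, hM1, hM⟩ := fp.exists_bound hJ hC R
  refine ⟨M, by linarith, fun s hs t ht => ?_⟩
  refine (fp.norm_sub_le_of_prim hS hmono hv hf (fun t ht => (hM t ht).2) hs ht).trans ?_
  exact mul_le_mul_of_nonneg_left (hh s t) (by linarith)

/-- Kernel estimate for primitives in the coordinates given by the fundamental solution. -/
theorem norm_clm_sub_le (fp : IsFundamentalPair η A 𝒱 W) {f : ℝ → ℝ → X} {v : ℝ → X}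
    (hv : IsPrimOn η S (fun τ s => W s (f τ s)) v) {L : X →L[ℝ] X} {κ a b c : ℝ} (hκ : 0 ≤ κ)
    (hab : a ≤ b) (hsub : Icc a b ⊆ S) (hL : ∀ s ∈ Icc a b, s ≠ c → ‖L * W s‖ ≤ κ) {m : ℝ → ℝ}
    (hm : Monotone m)
    (hf : ∀ τ ∈ Icc a b, ∀ᶠ s in 𝓝[Icc a b] τ, ‖f τ s‖ ≤ |m s - m τ|) :
    ‖L (v b - v a)‖ ≤ κ * (m b - m a) := by
  have := ((hv.mono hsub).clm_apply L).norm_sub_le (m := fun t => κ * m t) hab fp.mono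
    (fun x y hxy => mul_le_mul_of_nonneg_left (hm hxy) hκ) ?_
  · rwa [← map_sub, ← mul_sub] at this
  · intro τ hτ
    -- No kernel bound is needed at c: near τ ≠ c the point c is avoided, and for τ = c it appears
    -- only as s = τ, where the increment vanishes.
    have hne : ∀ᶠ s in 𝓝[Icc a b] τ, s = τ ∨ s ≠ c := by
      by_cases hτc : τ = c
      · subst hτc
        exact Eventually.of_forall fun s => em _
      · filter_upwards [mem_nhdsWithin_of_mem_nhds (isOpen_ne.mem_nhds hτc)] with s hs
          using Or.inr hs
    filter_upwards [hf τ hτ, hne, self_mem_nhdsWithin] with s h1 h2 hs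
    rcases h2 with rfl | h2
    · rw [sub_self, abs_zero, norm_le_zero_iff] at h1
      simp [h1]
    · rw [← mul_sub, abs_mul, abs_of_nonneg hκ, ← mul_apply_eq_comp]
      refine ((L * W s).le_opNorm _).trans ?_
      gcongr
      exact hL s hs h2

/-- A common contraction argument for the initial value problem and for solutions near a linear one.
The predicate N normalizes the primitive, by its value at a point or by boundedness; `hE` supplies
it and `hB` makes the solution operator a half-contraction. -/
theorem exists_solution [CompleteSpace X] (fp : IsFundamentalPair η A 𝒱 W)
    (hJ : HasInvertibleJumps A C) (hC : 0 < C) {F : X → ℝ → X} (hF : InClassF F h)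
    (hmono : Monotone h) (hh : ∀ s t, |h s - h t| ≤ |η s - η t|) (hS : S.OrdConnected)
    {N : (ℝ → X) → Prop} (hN : ∀ v v', N v → N v' → N fun t => v t - v' t)
    (hE : ∀ y, IsLocDominatedOn η S y →
      ∃ v, IsPrimOn η S (fun τ s => W s (incr F y τ s)) v ∧ N v)
    (hB : ∀ (f : ℝ → ℝ → X) (v : ℝ → X) (B : ℝ), 0 ≤ B →
      IsPrimOn η S (fun τ s => W s (f τ s)) v → N v →
      (∀ τ ∈ S, ∀ s ∈ S, ‖f τ s‖ ≤ B * |h s - h τ|) → ∀ t ∈ S, ‖𝒱 t (v t)‖ ≤ B / 2) (u₀ : X) :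
    ∃ v, IsPrimOn η S (fun τ s => W s (incr F (fun t => 𝒱 t (u₀ + v t)) τ s)) v ∧ N v := by
  classical
  -- All members share the same Lipschitz constants relative to h, so Z is closed under pointwise
  -- limits, and sewing applies along each of its members.
  set Z : Set (ℝ → X) := {v | ∀ R M, (∀ t ∈ Icc (-R) R, ‖W t‖ ≤ M) →
    ∀ s ∈ S ∩ Icc (-R) R, ∀ t ∈ S ∩ Icc (-R) R, ‖v s - v t‖ ≤ M * |h s - h t|} with hZdef
  have hZdom : ∀ v ∈ Z, IsLocDominatedOn η S (fun t => 𝒱 t (u₀ + v t)) := by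
    intro v hv
    refine fp.isLocDominatedOn_apply hJ hC fun R => ?_
    obtain ⟨M, hM1, hM⟩ := fp.exists_bound hJ hC R
    refine ⟨M, by linarith, fun s hs t ht => ?_⟩
    rw [add_sub_add_left_eq_sub]
    refine (hv R M (fun t ht => (hM t ht).2) s hs t ht).trans ?_
    exact mul_le_mul_of_nonneg_left (hh s t) (by linarith)
  have hex : ∀ v, ∃ v', v ∈ Z → IsPrimOn η S
      (fun τ s => W s (incr F (fun t => 𝒱 t (u₀ + v t)) τ s)) v' ∧ N v' := by
    intro v
    by_cases hv : v ∈ Z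
    · obtain ⟨v', hv'⟩ := hE _ (hZdom v hv)
      exact ⟨v', fun _ => hv'⟩
    · exact ⟨0, fun h => absurd h hv⟩
  choose T hT using hex
  -- The iteration runs in the coordinates z = 𝒱 v, where `hB` gives a uniform contraction; the
  -- value 0 off S is a harmless default.
  set T' : (ℝ → X) → ℝ → X := fun z t => if t ∈ S then 𝒱 t (T (fun t => W t (z t)) t) else 0
    with hT'
  have hWT : ∀ z, ∀ t ∈ S, W t (T' z t) = T (fun t => W t (z t)) t := by
    intro z t ht
    simp only [hT', if_pos ht, fp.inv_apply]
  obtain ⟨z, hzZ, hz⟩ := exists_fixedPoint_of_half_contracting (T := T')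
    (Z := {z | (fun t => W t (z t)) ∈ Z}) (z₀ := fun _ => 0) (B₀ := 1 / 2) (by
      intro z hz R M hM s hs t ht
      simp only [hWT z s hs.1, hWT z t ht.1]
      exact fp.norm_sub_le_of_prim hS hmono (hT _ hz).1 (hF.norm_incr_le _) hM hs ht) (by
      intro z w hz hw R M hM s hs t ht
      exact le_of_tendsto' ((((W s).continuous.tendsto _).comp (hw s)).sub
        (((W t).continuous.tendsto _).comp (hw t))).norm fun n => hz n R M hM s hs t ht) (by
      intro z hz z' hz' B hzz t
      have hB0 : 0 ≤ B := (norm_nonneg _).trans (hzz t)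
      by_cases ht : t ∈ S
      · simp only [hT', if_pos ht]
        rw [← map_sub]
        refine hB (fun τ s => incr F (fun t => 𝒱 t (u₀ + W t (z t))) τ s
          - incr F (fun t => 𝒱 t (u₀ + W t (z' t))) τ s) _ B hB0 ?_
          (hN _ _ (hT _ hz).2 (hT _ hz').2) (fun τ _ s _ => ?_) t ht
        · exact ((hT _ hz).1.sub (hT _ hz').1).congr (fun τ _ s _ => (map_sub _ _ _).symm)
            fun _ _ => rfl
        · refine (hF.norm_incr_sub_le _ _ _ _).trans ?_
          gcongr
          rw [map_add, map_add, fp.apply_inv, fp.apply_inv, add_sub_add_left_eq_sub]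
          exact hzz τ
      · simp only [hT', if_neg ht, sub_self, norm_zero]
        positivity) (by
      intro R M hM s hs t ht
      have hM0 : 0 ≤ M := (norm_nonneg _).trans (hM s hs.2)
      change ‖W s 0 - W t 0‖ ≤ _
      rw [map_zero, map_zero, sub_self, norm_zero]
      positivity) (by
      intro t
      rw [sub_zero]
      have h0 : (fun t => W t ((fun _ : ℝ => (0 : X)) t)) ∈ Z := by
        intro R M hM s hs t ht
        have hM0 : 0 ≤ M := (norm_nonneg _).trans (hM s hs.2)
        change ‖W s 0 - W t 0‖ ≤ _
        rw [map_zero, map_zero, sub_self, norm_zero]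
        positivity
      by_cases ht : t ∈ S
      · simp only [hT', if_pos ht]
        exact hB _ _ 1 zero_le_one (hT _ h0).1 (hT _ h0).2 (fun τ _ s _ => by
          rw [one_mul]; exact hF.norm_incr_le _ _ _) t ht
      · simp [hT', if_neg ht])
  refine ⟨T (fun t => W t (z t)), (hT _ hzZ).1.congr (fun τ hτ s _ => ?_) fun _ _ => rfl,
    (hT _ hzZ).2⟩
  have : T (fun t => W t (z t)) τ = W τ (z τ) := by
    rw [← hWT z τ hτ, hz]
  simp only [incr, this]

end IsFundamentalPair

end Coordinates

/-! ### Global initial value problem for the perturbed equation. -/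

section InitialValue

variable {X : Type*} [NormedAddCommGroup X] [NormedSpace ℝ X]
  {η h : ℝ → ℝ} {A 𝒱 W : ℝ → X →L[ℝ] X} {C δ κ : ℝ} {S T : Set ℝ} {F : X → ℝ → X} {y y' : ℝ → X}

/-- `y` is a local solution on `S` of `dx/dτ = D[A(t)x + F(x, t)]`. -/
def IsLocalSolutionOn (η : ℝ → ℝ) (A : ℝ → X →L[ℝ] X) (F : X → ℝ → X) (S : Set ℝ)
    (y : ℝ → X) : Prop :=
  IsPrimOn η S (fun τ s => A s (y τ) - A τ (y τ) + incr F y τ s) y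

theorem IsLocalSolutionOn.mono (hy : IsLocalSolutionOn η A F T y) (hST : S ⊆ T) :
    IsLocalSolutionOn η A F S y := IsPrimOn.mono hy hST

theorem IsLocalSolutionOn.congr (hy : IsLocalSolutionOn η A F S y) (he : EqOn y y' S) :
    IsLocalSolutionOn η A F S y' :=
  IsPrimOn.congr hy (fun τ hτ s _ => by simp only [incr, he hτ]) he

theorem IsLocalSolutionOn.exists_append {a b c : ℝ} (hab : a ≤ b) (hbc : b ≤ c)
    (hy : IsLocalSolutionOn η A F (Icc a b) y) (hy' : IsLocalSolutionOn η A F (Icc b c) y')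
    (he : y b = y' b) :
    ∃ z, IsLocalSolutionOn η A F (Icc a c) z ∧ EqOn z y (Icc a b) ∧ EqOn z y' (Icc b c) := by
  have h1 : EqOn (fun t => if t ≤ b then y t else y' t) y (Icc a b) := fun t ht => if_pos ht.2
  have h2 : EqOn (fun t => if t ≤ b then y t else y' t) y' (Icc b c) := fun t ht => by
    rcases eq_or_lt_of_le ht.1 with h | h
    · simp [← h, he]
    · simp [not_le.2 h]
  exact ⟨_, IsPrimOn.union_Icc (hy.congr h1.symm) (hy'.congr h2.symm) hab hbc, h1, h2⟩

theorem IsLocDominatedOn.exists_norm_le {a b : ℝ} (hη : Monotone η)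
    (hy : IsLocDominatedOn η (Icc a b) y) : ∃ B, ∀ t ∈ Icc a b, ‖y t‖ ≤ B := by
  rcases le_or_gt a b with hab | hab
  · obtain ⟨M, hM, hM'⟩ := hy (max |a| |b|)
    have hsub : Icc a b ⊆ Icc (-(max |a| |b|)) (max |a| |b|) := by
      refine Icc_subset_Icc ?_ ?_
      · linarith [neg_abs_le a, le_max_left |a| |b|]
      · linarith [le_abs_self b, le_max_right |a| |b|]
    refine ⟨‖y a‖ + M * (η b - η a), fun t ht => ?_⟩
    have h1 := hM' t ⟨ht, hsub ht⟩ a ⟨left_mem_Icc.2 hab, hsub (left_mem_Icc.2 hab)⟩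
    rw [abs_of_nonneg (sub_nonneg.2 (hη ht.1))] at h1
    have e : y t = y a + (y t - y a) := by abel
    rw [e]
    refine (norm_add_le _ _).trans ?_
    gcongr
    refine h1.trans ?_
    gcongr
    exact hη ht.2
  · exact ⟨0, by simp [Icc_eq_empty (not_le.2 hab)]⟩

namespace IsFundamentalPair

theorem norm_apply_sub_le (fp : IsFundamentalPair η A 𝒱 W) (hmono : Monotone h)
    {f : ℝ → ℝ → X} {v : ℝ → X} (hv : IsPrimOn η S (fun τ s => W s (f τ s)) v) (hκ : 0 ≤ κ)
    {c t B : ℝ} (hsub : uIcc c t ⊆ S) (hker : ∀ s ∈ uIcc c t, s ≠ c → ‖𝒱 t * W s‖ ≤ κ)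
    (hB : 0 ≤ B) (hf : ∀ τ ∈ S, ∀ s ∈ S, ‖f τ s‖ ≤ B * |h s - h τ|) :
    ‖𝒱 t (v t - v c)‖ ≤ κ * (B * |h t - h c|) := by
  have hBmono : Monotone fun t => B * h t := fun x y hxy =>
    mul_le_mul_of_nonneg_left (hmono hxy) hB
  have hf' : ∀ τ ∈ S, ∀ s ∈ S, ‖f τ s‖ ≤ |B * h s - B * h τ| := fun τ hτ s hs => by
    rw [← mul_sub, abs_mul, abs_of_nonneg hB]; exact hf τ hτ s hs
  rcases le_total c t with hct | hct
  · rw [uIcc_of_le hct] at hsub hker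
    have := fp.norm_clm_sub_le hv hκ hct hsub hker hBmono fun τ hτ => by
      filter_upwards [self_mem_nhdsWithin] with s hs using hf' τ (hsub hτ) s (hsub hs)
    rwa [abs_of_nonneg (sub_nonneg.2 (hmono hct)), mul_sub]
  · rw [uIcc_of_ge hct] at hsub hker
    have := fp.norm_clm_sub_le hv hκ hct hsub hker hBmono fun τ hτ => by
      filter_upwards [self_mem_nhdsWithin] with s hs using hf' τ (hsub hτ) s (hsub hs)
    rw [← neg_sub, map_neg, norm_neg, abs_sub_comm, abs_of_nonneg (sub_nonneg.2 (hmono hct)),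
      mul_sub]
    exact this

variable [CompleteSpace X]

theorem isLocalSolutionOn_of_prim (fp : IsFundamentalPair η A 𝒱 W)
    (hJ : HasInvertibleJumps A C) (hC : 0 < C) {v : ℝ → X} {u₀ : X}
    (hv : IsPrimOn η S (fun τ s => W s (incr F (fun t => 𝒱 t (u₀ + v t)) τ s)) v) :
    IsLocalSolutionOn η A F S (fun t => 𝒱 t (u₀ + v t)) :=
  fp.isPrimOn_of_inv hJ hC ((hv.sub_const (-u₀)).congr (fun _ _ _ _ => rfl) fun s _ => by abel)

theorem isLocDominatedOn_of_solution (fp : IsFundamentalPair η A 𝒱 W)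
    (hJ : HasInvertibleJumps A C) (hC : 0 < C) (hF : InClassF F h) (hmono : Monotone h)
    (hh : ∀ s t, |h s - h t| ≤ |η s - η t|) (hS : S.OrdConnected)
    (hy : IsLocalSolutionOn η A F S y) : IsLocDominatedOn η S y := by
  have := fp.isLocDominatedOn_apply hJ hC (fp.isLocDominatedOn_of_prim hJ hC hS hmono hh
    (fp.isPrimOn_inv hJ hC hy) (hF.norm_incr_le y))
  simpa only [fp.apply_inv] using this

/-- The fixed point argument with primitives normalized to vanish at c; the contraction factor is κδ
≤ 1 / 2. -/
theorem exists_solution_Icc (fp : IsFundamentalPair η A 𝒱 W)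
    (hJ : HasInvertibleJumps A C) (hC : 0 < C) (hF : InClassF F h) (hmono : Monotone h)
    (hh : ∀ s t, |h s - h t| ≤ |η s - η t|) (hδ : ∀ s t, |h s - h t| ≤ δ) (hκ : 0 ≤ κ)
    (hκδ : κ * δ ≤ 1 / 2) {a b c : ℝ} (hc : c ∈ Icc a b)
    (hker : ∀ t ∈ Icc a b, ∀ s ∈ uIcc c t, s ≠ c → ‖𝒱 t * W s‖ ≤ κ) (x₀ : X) :
    ∃ y, IsLocalSolutionOn η A F (Icc a b) y ∧ y c = x₀ := by
  have hab : a ≤ b := hc.1.trans hc.2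
  obtain ⟨v, hv, hvc⟩ := fp.exists_solution hJ hC hF hmono hh (S := Icc a b) ordConnected_Icc
    (N := fun v => v c = 0) (fun v v' h1 h2 => by simp [h1, h2]) (fun y hy => by
      obtain ⟨M, hM, hM'⟩ := fp.isAlmostAdditiveOn_incr hJ hC hF hh hy (max |a| |b|)
      obtain ⟨g, hg⟩ := (hM'.mono (S := Icc a b) (subset_inter le_rfl (Icc_subset_Icc
        (by linarith [neg_abs_le a, le_max_left |a| |b|])
        (by linarith [le_abs_self b, le_max_right |a| |b|])))).exists_isPrimOn_Icc fp.mono hM hab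
      exact ⟨_, hg.sub_const (g c), sub_self _⟩) (fun f v B hB hv hvc hf t ht => by
      have := fp.norm_apply_sub_le hmono hv hκ (ordConnected_Icc.uIcc_subset hc ht) (hker t ht)
        hB hf
      rw [hvc, sub_zero] at this
      refine this.trans ?_
      calc κ * (B * |h t - h c|) ≤ κ * (B * δ) := by gcongr; exact hδ t c
        _ = B * (κ * δ) := by ring
        _ ≤ B * (1 / 2) := by gcongr
        _ = B / 2 := by ring) (W c x₀)
  exact ⟨_, fp.isLocalSolutionOn_of_prim hJ hC hv, by simp [hvc, fp.apply_inv]⟩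

/-- The difference y - y' is the transported initial difference, at most M² ‖y c - y' c‖, plus a
term at most half of any bound for the difference, which is absorbed. The constant may depend on the
interval: only continuity and uniqueness are drawn from it. -/
theorem exists_lipschitz_Icc (fp : IsFundamentalPair η A 𝒱 W)
    (hJ : HasInvertibleJumps A C) (hC : 0 < C) (hF : InClassF F h) (hmono : Monotone h)
    (hh : ∀ s t, |h s - h t| ≤ |η s - η t|) (hδ : ∀ s t, |h s - h t| ≤ δ) (hκ : 0 ≤ κ)
    (hκδ : κ * δ ≤ 1 / 2) {a b c : ℝ} (hc : c ∈ Icc a b)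
    (hker : ∀ t ∈ Icc a b, ∀ s ∈ uIcc c t, s ≠ c → ‖𝒱 t * W s‖ ≤ κ) :
    ∃ L, 0 ≤ L ∧ ∀ y y', IsLocalSolutionOn η A F (Icc a b) y →
      IsLocalSolutionOn η A F (Icc a b) y' → ∀ t ∈ Icc a b, ‖y t - y' t‖ ≤ L * ‖y c - y' c‖ := by
  obtain ⟨M, hM1, hM⟩ := fp.exists_bound hJ hC (max |a| |b|)
  have hsub : Icc a b ⊆ Icc (-(max |a| |b|)) (max |a| |b|) := Icc_subset_Icc
    (by linarith [neg_abs_le a, le_max_left |a| |b|])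
    (by linarith [le_abs_self b, le_max_right |a| |b|])
  refine ⟨2 * (M * M), by positivity, fun y y' hy hy' => ?_⟩
  rw [mul_assoc]
  refine le_two_mul_of_forall_bound (S := Icc a b) (w := fun t => ‖y t - y' t‖)
    (D := M * M * ‖y c - y' c‖) ?_ ?_
  · obtain ⟨B, hB⟩ := (fp.isLocDominatedOn_of_solution hJ hC hF hmono hh ordConnected_Icc
      hy).exists_norm_le fp.mono
    obtain ⟨B', hB'⟩ := (fp.isLocDominatedOn_of_solution hJ hC hF hmono hh ordConnected_Icc
      hy').exists_norm_le fp.mono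
    exact ⟨B + B', fun t ht => (_root_.norm_sub_le _ _).trans (add_le_add (hB t ht) (hB' t ht))⟩
  · intro B hB t ht
    have hB0 : 0 ≤ B := (norm_nonneg _).trans (hB t ht)
    have hv : IsPrimOn η (Icc a b) (fun τ s => W s (incr F y τ s - incr F y' τ s))
        (fun t => W t (y t) - W t (y' t)) :=
      ((fp.isPrimOn_inv hJ hC hy).sub (fp.isPrimOn_inv hJ hC hy')).congr
        (fun τ _ s _ => (map_sub _ _ _).symm) fun _ _ => rfl
    have h1 := fp.norm_apply_sub_le hmono hv hκ (ordConnected_Icc.uIcc_subset hc ht) (hker t ht)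
      hB0 fun τ hτ s _ => (hF.norm_incr_sub_le _ _ _ _).trans (by gcongr; exact hB τ hτ)
    have e : y t - y' t = 𝒱 t (W c (y c - y' c))
        + 𝒱 t (W t (y t) - W t (y' t) - (W c (y c) - W c (y' c))) := by
      simp only [map_sub, fp.apply_inv]; abel
    change ‖y t - y' t‖ ≤ _
    rw [e]
    refine (norm_add_le _ _).trans (add_le_add ?_ (h1.trans ?_))
    · calc ‖𝒱 t (W c (y c - y' c))‖ ≤ ‖𝒱 t‖ * (‖W c‖ * ‖y c - y' c‖) :=
            ((𝒱 t).le_opNorm _).trans (by gcongr; exact (W c).le_opNorm _)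
        _ ≤ M * (M * ‖y c - y' c‖) := by
            gcongr
            exacts [(hM t (hsub ht)).1, (hM c (hsub hc)).2]
        _ = _ := by ring
    · calc κ * (B * |h t - h c|) ≤ κ * (B * δ) := by gcongr; exact hδ t c
        _ = B * (κ * δ) := by ring
        _ ≤ B * (1 / 2) := by gcongr
        _ = B / 2 := by ring

end IsFundamentalPair

/-- The solutions on `[a, b]` are parametrized, in a Lipschitz way, by their values at `a` and by
their values at `b`. -/
structure HasFlow (η : ℝ → ℝ) (A : ℝ → X →L[ℝ] X) (F : X → ℝ → X) (a b : ℝ) : Prop where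
  exists_left : ∀ x₀, ∃ y, IsLocalSolutionOn η A F (Icc a b) y ∧ y a = x₀
  exists_right : ∀ x₀, ∃ y, IsLocalSolutionOn η A F (Icc a b) y ∧ y b = x₀
  lipschitz_left : ∃ L, 0 ≤ L ∧ ∀ y y', IsLocalSolutionOn η A F (Icc a b) y →
    IsLocalSolutionOn η A F (Icc a b) y' → ∀ t ∈ Icc a b, ‖y t - y' t‖ ≤ L * ‖y a - y' a‖
  lipschitz_right : ∃ L, 0 ≤ L ∧ ∀ y y', IsLocalSolutionOn η A F (Icc a b) y →
    IsLocalSolutionOn η A F (Icc a b) y' → ∀ t ∈ Icc a b, ‖y t - y' t‖ ≤ L * ‖y b - y' b‖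

theorem HasFlow.trans {a b c : ℝ} (hab : a ≤ b) (hbc : b ≤ c) (h₁ : HasFlow η A F a b)
    (h₂ : HasFlow η A F b c) : HasFlow η A F a c := by
  have s₁ : Icc a b ⊆ Icc a c := Icc_subset_Icc le_rfl hbc
  have s₂ : Icc b c ⊆ Icc a c := Icc_subset_Icc hab le_rfl
  refine ⟨fun x₀ => ?_, fun x₀ => ?_, ?_, ?_⟩
  · obtain ⟨y, hy, hya⟩ := h₁.exists_left x₀
    obtain ⟨y', hy', hyb⟩ := h₂.exists_left (y b)
    obtain ⟨z, hz, hz1, hz2⟩ := hy.exists_append hab hbc hy' hyb.symm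
    exact ⟨z, hz, by rw [hz1 (left_mem_Icc.2 hab), hya]⟩
  · obtain ⟨y', hy', hyc⟩ := h₂.exists_right x₀
    obtain ⟨y, hy, hyb⟩ := h₁.exists_right (y' b)
    obtain ⟨z, hz, hz1, hz2⟩ := hy.exists_append hab hbc hy' hyb
    exact ⟨z, hz, by rw [hz2 (right_mem_Icc.2 hbc), hyc]⟩
  · obtain ⟨L, hL, hL'⟩ := h₁.lipschitz_left
    obtain ⟨M, hM, hM'⟩ := h₂.lipschitz_left
    refine ⟨L + M * L, by positivity, fun y y' hy hy' t ht => ?_⟩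
    have hb := hL' y y' (hy.mono s₁) (hy'.mono s₁) b (right_mem_Icc.2 hab)
    have h0 := norm_nonneg (y a - y' a)
    rcases le_total t b with htb | htb
    · refine (hL' y y' (hy.mono s₁) (hy'.mono s₁) t ⟨ht.1, htb⟩).trans ?_
      gcongr
      exact le_add_of_nonneg_right (by positivity)
    · refine (hM' y y' (hy.mono s₂) (hy'.mono s₂) t ⟨htb, ht.2⟩).trans ?_
      calc M * ‖y b - y' b‖ ≤ M * (L * ‖y a - y' a‖) := by gcongr
        _ ≤ L * ‖y a - y' a‖ + M * (L * ‖y a - y' a‖) := le_add_of_nonneg_left (by positivity)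
        _ = _ := by ring
  · obtain ⟨L, hL, hL'⟩ := h₁.lipschitz_right
    obtain ⟨M, hM, hM'⟩ := h₂.lipschitz_right
    refine ⟨M + L * M, by positivity, fun y y' hy hy' t ht => ?_⟩
    have hb := hM' y y' (hy.mono s₂) (hy'.mono s₂) b (left_mem_Icc.2 hbc)
    have h0 := norm_nonneg (y c - y' c)
    rcases le_total t b with htb | htb
    · refine (hL' y y' (hy.mono s₁) (hy'.mono s₁) t ⟨ht.1, htb⟩).trans ?_
      calc L * ‖y b - y' b‖ ≤ L * (M * ‖y c - y' c‖) := by gcongr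
        _ ≤ M * ‖y c - y' c‖ + L * (M * ‖y c - y' c‖) := le_add_of_nonneg_left (by positivity)
        _ = _ := by ring
    · refine (hM' y y' (hy.mono s₂) (hy'.mono s₂) t ⟨htb, ht.2⟩).trans ?_
      gcongr
      exact le_add_of_nonneg_right (by positivity)

/-- On short intervals with endpoint τ the kernels are at most C + 2, so the contraction works from
either endpoint, even across a jump; Cousin's lemma concatenates the pieces. Solving from the right
endpoint supplies backward solvability across jumps of A + F. -/
theorem IsFundamentalPair.hasFlow [CompleteSpace X] (fp : IsFundamentalPair η A 𝒱 W)
    (hJ : HasInvertibleJumps A C) (hC : 0 < C) (hF : InClassF F h) (hmono : Monotone h)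
    (hh : ∀ s t, |h s - h t| ≤ |η s - η t|) (hδ : ∀ s t, |h s - h t| ≤ δ)
    (hCδ : (C + 2) * δ ≤ 1 / 2) {a b : ℝ} (hab : a ≤ b) : HasFlow η A F a b := by
  have hκ : 0 ≤ C + 2 := by linarith
  have hone : ∀ t, ‖𝒱 t * W t‖ ≤ C + 2 := fun t => by
    rw [fp.mul_inv]
    exact ContinuousLinearMap.norm_id_le.trans (by linarith)
  refine interval_induction (Q := HasFlow η A F) hab
    (fun x y z _ hxy hyz _ h1 h2 => h1.trans hxy hyz h2) fun τ _ => ?_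
  filter_upwards [mem_nhdsWithin_of_mem_nhds (fp.eventually_norm_mul_inv_le hJ hC τ)] with q hq
  have kτ : ∀ t ∈ uIcc τ q, ∀ s ∈ uIcc τ t, s ≠ τ → ‖𝒱 t * W s‖ ≤ C + 2 :=
    fun t ht s hs hsτ => hq s (uIcc_subset_uIcc left_mem_uIcc ht hs) t ht hsτ
  have kq : ∀ t ∈ uIcc τ q, ∀ s ∈ uIcc q t, s ≠ q → ‖𝒱 t * W s‖ ≤ C + 2 := by
    intro t ht s hs hsq
    -- The point s = τ, not covered by the local bound, lies between q and t only if t = τ, and then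
    -- 𝒱 t W s is the identity.
    by_cases hsτ : s = τ
    · subst hsτ
      have : t = s := by
        rcases le_total s q with h | h
        · rw [uIcc_of_le h] at ht
          rw [uIcc_of_ge ht.2] at hs
          exact le_antisymm hs.1 ht.1
        · rw [uIcc_of_ge h] at ht
          rw [uIcc_of_le ht.1] at hs
          exact le_antisymm ht.2 hs.2
      rw [this]
      exact hone s
    · exact hq s (uIcc_subset_uIcc right_mem_uIcc ht hs) t ht hsτ
  constructor
  · intro h
    rw [uIcc_of_ge h] at kτ kq
    exact ⟨fp.exists_solution_Icc hJ hC hF hmono hh hδ hκ hCδ (left_mem_Icc.2 h) kq,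
      fp.exists_solution_Icc hJ hC hF hmono hh hδ hκ hCδ (right_mem_Icc.2 h) kτ,
      fp.exists_lipschitz_Icc hJ hC hF hmono hh hδ hκ hCδ (left_mem_Icc.2 h) kq,
      fp.exists_lipschitz_Icc hJ hC hF hmono hh hδ hκ hCδ (right_mem_Icc.2 h) kτ⟩
  · intro h
    rw [uIcc_of_le h] at kτ kq
    exact ⟨fp.exists_solution_Icc hJ hC hF hmono hh hδ hκ hCδ (left_mem_Icc.2 h) kτ,
      fp.exists_solution_Icc hJ hC hF hmono hh hδ hκ hCδ (right_mem_Icc.2 h) kq,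
      fp.exists_lipschitz_Icc hJ hC hF hmono hh hδ hκ hCδ (left_mem_Icc.2 h) kτ,
      fp.exists_lipschitz_Icc hJ hC hF hmono hh hδ hκ hCδ (right_mem_Icc.2 h) kq⟩

theorem exists_lipschitz_of_hasFlow (hflow : ∀ a b, a ≤ b → HasFlow η A F a b) (c : ℝ) {R : ℝ}
    (hR : 0 ≤ R) : ∃ L, 0 ≤ L ∧ ∀ y y', IsLocalSolutionOn η A F (Icc (c - R) (c + R)) y →
      IsLocalSolutionOn η A F (Icc (c - R) (c + R)) y' →
      ∀ t ∈ Icc (c - R) (c + R), ‖y t - y' t‖ ≤ L * ‖y c - y' c‖ := by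
  obtain ⟨L, hL, hL'⟩ := (hflow (c - R) c (by linarith)).lipschitz_right
  obtain ⟨M, hM, hM'⟩ := (hflow c (c + R) (by linarith)).lipschitz_left
  have s₁ : Icc (c - R) c ⊆ Icc (c - R) (c + R) := Icc_subset_Icc le_rfl (by linarith)
  have s₂ : Icc c (c + R) ⊆ Icc (c - R) (c + R) := Icc_subset_Icc (by linarith) le_rfl
  refine ⟨L + M, by positivity, fun y y' hy hy' t ht => ?_⟩
  rcases le_total t c with htc | htc
  · refine (hL' y y' (hy.mono s₁) (hy'.mono s₁) t ⟨ht.1, htc⟩).trans ?_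
    gcongr
    linarith
  · refine (hM' y y' (hy.mono s₂) (hy'.mono s₂) t ⟨htc, ht.2⟩).trans ?_
    gcongr
    linarith

theorem exists_global_solution (hflow : ∀ a b, a ≤ b → HasFlow η A F a b) (c : ℝ) (x₀ : X) :
    ∃ y, IsLocalSolutionOn η A F univ y ∧ y c = x₀ := by
  have hn : ∀ n : ℕ, (0 : ℝ) ≤ n := fun n => n.cast_nonneg
  obtain ⟨g, hg⟩ := exists_glue
    (p := fun n y => IsLocalSolutionOn η A F (Icc (c - n) (c + n)) y ∧ y c = x₀) c
    (fun n => by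
      have h1 : c - n ≤ c := by linarith [hn n]
      have h2 : c ≤ c + n := by linarith [hn n]
      obtain ⟨y, hy, hyc⟩ := (hflow _ _ h1).exists_right x₀
      obtain ⟨y', hy', hyc'⟩ := (hflow _ _ h2).exists_left x₀
      obtain ⟨z, hz, hz1, -⟩ := hy.exists_append h1 h2 hy' (hyc.trans hyc'.symm)
      exact ⟨z, hz, by rw [hz1 (right_mem_Icc.2 h1), hyc]⟩)
    (fun n k y hnk hy => by
      have hnk' : (n : ℝ) ≤ k := by exact_mod_cast hnk
      exact ⟨hy.1.mono (Icc_subset_Icc (by linarith) (by linarith)), hy.2⟩)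
    (fun n y y' hy hy' t ht => by
      obtain ⟨L, -, hL⟩ := exists_lipschitz_of_hasFlow hflow c (hn n)
      have := hL y y' hy.1 hy'.1 t ht
      rw [hy.2, hy'.2, sub_self, norm_zero, mul_zero, norm_le_zero_iff] at this
      exact sub_eq_zero.1 this)
  refine ⟨g, IsPrimOn.of_forall_Icc (c := c) fun n => ?_, ?_⟩
  · obtain ⟨y, hy, he⟩ := hg n
    exact hy.1.congr he
  · obtain ⟨y, hy, he⟩ := hg 0
    rw [← he (by simp), hy.2]

end InitialValue

/-! ### Bounded primitives under a dichotomy; matching perturbed and linear solutions. -/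

section Dichotomy

variable {X : Type*} [NormedAddCommGroup X] [NormedSpace ℝ X]
  {η h m : ℝ → ℝ} {A 𝒱 W : ℝ → X →L[ℝ] X} {C δ K α μ : ℝ} {F : X → ℝ → X} {y y' : ℝ → X}
  {P : X →L[ℝ] X}

/-- Exponential dichotomy in terms of a fundamental solution and its inverse. -/
structure IsDichotomy (𝒱 W : ℝ → X →L[ℝ] X) (P : X →L[ℝ] X) (K α : ℝ) : Prop where
  K_pos : 0 < K
  α_pos : 0 < α
  idem : P * P = P
  stable : ∀ t s, s ≤ t → ‖𝒱 t * P * W s‖ ≤ K * Real.exp (-α * (t - s))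
  unstable : ∀ t s, t < s → ‖𝒱 t * (1 - P) * W s‖ ≤ K * Real.exp (α * (t - s))

namespace IsDichotomy

theorem stable_le (d : IsDichotomy 𝒱 W P K α) {t s : ℝ} (hst : s ≤ t) : ‖𝒱 t * P * W s‖ ≤ K := by
  refine (d.stable t s hst).trans (mul_le_of_le_one_right d.K_pos.le ?_)
  rw [Real.exp_le_one_iff]
  nlinarith [d.α_pos]

theorem unstable_le (d : IsDichotomy 𝒱 W P K α) {t s : ℝ} (hts : t < s) :
    ‖𝒱 t * (1 - P) * W s‖ ≤ K := by
  refine (d.unstable t s hts).trans (mul_le_of_le_one_right d.K_pos.le ?_)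
  rw [Real.exp_le_one_iff]
  nlinarith [d.α_pos]

variable {f : ℝ → ℝ → X} {v : ℝ → X}

theorem norm_stable_sub_le (d : IsDichotomy 𝒱 W P K α) (fp : IsFundamentalPair η A 𝒱 W)
    (hv : IsPrimOn η univ (fun τ s => W s (f τ s)) v) (hm : Monotone m)
    (hf : ∀ τ, ∀ᶠ s in 𝓝 τ, ‖f τ s‖ ≤ |m s - m τ|) {r s t : ℝ} (hrs : r ≤ s) (hst : s ≤ t) :
    ‖𝒱 t (P (v s - v r))‖ ≤ K * (m s - m r) :=
  fp.norm_clm_sub_le hv (L := 𝒱 t * P) (c := s) d.K_pos.le hrs (subset_univ _)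
    (fun _ hx _ => d.stable_le (hx.2.trans hst)) hm
    fun τ _ => (hf τ).filter_mono nhdsWithin_le_nhds

/-- The dichotomy bounds the unstable kernel only for t < s, so t is taken as the exceptional point
of the kernel estimate. -/
theorem norm_unstable_sub_le (d : IsDichotomy 𝒱 W P K α) (fp : IsFundamentalPair η A 𝒱 W)
    (hv : IsPrimOn η univ (fun τ s => W s (f τ s)) v) (hm : Monotone m)
    (hf : ∀ τ, ∀ᶠ s in 𝓝 τ, ‖f τ s‖ ≤ |m s - m τ|) {r s t : ℝ} (hts : t ≤ s) (hsr : s ≤ r) :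
    ‖𝒱 t ((1 - P) (v r - v s))‖ ≤ K * (m r - m s) :=
  fp.norm_clm_sub_le hv (L := 𝒱 t * (1 - P)) (c := t) d.K_pos.le hsr (subset_univ _)
    (fun _ hx hxt => d.unstable_le (lt_of_le_of_ne (hts.trans hx.1) hxt.symm)) hm
    fun τ _ => (hf τ).filter_mono nhdsWithin_le_nhds

theorem apply_eq_add (t : ℝ) (x : X) : 𝒱 t x = 𝒱 t (P x) + 𝒱 t ((1 - P) x) := by
  rw [← map_add, sub_apply, one_apply_eq_self, add_sub_cancel]

/-- A primitive that is bounded in the original coordinates is controlled by the oscillation of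
its control function. -/
theorem norm_apply_le_of_bounded (d : IsDichotomy 𝒱 W P K α) (fp : IsFundamentalPair η A 𝒱 W)
    (hv : IsPrimOn η univ (fun τ s => W s (f τ s)) v) (hm : Monotone m)
    (hf : ∀ τ, ∀ᶠ s in 𝓝 τ, ‖f τ s‖ ≤ |m s - m τ|) (hμ : ∀ s t, |m s - m t| ≤ μ)
    (hbdd : ∃ B, ∀ t, ‖𝒱 t (v t)‖ ≤ B) (t : ℝ) : ‖𝒱 t (v t)‖ ≤ 2 * K * μ := by
  obtain ⟨B, hB⟩ := hbdd
  have hB0 : 0 ≤ B := (norm_nonneg _).trans (hB 0)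
  have hK := d.K_pos
  have hα := d.α_pos
  have h1 : ‖𝒱 t (P (v t))‖ ≤ K * μ := by
    -- The increment from s to t costs K μ, whatever s is. The remaining term is the stable kernel
    -- applied to the bounded vector 𝒱 s (v s), and it decays as s → -∞.
    have key : ∀ s ≤ t, ‖𝒱 t (P (v t))‖ ≤ K * μ + K * Real.exp (-α * (t - s)) * B := by
      intro s hs
      have e : 𝒱 t (P (v t)) = 𝒱 t (P (v t - v s)) + (𝒱 t * P * W s) (𝒱 s (v s)) := by
        simp only [mul_apply_eq_comp, fp.inv_apply, map_sub, sub_add_cancel]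
      rw [e]
      refine (norm_add_le _ _).trans (add_le_add ?_ ?_)
      · refine (d.norm_stable_sub_le fp hv hm hf hs le_rfl).trans ?_
        gcongr
        exact (le_abs_self _).trans (hμ t s)
      · refine ((𝒱 t * P * W s).le_opNorm _).trans ?_
        gcongr
        exacts [d.stable t s hs, hB s]
    refine ge_of_tendsto (x := atBot) ?_ ((eventually_le_atBot t).mono key)
    have h2 : Tendsto (fun s : ℝ => -α * (t - s)) atBot atBot := by
      have : Tendsto (fun s : ℝ => α * s + -α * t) atBot atBot :=
        tendsto_atBot_add_const_right _ _ (tendsto_id.const_mul_atBot hα)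
      refine this.congr fun s => by ring
    have h3 := ((Real.tendsto_exp_atBot.comp h2).const_mul K).mul_const B
    simpa using h3.const_add (K * μ)
  have h2 : ‖𝒱 t ((1 - P) (v t))‖ ≤ K * μ := by
    have key : ∀ s > t, ‖𝒱 t ((1 - P) (v t))‖ ≤ K * μ + K * Real.exp (α * (t - s)) * B := by
      intro s hs
      have e : 𝒱 t ((1 - P) (v t))
          = -𝒱 t ((1 - P) (v s - v t)) + (𝒱 t * (1 - P) * W s) (𝒱 s (v s)) := by
        simp only [mul_apply_eq_comp, fp.inv_apply, map_sub]
        abel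
      rw [e]
      refine (norm_add_le _ _).trans (add_le_add ?_ ?_)
      · rw [norm_neg]
        refine (d.norm_unstable_sub_le fp hv hm hf le_rfl hs.le).trans ?_
        gcongr
        exact (le_abs_self _).trans (hμ s t)
      · refine ((𝒱 t * (1 - P) * W s).le_opNorm _).trans ?_
        gcongr
        exacts [d.unstable t s hs, hB s]
    refine ge_of_tendsto (x := atTop) ?_ ((eventually_gt_atTop t).mono key)
    have h2 : Tendsto (fun s : ℝ => α * (t - s)) atTop atBot := by
      have : Tendsto (fun s : ℝ => -α * s + α * t) atTop atBot :=
        tendsto_atBot_add_const_right _ _ (tendsto_id.const_mul_atTop_of_neg (by linarith))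
      refine this.congr fun s => by ring
    have h3 := ((Real.tendsto_exp_atBot.comp h2).const_mul K).mul_const B
    simpa using h3.const_add (K * μ)
  rw [apply_eq_add (P := P)]
  refine (norm_add_le _ _).trans ?_
  linarith

/-- A constant is a primitive of zero increments, whose control has oscillation 0. -/
theorem eq_zero_of_bounded (d : IsDichotomy 𝒱 W P K α) (fp : IsFundamentalPair η A 𝒱 W) {x : X}
    (hbdd : ∃ B, ∀ t, ‖𝒱 t x‖ ≤ B) : x = 0 := by
  have := d.norm_apply_le_of_bounded fp (f := fun _ _ => 0) (v := fun _ => x) (m := fun _ => 0)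
    (μ := 0) (fun ε hε τ _ => Eventually.of_forall fun s => by
      simp only [sub_self, map_zero, norm_zero]; positivity)
    monotone_const (fun τ => by simp) (by simp) hbdd 0
  rw [mul_zero, norm_le_zero_iff, fp.at_zero, one_apply_eq_self] at this
  exact this

/-- Every primitive becomes bounded in the original coordinates after subtracting a constant. -/
theorem exists_sub_bounded [CompleteSpace X] (d : IsDichotomy 𝒱 W P K α)
    (fp : IsFundamentalPair η A 𝒱 W)
    (hv : IsPrimOn η univ (fun τ s => W s (f τ s)) v) (hm : Monotone m)
    (hf : ∀ τ, ∀ᶠ s in 𝓝 τ, ‖f τ s‖ ≤ |m s - m τ|) (hμ : ∀ s t, |m s - m t| ≤ μ) :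
    ∃ c, ∀ t, ‖𝒱 t (v t - c)‖ ≤ 2 * K * μ := by
  have hK := d.K_pos
  have hbelow : BddBelow (range m) := ⟨m 0 - μ, by
    rintro _ ⟨s, rfl⟩
    linarith [le_abs_self (m 0 - m s), hμ 0 s]⟩
  have habove : BddAbove (range m) := ⟨m 0 + μ, by
    rintro _ ⟨s, rfl⟩
    linarith [le_abs_self (m s - m 0), hμ s 0]⟩
  -- Since 𝒱 0 = 1, the stable estimate at time 0 dominates increments of P v on (-∞, 0] by those of
  -- K m, which converges at -∞. Truncation by min s 0 extends the domination to all s.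
  obtain ⟨p, hp⟩ : ∃ p, Tendsto (fun s => P (v s)) atBot (𝓝 p) := by
    have h1 : ∀ r s, r ≤ s → ‖P (v (min s 0)) - P (v (min r 0))‖
        ≤ |K * m (min s 0) - K * m (min r 0)| := fun r s hrs => by
      have hle : min r 0 ≤ min s 0 := min_le_min_right 0 hrs
      have := d.norm_stable_sub_le fp hv hm hf hle (min_le_right s 0)
      rw [fp.at_zero, one_apply_eq_self, map_sub] at this
      rw [← mul_sub]
      exact this.trans (le_abs_self _)
    have h0 : ∀ s : ℝ, s ≤ 0 → min s 0 = s := fun s hs => min_eq_left hs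
    obtain ⟨p, hp⟩ := exists_tendsto_of_dominated (l := atBot) (η := fun s => K * m (min s 0))
      (y := fun s => P (v (min s 0)))
      (((tendsto_atBot_ciInf hm hbelow).const_mul K).congr' (by
        filter_upwards [eventually_le_atBot 0] with s hs
        rw [h0 s hs])) fun s r => by
        rcases le_total r s with h | h
        · exact h1 r s h
        · rw [norm_sub_rev, abs_sub_comm]
          exact h1 s r h
    refine ⟨p, hp.congr' ?_⟩
    filter_upwards [eventually_le_atBot 0] with s hs
    rw [h0 s hs]
  obtain ⟨q, hq⟩ : ∃ q, Tendsto (fun s => (1 - P) (v s)) atTop (𝓝 q) := by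
    have h1 : ∀ r s, r ≤ s → ‖(1 - P) (v (max s 0)) - (1 - P) (v (max r 0))‖
        ≤ |K * m (max s 0) - K * m (max r 0)| := fun r s hrs => by
      have hle : max r 0 ≤ max s 0 := max_le_max_right 0 hrs
      have := d.norm_unstable_sub_le fp hv hm hf (le_max_right r 0) hle
      rw [fp.at_zero, one_apply_eq_self, map_sub] at this
      rw [← mul_sub]
      exact this.trans (le_abs_self _)
    have h0 : ∀ s : ℝ, 0 ≤ s → max s 0 = s := fun s hs => max_eq_left hs
    obtain ⟨q, hq⟩ := exists_tendsto_of_dominated (l := atTop) (η := fun s => K * m (max s 0))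
      (y := fun s => (1 - P) (v (max s 0)))
      (((tendsto_atTop_ciSup hm habove).const_mul K).congr' (by
        filter_upwards [eventually_ge_atTop 0] with s hs
        rw [h0 s hs])) fun s r => by
        rcases le_total r s with h | h
        · exact h1 r s h
        · rw [norm_sub_rev, abs_sub_comm]
          exact h1 s r h
    refine ⟨q, hq.congr' ?_⟩
    filter_upwards [eventually_ge_atTop 0] with s hs
    rw [h0 s hs]
  have hPP : ∀ x, P (P x) = P x := fun x => by rw [← mul_apply_eq_comp, d.idem]
  have hPp : P p = p := by
    refine tendsto_nhds_unique ((P.continuous.tendsto p).comp hp) ?_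
    exact hp.congr fun s => (hPP _).symm
  have hPq : P q = 0 := by
    refine tendsto_nhds_unique ((P.continuous.tendsto q).comp hq) ?_
    refine tendsto_const_nhds.congr fun s => ?_
    simp [hPP]
  -- Subtracting p + q makes the stable part start from 0 at -∞ and the unstable part end at 0 at
  -- +∞, as for a Green function.
  refine ⟨p + q, fun t => ?_⟩
  have h1 : ‖𝒱 t (P (v t - (p + q)))‖ ≤ K * μ := by
    have hlim : Tendsto (fun s => ‖𝒱 t (P (v t) - P (v s))‖) atBot
        (𝓝 ‖𝒱 t (P (v t) - p)‖) :=
      (((𝒱 t).continuous.tendsto _).comp (tendsto_const_nhds.sub hp)).norm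
    rw [map_sub, map_add, hPp, hPq, add_zero]
    refine le_of_tendsto hlim ?_
    filter_upwards [eventually_le_atBot t] with s hs
    rw [← map_sub P]
    refine (d.norm_stable_sub_le fp hv hm hf hs le_rfl).trans ?_
    gcongr
    exact (le_abs_self _).trans (hμ t s)
  have h2 : ‖𝒱 t ((1 - P) (v t - (p + q)))‖ ≤ K * μ := by
    have hlim : Tendsto (fun s => ‖𝒱 t ((1 - P) (v t) - (1 - P) (v s))‖) atTop
        (𝓝 ‖𝒱 t ((1 - P) (v t) - q)‖) :=
      (((𝒱 t).continuous.tendsto _).comp (tendsto_const_nhds.sub hq)).norm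
    have e : (1 - P) (v t - (p + q)) = (1 - P) (v t) - q := by
      have : (1 - P) (p + q) = q := by
        simp only [sub_apply, one_apply_eq_self, map_add, hPp, hPq]
        abel
      rw [map_sub, this]
    rw [e]
    refine le_of_tendsto hlim ?_
    filter_upwards [eventually_ge_atTop t] with s hs
    rw [← map_sub (1 - P), ← neg_sub (v s), map_neg, map_neg, norm_neg]
    refine (d.norm_unstable_sub_le fp hv hm hf le_rfl hs).trans ?_
    gcongr
    exact (le_abs_self _).trans (hμ s t)
  rw [apply_eq_add (P := P)]
  refine (norm_add_le _ _).trans ?_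
  linarith

end IsDichotomy

/-- A control function which is `σ • h` on `[-T, T]` and `2 • h` outside. -/
theorem exists_truncated_control {h : ℝ → ℝ} (hmono : Monotone h) {δ σ T ε : ℝ}
    (hδ : ∀ s t, |h s - h t| ≤ δ) (hσ : 0 ≤ σ) (hT : 0 < T)
    (htop : ∀ s ≥ T, h s - h T ≤ ε) (hbot : ∀ s ≤ -T, h (-T) - h s ≤ ε) :
    ∃ m : ℝ → ℝ, Monotone m ∧ (∀ s t, |m s - m t| ≤ σ * δ + 4 * ε) ∧
      ∀ τ, ∀ᶠ s in 𝓝 τ, ∀ w : ℝ, w ≤ 2 * |h s - h τ| →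
        (τ ∈ Icc (-T) T → w ≤ σ * |h s - h τ|) → w ≤ |m s - m τ| := by
  have hcl : Monotone fun s => σ * h (max (-T) (min s T)) := fun s t hst =>
    mul_le_mul_of_nonneg_left (hmono (max_le_max_left _ (min_le_min_right _ hst))) hσ
  have hmax : Monotone fun s => 2 * h (max s T) := fun s t hst =>
    mul_le_mul_of_nonneg_left (hmono (max_le_max_right _ hst)) zero_le_two
  have hmin : Monotone fun s => 2 * h (min s (-T)) := fun s t hst =>
    mul_le_mul_of_nonneg_left (hmono (min_le_min_right _ hst)) zero_le_two
  -- Exactly one summand varies on each of the three regions. The middle one oscillates by at most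
  -- σδ and each tail by at most 2ε. The comparison is asked only for s near τ, hence within a
  -- single closed region.
  refine ⟨fun s => σ * h (max (-T) (min s T)) + 2 * h (max s T) + 2 * h (min s (-T)),
    (hcl.add hmax).add hmin, fun s t => ?_, fun τ => ?_⟩
  · have a1 : ∀ s, h T ≤ h (max s T) ∧ h (max s T) ≤ h T + ε := fun s =>
      ⟨hmono (le_max_right _ _), by linarith [htop _ (le_max_right s T)]⟩
    have a2 : ∀ s, h (min s (-T)) ≤ h (-T) ∧ h (-T) - ε ≤ h (min s (-T)) := fun s =>
      ⟨hmono (min_le_right _ _), by linarith [hbot _ (min_le_right s (-T))]⟩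
    have a3 := abs_le.1 (hδ (max (-T) (min s T)) (max (-T) (min t T)))
    have a4 := mul_le_mul_of_nonneg_left a3.1 hσ
    have a5 := mul_le_mul_of_nonneg_left a3.2 hσ
    have b1 := a1 s
    have b2 := a1 t
    have b3 := a2 s
    have b4 := a2 t
    rw [abs_le]
    constructor <;> nlinarith
  · have hcases : ∀ᶠ s in 𝓝 τ, (s ≤ -T ∧ τ ≤ -T) ∨ (s ∈ Icc (-T) T ∧ τ ∈ Icc (-T) T) ∨
        (T ≤ s ∧ T ≤ τ) := by
      rcases lt_trichotomy τ (-T) with h1 | h1 | h1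
      · filter_upwards [Iio_mem_nhds h1] with s hs using Or.inl ⟨le_of_lt hs, h1.le⟩
      · filter_upwards [Iio_mem_nhds (show τ < T by linarith)] with s hs
        rcases le_total s (-T) with h2 | h2
        · exact Or.inl ⟨h2, h1.le⟩
        · exact Or.inr (Or.inl ⟨⟨h2, le_of_lt hs⟩, ⟨h1.ge, by linarith⟩⟩)
      · rcases lt_trichotomy τ T with h2 | h2 | h2
        · filter_upwards [Ioo_mem_nhds h1 h2] with s hs
            using Or.inr (Or.inl ⟨⟨hs.1.le, hs.2.le⟩, ⟨h1.le, h2.le⟩⟩)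
        · filter_upwards [Ioi_mem_nhds h1] with s hs
          rcases le_total s T with h3 | h3
          · exact Or.inr (Or.inl ⟨⟨le_of_lt hs, h3⟩, ⟨h1.le, h2.le⟩⟩)
          · exact Or.inr (Or.inr ⟨h3, h2.ge⟩)
        · filter_upwards [Ioi_mem_nhds h2] with s hs using Or.inr (Or.inr ⟨le_of_lt hs, h2.le⟩)
    filter_upwards [hcases] with s hs w hw hw'
    have hTT : -T ≤ T := by linarith
    rcases hs with ⟨h1, h2⟩ | ⟨h1, h2⟩ | ⟨h1, h2⟩
    · refine hw.trans (le_of_eq ?_)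
      rw [max_eq_right (h1.trans hTT), max_eq_right (h2.trans hTT), min_eq_left h1,
        min_eq_left h2, min_eq_left (h1.trans hTT), min_eq_left (h2.trans hTT),
        max_eq_left h1, max_eq_left h2, add_sub_add_left_eq_sub, ← mul_sub, abs_mul, abs_two]
    · refine (hw' h2).trans (le_of_eq ?_)
      rw [max_eq_right h1.2, max_eq_right h2.2, min_eq_right h1.1, min_eq_right h2.1,
        min_eq_left h1.2, min_eq_left h2.2, max_eq_right h1.1, max_eq_right h2.1,
        add_sub_add_right_eq_sub, add_sub_add_right_eq_sub, ← mul_sub, abs_mul,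
        abs_of_nonneg hσ]
    · refine hw.trans (le_of_eq ?_)
      rw [max_eq_left h1, max_eq_left h2, min_eq_right (hTT.trans h1),
        min_eq_right (hTT.trans h2), min_eq_right h1, min_eq_right h2, add_sub_add_right_eq_sub,
        add_sub_add_left_eq_sub, ← mul_sub, abs_mul, abs_two]

theorem exists_small_tails {h : ℝ → ℝ} (hmono : Monotone h) {δ ε : ℝ}
    (hδ : ∀ s t, |h s - h t| ≤ δ) (hε : 0 < ε) (T₀ : ℝ) :
    ∃ T > 0, T₀ ≤ T ∧ (∀ s ≥ T, h s - h T ≤ ε) ∧ ∀ s ≤ -T, h (-T) - h s ≤ ε := by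
  have hbelow : BddBelow (range h) := ⟨h 0 - δ, by
    rintro _ ⟨s, rfl⟩
    linarith [le_abs_self (h 0 - h s), hδ 0 s]⟩
  have habove : BddAbove (range h) := ⟨h 0 + δ, by
    rintro _ ⟨s, rfl⟩
    linarith [le_abs_self (h s - h 0), hδ s 0]⟩
  have h1 := (tendsto_atTop_ciSup hmono habove).eventually
    (lt_mem_nhds (sub_lt_self (⨆ i, h i) hε))
  have h2 := (((tendsto_atBot_ciInf hmono hbelow).comp tendsto_neg_atTop_atBot).eventually
    (gt_mem_nhds (lt_add_of_pos_right (⨅ i, h i) hε)))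
  obtain ⟨T, hT1, hT2, hT3, hT4⟩ := (h1.and (h2.and ((eventually_gt_atTop 0).and
    (eventually_ge_atTop T₀)))).exists
  refine ⟨T, hT3, hT4, fun s _ => ?_, fun s _ => ?_⟩
  · linarith [le_ciSup habove s]
  · simp only [Function.comp] at hT2
    linarith [ciInf_le hbelow s]

namespace IsDichotomy

variable [CompleteSpace X]

/-- Comparison of two nonlinear solutions with their asymptotic linear solutions. -/
theorem norm_sub_sub_le (d : IsDichotomy 𝒱 W P K α) (fp : IsFundamentalPair η A 𝒱 W)
    (hJ : HasInvertibleJumps A C) (hC : 0 < C) (hF : InClassF F h) (hmono : Monotone h)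
    (hδ : ∀ s t, |h s - h t| ≤ δ) (hy : IsLocalSolutionOn η A F univ y)
    (hy' : IsLocalSolutionOn η A F univ y') {u u' : X} (hu : ∃ B, ∀ t, ‖y t - 𝒱 t u‖ ≤ B)
    (hu' : ∃ B, ∀ t, ‖y' t - 𝒱 t u'‖ ≤ B) {σ T ε : ℝ} (hσ : 0 ≤ σ) (hT : 0 < T)
    (htop : ∀ s ≥ T, h s - h T ≤ ε) (hbot : ∀ s ≤ -T, h (-T) - h s ≤ ε)
    (hyy : ∀ t ∈ Icc (-T) T, ‖y t - y' t‖ ≤ σ) (t : ℝ) :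
    ‖(y t - 𝒱 t u) - (y' t - 𝒱 t u')‖ ≤ 2 * K * (σ * δ + 4 * ε) := by
  obtain ⟨B, hB⟩ := hu
  obtain ⟨B', hB'⟩ := hu'
  obtain ⟨m, hm, hmosc, hmloc⟩ := exists_truncated_control hmono hδ hσ hT htop hbot
  have hv : IsPrimOn η univ (fun τ s => W s (incr F y τ s - incr F y' τ s))
      (fun t => W t (y t) - W t (y' t) - (u - u')) :=
    (((fp.isPrimOn_inv hJ hC hy).sub (fp.isPrimOn_inv hJ hC hy')).congr
      (fun τ _ s _ => (map_sub _ _ _).symm) fun _ _ => rfl).sub_const _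
  have e : ∀ t, 𝒱 t (W t (y t) - W t (y' t) - (u - u'))
      = (y t - 𝒱 t u) - (y' t - 𝒱 t u') := fun t => by
    simp only [map_sub, fp.apply_inv]; abel
  have := d.norm_apply_le_of_bounded fp hv hm (fun τ => ?_) hmosc ⟨B + B', fun t => ?_⟩ t
  · rwa [e] at this
  · filter_upwards [hmloc τ] with s hs
    -- Outside [-T, T] the two increments are bounded separately, hence the factor 2; inside, the
    -- Lipschitz condition on F supplies σ.
    refine hs _ ?_ fun hτ => ?_
    · have h1 := hF.norm_incr_le y τ s
      have h2 := hF.norm_incr_le y' τ s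
      refine (norm_sub_le _ _).trans ?_
      linarith
    · refine (hF.norm_incr_sub_le _ _ _ _).trans ?_
      gcongr
      exact hyy τ hτ
  · rw [e]
    exact (norm_sub_le _ _).trans (add_le_add (hB t) (hB' t))

/-- Here closeness on [-T, T] is assumed for the linear solutions only. If B bounds the difference
to be estimated, the preceding estimate applies with σ + B, and 2Kδ ≤ 1 / 4 allows B to be absorbed.
-/
theorem norm_sub_sub_le' (d : IsDichotomy 𝒱 W P K α) (fp : IsFundamentalPair η A 𝒱 W)
    (hJ : HasInvertibleJumps A C) (hC : 0 < C) (hF : InClassF F h) (hmono : Monotone h)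
    (hδ : ∀ s t, |h s - h t| ≤ δ) (hKδ : K * δ ≤ 1 / 8) (hy : IsLocalSolutionOn η A F univ y)
    (hy' : IsLocalSolutionOn η A F univ y') {u u' : X} (hu : ∃ B, ∀ t, ‖y t - 𝒱 t u‖ ≤ B)
    (hu' : ∃ B, ∀ t, ‖y' t - 𝒱 t u'‖ ≤ B) {σ T ε : ℝ} (hσ : 0 ≤ σ) (hT : 0 < T)
    (htop : ∀ s ≥ T, h s - h T ≤ ε) (hbot : ∀ s ≤ -T, h (-T) - h s ≤ ε)
    (huu : ∀ t ∈ Icc (-T) T, ‖𝒱 t (u - u')‖ ≤ σ) (t : ℝ) :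
    ‖(y t - 𝒱 t u) - (y' t - 𝒱 t u')‖ ≤ 2 * (σ + 8 * K * ε) := by
  refine le_two_mul_of_forall_bound (S := univ)
    (w := fun t => ‖(y t - 𝒱 t u) - (y' t - 𝒱 t u')‖) ?_ (fun B hB t _ => ?_) t (mem_univ t)
  · obtain ⟨B, hB⟩ := hu
    obtain ⟨B', hB'⟩ := hu'
    exact ⟨B + B', fun t _ => (norm_sub_le _ _).trans (add_le_add (hB t) (hB' t))⟩
  · have hB0 : 0 ≤ B := (norm_nonneg _).trans (hB 0 (mem_univ 0))
    refine (d.norm_sub_sub_le fp hJ hC hF hmono hδ hy hy' hu hu' (σ := σ + B) (by positivity) hT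
      htop hbot (fun s hs => ?_) t).trans ?_
    · have e : y s - y' s = 𝒱 s (u - u') + ((y s - 𝒱 s u) - (y' s - 𝒱 s u')) := by
        rw [map_sub]; abel
      rw [e]
      exact (norm_add_le _ _).trans (add_le_add (huu s hs) (hB s (mem_univ s)))
    · nlinarith [mul_le_mul_of_nonneg_left hKδ (add_nonneg hσ hB0)]

/-- With the same linear solution on both sides σ = 0, so only the tail contribution remains, and it
is arbitrarily small. -/
theorem solution_unique (d : IsDichotomy 𝒱 W P K α) (fp : IsFundamentalPair η A 𝒱 W)
    (hJ : HasInvertibleJumps A C) (hC : 0 < C) (hF : InClassF F h) (hmono : Monotone h)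
    (hδ : ∀ s t, |h s - h t| ≤ δ) (hKδ : K * δ ≤ 1 / 8) (hy : IsLocalSolutionOn η A F univ y)
    (hy' : IsLocalSolutionOn η A F univ y') {u : X} (hu : ∃ B, ∀ t, ‖y t - 𝒱 t u‖ ≤ B)
    (hu' : ∃ B, ∀ t, ‖y' t - 𝒱 t u‖ ≤ B) : y = y' := by
  have hK := d.K_pos
  funext t
  rw [← sub_eq_zero, ← norm_le_zero_iff]
  refine le_of_forall_pos_le_add fun ε hε => ?_
  obtain ⟨T, hT, -, htop, hbot⟩ := exists_small_tails hmono hδ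
    (show 0 < ε / (16 * K) by positivity) 0
  have := d.norm_sub_sub_le' fp hJ hC hF hmono hδ hKδ hy hy' hu hu' le_rfl hT htop hbot
    (by simp) t
  rw [sub_sub_sub_cancel_right] at this
  refine this.trans (le_of_eq ?_)
  field_simp
  ring

/-- The fixed point argument with boundedness of 𝒱 v as normalization. Subtracting a constant
achieves it, and the contraction factor is 2Kδ ≤ 1 / 4. -/
theorem exists_solution_near (d : IsDichotomy 𝒱 W P K α) (fp : IsFundamentalPair η A 𝒱 W)
    (hJ : HasInvertibleJumps A C) (hC : 0 < C) (hF : InClassF F h) (hmono : Monotone h)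
    (hh : ∀ s t, |h s - h t| ≤ |η s - η t|) (hδ : ∀ s t, |h s - h t| ≤ δ) (hKδ : K * δ ≤ 1 / 8)
    (u : X) : ∃ y, IsLocalSolutionOn η A F univ y ∧ ∀ t, ‖y t - 𝒱 t u‖ ≤ 2 * K * δ := by
  obtain ⟨v, hv, hvb⟩ := fp.exists_solution hJ hC hF hmono hh (S := univ) ordConnected_univ
    (N := fun v => ∃ B, ∀ t, ‖𝒱 t (v t)‖ ≤ B) (fun v v' ⟨B, hB⟩ ⟨B', hB'⟩ =>
      ⟨B + B', fun t => by
        rw [map_sub]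
        exact (norm_sub_le _ _).trans (add_le_add (hB t) (hB' t))⟩) (fun y hy => by
      obtain ⟨g, hg⟩ := exists_isPrimOn_univ fp.mono fun R => by
        simpa only [univ_inter] using fp.isAlmostAdditiveOn_incr hJ hC hF hh hy R
      obtain ⟨c, hc⟩ := d.exists_sub_bounded fp hg hmono
        (fun τ => Eventually.of_forall (hF.norm_incr_le y τ)) hδ
      exact ⟨_, hg.sub_const c, _, hc⟩) (fun f v B hB hv hvb hf t _ => by
      have := d.norm_apply_le_of_bounded fp hv (m := fun t => B * h t)
        (fun s t hst => mul_le_mul_of_nonneg_left (hmono hst) hB)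
        (fun τ => Eventually.of_forall fun s => by
          rw [← mul_sub, abs_mul, abs_of_nonneg hB]
          exact hf τ (mem_univ _) s (mem_univ _))
        (μ := B * δ) (fun s t => by
          rw [← mul_sub, abs_mul, abs_of_nonneg hB]
          exact mul_le_mul_of_nonneg_left (hδ s t) hB) hvb t
      nlinarith [mul_le_mul_of_nonneg_left hKδ hB]) u
  refine ⟨_, fp.isLocalSolutionOn_of_prim hJ hC hv, fun t => ?_⟩
  rw [← map_sub, add_sub_cancel_left]
  exact d.norm_apply_le_of_bounded fp hv hmono
    (fun τ => Eventually.of_forall (hF.norm_incr_le _ τ)) hδ hvb t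

theorem exists_linear_near (d : IsDichotomy 𝒱 W P K α) (fp : IsFundamentalPair η A 𝒱 W)
    (hJ : HasInvertibleJumps A C) (hC : 0 < C) (hF : InClassF F h) (hmono : Monotone h)
    (hδ : ∀ s t, |h s - h t| ≤ δ) (hy : IsLocalSolutionOn η A F univ y) :
    ∃ u, ∀ t, ‖y t - 𝒱 t u‖ ≤ 2 * K * δ := by
  obtain ⟨c, hc⟩ := d.exists_sub_bounded fp (fp.isPrimOn_inv hJ hC hy) hmono
    (fun τ => Eventually.of_forall (hF.norm_incr_le y τ)) hδ
  exact ⟨c, fun t => by simpa only [map_sub, fp.apply_inv] using hc t⟩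

end IsDichotomy

end Dichotomy

/-! ### Assembly of the conjugacy. -/

section Conjugacy

variable {X : Type*} [NormedAddCommGroup X] [NormedSpace ℝ X]
  {η h : ℝ → ℝ} {A 𝒱 W : ℝ → X →L[ℝ] X} {C δ K α : ℝ} {F : X → ℝ → X} {P : X →L[ℝ] X}

theorem HasExponentialDichotomy.exists_isDichotomy (hd : HasExponentialDichotomy A K α)
    (hη : Monotone η) (hA : ∀ s t, ‖A s - A t‖ ≤ |η s - η t|) (hJ : HasInvertibleJumps A C) :
    ∃ (𝒱 W : ℝ → X →L[ℝ] X) (P : X →L[ℝ] X), IsFundamentalPair η A 𝒱 W ∧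
      IsDichotomy 𝒱 W P K α := by
  obtain ⟨hK, hα, V, hV, P, hP, h1, h2⟩ := hd
  exact ⟨_, _, P, hV.isFundamentalPair hη hA hJ, ⟨hK, hα, hP, h1, h2⟩⟩

/-- A common control function for `A` and `h`. -/
theorem exists_control (hA : LocallyBoundedVariationOn A univ) (hmono : Monotone h) :
    ∃ η : ℝ → ℝ, Monotone η ∧ ∀ s t, ‖A s - A t‖ + |h s - h t| ≤ |η s - η t| := by
  have hv : Monotone (variationOnFromTo A univ 0) :=
    monotoneOn_univ.1 (variationOnFromTo.monotoneOn hA (mem_univ 0))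
  refine ⟨fun t => variationOnFromTo A univ 0 t + h t, hv.add hmono, fun s t => ?_⟩
  wlog hst : t ≤ s generalizing s t
  · rw [norm_sub_rev, abs_sub_comm, abs_sub_comm (variationOnFromTo A univ 0 s + h s)]
    exact this t s (le_of_not_ge hst)
  have h1 : ‖A s - A t‖ ≤ variationOnFromTo A univ 0 s - variationOnFromTo A univ 0 t := by
    rw [← variationOnFromTo.add hA (mem_univ 0) (mem_univ t) (mem_univ s), add_sub_cancel_left,
      variationOnFromTo.eq_of_le _ _ hst, ← dist_eq_norm]
    exact BoundedVariationOn.dist_le (hA t s (mem_univ t) (mem_univ s))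
      ⟨mem_univ s, hst, le_rfl⟩ ⟨mem_univ t, le_rfl, hst⟩
  rw [abs_of_nonneg (sub_nonneg.2 (hmono hst)), abs_of_nonneg (by linarith [hv hst, hmono hst])]
  linarith

theorem isGODESolution_linear_iff (hη : Monotone η) (hA : ∀ s t, ‖A s - A t‖ ≤ |η s - η t|)
    {x : ℝ → X} : IsGODESolution (fun x t => A t x) x ↔
      IsPrimOn η univ (fun τ s => A s (x τ) - A τ (x τ)) x := by
  have hdist : ∀ (y : X) (s t : ℝ), ‖A s y - A t y‖ ≤ ‖y‖ * |η s - η t| := fun y s t => by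
    rw [← sub_apply, mul_comm]
    exact ((A s - A t).le_opNorm y).trans (by gcongr; exact hA s t)
  refine ⟨fun hx => hx.isPrimOn hη (k := fun y => ‖y‖) (fun _ => norm_nonneg _) hdist
    fun y z s t => ?_,
    fun hx => isGODESolution_of_isPrimOn (G := fun x t => A t x) hη hx⟩
  have e : A s y - A t y - A s z + A t z = A s (y - z) - A t (y - z) := by
    rw [map_sub, map_sub]; abel
  rw [e]
  exact hdist _ _ _

theorem isGODESolution_nonlinear_iff (hη : Monotone η)
    (hA : ∀ s t, ‖A s - A t‖ + |h s - h t| ≤ |η s - η t|) (hF : InClassF F h) {x : ℝ → X} :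
    IsGODESolution (fun x t => A t x + F x t) x ↔ IsLocalSolutionOn η A F univ x := by
  have hdist : ∀ (y : X) (s t : ℝ), ‖A s y - A t y‖ ≤ ‖A s - A t‖ * ‖y‖ := fun y s t => by
    rw [← sub_apply]
    exact (A s - A t).le_opNorm y
  have he : ∀ τ s, (A s (x τ) + F (x τ) s) - (A τ (x τ) + F (x τ) τ)
      = A s (x τ) - A τ (x τ) + incr F x τ s := fun τ s => by unfold incr; abel
  constructor
  · intro hx
    have := hx.isPrimOn hη (k := fun y => ‖y‖ + 1) (fun y => by positivity) (fun y s t => ?_)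
      fun y z s t => ?_
    · unfold IsLocalSolutionOn
      simpa only [he] using this
    · have e : A s y + F y s - (A t y + F y t) = (A s y - A t y) + (F y s - F y t) := by abel
      rw [e]
      have h1 := hF.1 y t s
      have h2 := hdist y s t
      refine (norm_add_le _ _).trans ?_
      have h3 := hA s t
      nlinarith [norm_nonneg y, norm_nonneg (A s - A t), abs_nonneg (h s - h t)]
    · have e : A s y + F y s - (A t y + F y t) - (A s z + F z s) + (A t z + F z t)
          = (A s (y - z) - A t (y - z)) + (F y s - F y t - F z s + F z t) := by
        rw [map_sub, map_sub]; abel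
      rw [e]
      refine (norm_add_le _ _).trans ((add_le_add (hdist (y - z) s t) (hF.2 y z t s)).trans ?_)
      rw [mul_comm ‖A s - A t‖, ← mul_add]
      gcongr
      exact hA s t
  · intro hx
    refine isGODESolution_of_isPrimOn (G := fun x t => A t x + F x t) hη ?_
    unfold IsLocalSolutionOn at hx
    simpa only [he] using hx

/-- Topological conjugacy for sufficiently small nonlinear perturbations. -/
theorem IsDichotomy.exists_conjugacy [CompleteSpace X] (d : IsDichotomy 𝒱 W P K α)
    (fp : IsFundamentalPair η A 𝒱 W) (hJ : HasInvertibleJumps A C) (hC : 0 < C)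
    (hF : InClassF F h) (hmono : Monotone h)
    (hA : ∀ s t, ‖A s - A t‖ + |h s - h t| ≤ |η s - η t|) (hδ : ∀ s t, |h s - h t| ≤ δ)
    (hKδ : K * δ ≤ 1 / 8) (hCδ : (C + 2) * δ ≤ 1 / 2) :
    ∃ Φ Ψ : ℝ → X → X,
      IsTopologicalConjugacy (fun x t => A t x) (fun x t => A t x + F x t) Φ Ψ := by
  have hK := d.K_pos
  have hδ0 : 0 ≤ δ := (abs_nonneg _).trans (hδ 0 0)
  have hη := fp.mono
  have hA' := fp.norm_sub_le
  have hh : ∀ s t, |h s - h t| ≤ |η s - η t| := fun s t =>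
    (le_add_of_nonneg_left (norm_nonneg _)).trans (hA s t)
  -- Three correspondences are set up: Y u is the perturbed solution near 𝒱 u, U y labels the linear
  -- solution near y, and Z t x is the perturbed solution through (t, x).
  have hflow : ∀ a b, a ≤ b → HasFlow η A F a b := fun a b hab =>
    fp.hasFlow hJ hC hF hmono hh hδ hCδ hab
  choose Y hY hYb using d.exists_solution_near fp hJ hC hF hmono hh hδ hKδ
  choose Z hZ hZc using exists_global_solution hflow
  have hU : ∀ y, ∃ u, IsLocalSolutionOn η A F univ y → ∀ t, ‖y t - 𝒱 t u‖ ≤ 2 * K * δ := by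
    intro y
    by_cases hy : IsLocalSolutionOn η A F univ y
    · obtain ⟨u, hu⟩ := d.exists_linear_near fp hJ hC hF hmono hδ hy
      exact ⟨u, fun _ => hu⟩
    · exact ⟨0, fun h => absurd h hy⟩
  choose U hU using hU
  have hflow_unique : ∀ y y' c, IsLocalSolutionOn η A F univ y → IsLocalSolutionOn η A F univ y' →
      y c = y' c → y = y' := by
    intro y y' c hy hy' hc
    funext t
    obtain ⟨L, -, hL⟩ := exists_lipschitz_of_hasFlow hflow c (abs_nonneg (t - c))
    have := hL y y' (hy.mono (subset_univ _)) (hy'.mono (subset_univ _)) t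
      ⟨by linarith [neg_abs_le (t - c)], by linarith [le_abs_self (t - c)]⟩
    rw [hc, sub_self, norm_zero, mul_zero, norm_le_zero_iff] at this
    exact sub_eq_zero.1 this
  have hYU : ∀ y, IsLocalSolutionOn η A F univ y → Y (U y) = y := fun y hy =>
    d.solution_unique fp hJ hC hF hmono hδ hKδ (hY _) hy ⟨_, hYb _⟩ ⟨_, hU y hy⟩
  have hUY : ∀ u, U (Y u) = u := by
    intro u
    rw [← sub_eq_zero]
    refine d.eq_zero_of_bounded fp ⟨2 * K * δ + 2 * K * δ, fun t => ?_⟩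
    have e : 𝒱 t (U (Y u) - u) = (Y u t - 𝒱 t u) - (Y u t - 𝒱 t (U (Y u))) := by
      rw [map_sub]; abel
    rw [e]
    exact (norm_sub_le _ _).trans (add_le_add (hYb u t) (hU _ (hY u) t))
  have hZy : ∀ y t, IsLocalSolutionOn η A F univ y → Z t (y t) = y := fun y t hy =>
    hflow_unique _ _ t (hZ _ _) hy (hZc _ _)
  refine ⟨fun t x => Y (W t x) t, fun t x => 𝒱 t (U (Z t x)), ?_, ?_, fun t x => ?_,
    fun t x => ?_, ⟨2 * K * δ, fun t x => ?_⟩, ⟨2 * K * δ, fun t x => ?_⟩, fun x hx => ?_,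
    fun y hy => ?_⟩
  · intro t
    rw [Metric.continuous_iff]
    intro x ε hε
    -- The tails contribute 2 · 8K · ε / (64K) = ε / 4. On [-T, T] the linear solutions differ by at
    -- most L ‖x' - x‖, so the total is at most (2L + 1) ‖x' - x‖ + ε / 4.
    obtain ⟨T, hT, -, htop, hbot⟩ := exists_small_tails hmono hδ
      (show 0 < ε / (64 * K) by positivity) 0
    obtain ⟨M, hM1, hM⟩ := fp.exists_bound hJ hC T
    set L := M * ‖W t‖ with hL
    have hL0 : 0 ≤ L := by positivity
    refine ⟨ε / (4 * (2 * L + 1)), by positivity, fun x' hx' => ?_⟩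
    rw [dist_eq_norm] at hx' ⊢
    have h1 := d.norm_sub_sub_le' fp hJ hC hF hmono hδ hKδ (hY (W t x')) (hY (W t x))
      ⟨_, hYb _⟩ ⟨_, hYb _⟩ (σ := L * ‖x' - x‖) (by positivity) hT htop hbot (fun s hs => by
        rw [← map_sub, hL, mul_assoc]
        refine ((𝒱 s).le_opNorm _).trans ?_
        gcongr
        exacts [(hM s hs).1, (W t).le_opNorm _]) t
    rw [fp.apply_inv, fp.apply_inv] at h1
    have e : Y (W t x') t - Y (W t x) t = (Y (W t x') t - x' - (Y (W t x) t - x)) + (x' - x) := by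
      abel
    rw [e]
    refine (norm_add_le _ _).trans_lt ?_
    rw [lt_div_iff₀ (by positivity)] at hx'
    have h2 : 8 * K * (ε / (64 * K)) = ε / 8 := by field_simp; norm_num
    rw [h2] at h1
    nlinarith [norm_nonneg (x' - x)]
  · intro t
    rw [Metric.continuous_iff]
    intro x ε hε
    obtain ⟨T, hT, -, htop, hbot⟩ := exists_small_tails hmono hδ
      (show 0 < ε / (64 * K) by positivity) 0
    -- For Ψ it is the perturbed solutions that must be close on [-T, T]. The radius T + |t| makes
    -- the interval centred at t contain it.
    obtain ⟨L, hL0, hL⟩ := exists_lipschitz_of_hasFlow hflow t (R := T + |t|) (by positivity)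
    have hsub : Icc (-T) T ⊆ Icc (t - (T + |t|)) (t + (T + |t|)) := Icc_subset_Icc
      (by linarith [le_abs_self t]) (by linarith [neg_abs_le t])
    refine ⟨ε / (4 * (2 * L + 1)), by positivity, fun x' hx' => ?_⟩
    rw [dist_eq_norm] at hx' ⊢
    have h1 := d.norm_sub_sub_le fp hJ hC hF hmono hδ (hZ t x') (hZ t x)
      ⟨_, hU _ (hZ t x')⟩ ⟨_, hU _ (hZ t x)⟩ (σ := L * ‖x' - x‖) (by positivity) hT htop hbot
      (fun s hs => by
        have := hL _ _ ((hZ t x').mono (subset_univ _)) ((hZ t x).mono (subset_univ _)) s (hsub hs)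
        rwa [hZc, hZc] at this) t
    rw [hZc, hZc] at h1
    have e : 𝒱 t (U (Z t x')) - 𝒱 t (U (Z t x))
        = (x' - x) - (x' - 𝒱 t (U (Z t x')) - (x - 𝒱 t (U (Z t x)))) := by abel
    rw [e]
    refine (norm_sub_le _ _).trans_lt ?_
    rw [lt_div_iff₀ (by positivity)] at hx'
    have h2 : 2 * K * (L * ‖x' - x‖ * δ + 4 * (ε / (64 * K)))
        = 2 * (K * δ) * (L * ‖x' - x‖) + ε / 8 := by field_simp; ring
    rw [h2] at h1
    have h3 : 2 * (K * δ) * (L * ‖x' - x‖) ≤ 2 * (1 / 8) * (L * ‖x' - x‖) := by gcongr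
    have h4 : 0 ≤ L * ‖x' - x‖ := by positivity
    nlinarith [norm_nonneg (x' - x)]
  · rw [hZy _ t (hY _), hUY, fp.apply_inv]
  · rw [fp.inv_apply, hYU _ (hZ _ _), hZc]
  · have := hYb (W t x) t
    rwa [fp.apply_inv] at this
  · have := hU _ (hZ t x) t
    rwa [hZc, norm_sub_rev] at this
  · have hx' := (isGODESolution_linear_iff hη hA').1 hx
    have hx'' : ∀ t, x t = 𝒱 t (x 0) := linear_unique hη hA' hJ hx' (fp.isPrimOn_apply (x 0))
      (s := 0) (by rw [fp.at_zero, one_apply_eq_self])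
    have e : (fun t => Y (W t (x t)) t) = Y (x 0) := funext fun t => by
      rw [hx'' t, fp.inv_apply]
    change IsGODESolution _ (fun t => Y (W t (x t)) t)
    rw [e]
    exact (isGODESolution_nonlinear_iff hη hA hF).2 (hY _)
  · have hy' := (isGODESolution_nonlinear_iff hη hA hF).1 hy
    have e : (fun t => 𝒱 t (U (Z t (y t)))) = fun t => 𝒱 t (U y) := funext fun t => by
      rw [hZy y t hy']
    change IsGODESolution _ (fun t => 𝒱 t (U (Z t (y t))))
    rw [e]
    exact (isGODESolution_linear_iff hη hA').2 (fp.isPrimOn_apply (U y))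

end Conjugacy

theorem theorem4p1 {X : Type*} [NormedAddCommGroup X] [NormedSpace ℝ X] [CompleteSpace X]
    (K C : ℝ) (hC : 0 < C) :
    ∃ δ : ℝ, 0 < δ ∧
      ∀ (α : ℝ) (A : ℝ → X →L[ℝ] X) (F : X → ℝ → X) (h : ℝ → ℝ),
        LocallyBoundedVariationOn A univ →
        JumpsInvertible A C →
        HasExponentialDichotomy A K α →
        Monotone h →
        InClassF F h →
        eVariationOn h univ ≤ ENNReal.ofReal δ →
        ∃ Φ Ψ : ℝ → X → X,
          IsTopologicalConjugacy (fun x t => A t x) (fun x t => A t x + F x t) Φ Ψ := by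
  have hpos : 0 < |K| + C + 2 := by positivity
  -- This choice gives both Kδ ≤ 1 / 8 and (C + 2)δ ≤ 1 / 2. The absolute value is there because K >
  -- 0 becomes known only through the dichotomy, after δ is fixed.
  refine ⟨1 / (8 * (|K| + C + 2)), by positivity, fun α A F h hA hJ hd hmono hF hvar => ?_⟩
  obtain ⟨η, hη, hAh⟩ := exists_control hA hmono
  have hA' : ∀ s t, ‖A s - A t‖ ≤ |η s - η t| := fun s t =>
    (le_add_of_nonneg_right (abs_nonneg _)).trans (hAh s t)
  have hJ' := hJ.hasInvertibleJumps hη hA'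
  obtain ⟨𝒱, W, P, fp, d⟩ := hd.exists_isDichotomy hη hA' hJ'
  refine d.exists_conjugacy fp hJ' hC hF hmono hAh (δ := 1 / (8 * (|K| + C + 2)))
    (fun s t => ?_) ?_ ?_
  · have := (eVariationOn.edist_le h (mem_univ s) (mem_univ t)).trans hvar
    rw [edist_dist, Real.dist_eq] at this
    exact (ENNReal.ofReal_le_ofReal_iff (by positivity)).1 this
  · rw [mul_one_div, div_le_div_iff₀ (by positivity) (by norm_num)]
    linarith [le_abs_self K]
  · rw [mul_one_div, div_le_div_iff₀ (by positivity) (by norm_num)]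
    linarith [abs_nonneg K]
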